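/- **Setting.** Let $k\ge 6$ and $\varphi(x)=|x|^2$ on $\mathbb R^6$. For $0\le l\le 4$ let $V_l=\odot^{k-l}\mathbb C^4\otimes\wedge^l\mathbb C^4\subset\otimes^k\mathbb C^4$, whose elements are tensors $(\xi^{A_1\dots A_l}_{B_1\dots B_{k-l}})$, with indices in $\{1,2,3,4\}$, symmetric in the $B$'s and antisymmetric in the $A$'s, with the Hermitian inner product of $\otimes^k\mathbb C^4$. Let $\mathscr V_l\subset V_l$ be the kernel of the contraction $\mathscr C(\xi)^{A_2\dots A_l}_{B_1\dots B_{k-l-1}}=\sum_{C}\xi^{C A_2\dots A_l}_{B_1\dots B_{k-l-1}C}$ (with $\mathscr V_0=V_0$). Let $(\nabla^{AB})$ be the antisymmetric matrix of vector fields with entries above the diagonal $$\nabla^{12}=i\partial_{x^0}+\partial_{x^5},\quad \nabla^{13}=\partial_{x^3}+i\partial_{x^4},\quad \nabla^{14}=\partial_{x^1}+i\partial_{x^2},\quad \nabla^{23}=\partial_{x^1}-i\partial_{x^2},\quad \nabla^{24}=-\partial_{x^3}+i\partial_{x^4},\quad \nabla^{34}=-i\partial_{x^0}+\partial_{x^5}.$$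 For smooth $\mathscr V_l$-valued $f$ put $$(\mathscr D_lf)^{A_1\dots A_{l+1}}_{B_2\dots B_{k-l}}=\sum_{B_1}\nabla^{B_1[A_1}f^{A_2\dots A_{l+1}]}_{B_1B_2\dots B_{k-l}},$$ where $[\cdots]$ is antisymmetrization, normalized by $1/(l+1)!$; this is $\mathscr V_{l+1}$-valued. Let $L^2_\varphi(\mathbb R^6,\mathscr V_l)$ be the Hilbert space of $\mathscr V_l$-valued functions with inner product $\langle f,h\rangle_\varphi=\int_{\mathbb R^6}\langle f(x),h(x)\rangle e^{-|x|^2}\,dx$ and norm $\|\cdot\|_\varphi$, and let $\Theta_l:C_0^\infty(\mathbb R^6,\mathscr V_{l+1})\to C_0^\infty(\mathbb R^6,\mathscr V_l)$ be the formal adjoint of $\mathscr D_l$ with respect to these inner products. Extend $\mathscr D_l$ to the operator $L^2_\varphi(\mathbb R^6,\mathscr V_l)\to L^2_\varphi(\mathbb R^6,\mathscr V_{l+1})$ whose domain $\mathrm{Dom}(\mathscr D_l)$ consists of the $f$ for which there is $u\in L^2_\varphi(\mathbb R^6,\mathscr V_{l+1})$ with $\langle u,g\rangle_\varphi=\langle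 f,\Theta_lg\rangle_\varphi$ for all $g\in C_0^\infty(\mathbb R^6,\mathscr V_{l+1})$; then $\mathscr D_lf:=u$. Let $\mathscr D_l^*$ be the Hilbert space adjoint of this densely defined operator. **Theorem.** For every integer $k\ge 6$ there is a constant $C>0$ depending only on $k$ such that, for $l=1,2,3$ and every $f\in\mathrm{Dom}(\mathscr D_l)\cap\mathrm{Dom}(\mathscr D_{l-1}^*)$, $$\|f\|_\varphi^2\le C\left(\|\mathscr D_lf\|_\varphi^2+\|\mathscr D_{l-1}^*f\|_\varphi^2\right).$$ -/

import Mathlib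

open MeasureTheory
open scoped ContDiff ComplexConjugate

noncomputable section

namespace Monogenic

/-- The Euclidean space `ℝ⁶`. -/
abbrev E6 : Type := EuclideanSpace ℝ (Fin 6)

/-! ### Tensors -/

/-- Tensors `ξ^{A₁…A_q}_{B₁…B_p}` with all indices in `{1,2,3,4}`, that is `⊗^{p+q} ℂ⁴` with its
standard Hermitian inner product. An index is a pair `(A, B)`. -/
abbrev Tens (p q : ℕ) : Type := EuclideanSpace ℂ ((Fin q → Fin 4) × (Fin p → Fin 4))

/-- `V = ⊙^p ℂ⁴ ⊗ ∧^q ℂ⁴`: tensors symmetric in `B₁…B_p` and antisymmetric in `A₁…A_q`. -/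
def symAlt (p q : ℕ) : Submodule ℂ (Tens p q) where
  carrier := {ξ | (∀ A B, ∀ σ : Equiv.Perm (Fin p), ξ (A, B ∘ σ) = ξ (A, B)) ∧
    (∀ A B, ∀ σ : Equiv.Perm (Fin q),
      ξ (A ∘ σ, B) = ((Equiv.Perm.sign σ : ℤ) : ℂ) * ξ (A, B))}
  add_mem' := by
    rintro ξ η ⟨h1, h2⟩ ⟨h3, h4⟩
    refine ⟨fun A B σ => ?_, fun A B σ => ?_⟩
    · simp [h1 A B σ, h3 A B σ]
    · simp [h2 A B σ, h4 A B σ, mul_add]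
  zero_mem' := by constructor <;> simp
  smul_mem' := by
    rintro c ξ ⟨h1, h2⟩
    refine ⟨fun A B σ => ?_, fun A B σ => ?_⟩
    · simp [h1 A B σ]
    · simp [h2 A B σ, mul_left_comm]

/-- The contraction `𝒞(ξ)^{A₁…A_q}_{B₁…B_p} = ∑_C ξ^{C A₁…A_q}_{B₁…B_p C}`. -/
def contraction (p q : ℕ) : Tens (p + 1) (q + 1) →ₗ[ℂ] Tens p q where
  toFun ξ := WithLp.toLp 2 fun i =>
    ∑ C : Fin 4, ξ (Fin.cons (α := fun _ => Fin 4) C i.1, Fin.snoc (α := fun _ => Fin 4) i.2 C)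
  map_add' ξ η := by ext i; simp [Finset.sum_add_distrib]
  map_smul' c ξ := by ext i; simp [Finset.mul_sum]

/-- `𝒱 = ker 𝒞` on `⊙^p ℂ⁴ ⊗ ∧^q ℂ⁴`. There is nothing to contract when `p = 0` or `q = 0`, and
then `𝒱 = V`. -/
def scrV : (p q : ℕ) → Submodule ℂ (Tens p q)
  | 0, q => symAlt 0 q
  | p + 1, 0 => symAlt (p + 1) 0
  | p + 1, q + 1 => symAlt (p + 1) (q + 1) ⊓ LinearMap.ker (contraction p q)

/-- The space `𝒱` as a Hilbert space, with the inner product inherited from the tensors. -/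
def Fib (p q : ℕ) : Type := scrV p q

instance (p q : ℕ) : NormedAddCommGroup (Fib p q) :=
  inferInstanceAs (NormedAddCommGroup (scrV p q))

instance (p q : ℕ) : InnerProductSpace ℂ (Fib p q) :=
  inferInstanceAs (InnerProductSpace ℂ (scrV p q))

instance (p q : ℕ) : FiniteDimensional ℂ (Fib p q) :=
  inferInstanceAs (FiniteDimensional ℂ (scrV p q))

instance (p q : ℕ) : CompleteSpace (Fib p q) := FiniteDimensional.complete ℂ _

/-- The inclusion of `𝒱` in the space of all tensors. -/
def incl (p q : ℕ) : Fib p q →ₗᵢ[ℂ] Tens p q := (scrV p q).subtypeₗᵢ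

/-- The orthogonal projection of the space of all tensors to `𝒱`. -/
def proj (p q : ℕ) : Tens p q →L[ℂ] Fib p q := (scrV p q).orthogonalProjectionOnto

/-- Symmetrization over the lower indices. -/
def symB {p q : ℕ} (T : (Fin q → Fin 4) → (Fin p → Fin 4) → ℂ)
    (A : Fin q → Fin 4) (B : Fin p → Fin 4) : ℂ :=
  ((p.factorial : ℂ))⁻¹ * ∑ σ : Equiv.Perm (Fin p), T A (B ∘ σ)

/-- Antisymmetrization over the upper indices. -/
def altA {p q : ℕ} (T : (Fin q → Fin 4) → (Fin p → Fin 4) → ℂ)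
    (A : Fin q → Fin 4) (B : Fin p → Fin 4) : ℂ :=
  ((q.factorial : ℂ))⁻¹ *
    ∑ σ : Equiv.Perm (Fin q), ((Equiv.Perm.sign σ : ℤ) : ℂ) * T (A ∘ σ) B

/-! ### Scalar first-order operators -/

/-- The weight `φ(x) = |x|²`. -/
def phi (x : E6) : ℝ := ‖x‖ ^ 2

/-- The partial derivative `∂_{x^j}` of a complex-valued function. -/
def partialD (j : Fin 6) (f : E6 → ℂ) (x : E6) : ℂ :=
  fderiv ℝ f x (EuclideanSpace.single j 1)

/-- The embedding of six coordinates into antisymmetric `4 × 4` matrices. -/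
def iota (z : Fin 6 → ℂ) : Matrix (Fin 4) (Fin 4) ℂ :=
  !![0, Complex.I * z 0 + z 5, z 3 + Complex.I * z 4, z 1 + Complex.I * z 2;
    -Complex.I * z 0 - z 5, 0, z 1 - Complex.I * z 2, -z 3 + Complex.I * z 4;
    -z 3 - Complex.I * z 4, -z 1 + Complex.I * z 2, 0, -Complex.I * z 0 + z 5;
    -z 1 - Complex.I * z 2, z 3 - Complex.I * z 4, Complex.I * z 0 - z 5, 0]

/-- `∇^{AB}`: the embedding matrix with `x^j` replaced by `∂_{x^j}`. -/
def nablaUp (A B : Fin 4) (f : E6 → ℂ) (x : E6) : ℂ :=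
  iota (fun j => partialD j f x) A B

open Classical in
/-- `ε_{v₀v₁v₂v₃}`: the sign of `v` if `v` is a permutation of the four indices, `0` otherwise. -/
def levi (v : Fin 4 → Fin 4) : ℤ :=
  if h : Function.Bijective v then (Equiv.Perm.sign (Equiv.ofBijective v h) : ℤ) else 0

/-- `∇_{AB} = ½ ∑_{C,D} ε_{ABCD} ∇^{CD}`. -/
def nablaDown (A B : Fin 4) (f : E6 → ℂ) (x : E6) : ℂ :=
  1 / 2 * ∑ C : Fin 4, ∑ D : Fin 4, (levi ![A, B, C, D] : ℂ) * nablaUp C D f x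

/-- `Θ_{AB} f = - e^φ ∇_{AB} (e^{-φ} f)`. -/
def thetaAB (A B : Fin 4) (f : E6 → ℂ) (x : E6) : ℂ :=
  -((Real.exp (phi x) : ℝ) : ℂ) *
    nablaDown A B (fun y => ((Real.exp (-phi y) : ℝ) : ℂ) * f y) x

/-! ### The operators on tensor fields -/

/-- The components of `𝒟f`:
`(𝒟f)^{A₁…A_{q+1}}_{B₂…B_{p+1}} = ∑_{B₁} ∇^{B₁[A₁} f^{A₂…A_{q+1}]}_{B₁B₂…B_{p+1}}`. -/
def calD {p q : ℕ} (f : E6 → Tens (p + 1) q) (x : E6) : Tens p (q + 1) :=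
  WithLp.toLp 2 fun i => altA (fun A B =>
    ∑ b : Fin 4, nablaUp b (A 0)
      (fun y => f y (Fin.tail A, Fin.cons (α := fun _ => Fin 4) b B)) x) i.1 i.2

/-- The formal adjoint `𝒟^*` of `𝒟` in the weighted inner product:
`(𝒟^*g)^{A₁…A_q}_{B₁…B_{p+1}} = - ∑_E Θ_{E(B₁} g^{E A₁…A_q}_{B₂…B_{p+1})}`. -/
def calDStar {p q : ℕ} (g : E6 → Tens p (q + 1)) (x : E6) : Tens (p + 1) q :=
  WithLp.toLp 2 fun i => symB (fun A B =>
    -∑ e : Fin 4, thetaAB e (B 0)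
      (fun y => g y (Fin.cons (α := fun _ => Fin 4) e A, Fin.tail B)) x) i.1 i.2

/-- The formal adjoint `Θ` of the restriction of `𝒟` to `𝒱`-valued functions: the orthogonal
projection of `𝒟^*g` to `𝒱`. -/
def Theta {p q : ℕ} (g : E6 → Fib p (q + 1)) (x : E6) : Fib (p + 1) q :=
  proj (p + 1) q (calDStar (fun y => incl p (q + 1) (g y)) x)

/-! ### Weighted `L²` spaces and the closed operators -/

/-- The measure `e^{-|x|²} dx` on `ℝ⁶`. -/
def gaussWeight : Measure E6 :=
  volume.withDensity fun x => ENNReal.ofReal (Real.exp (-phi x))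

/-- `L²_φ(ℝ⁶, 𝒱)`. -/
abbrev L2phi (p q : ℕ) : Type := Lp (Fib p q) 2 gaussWeight

/-- Test functions `C_0^∞(ℝ⁶, 𝒱)`. -/
def IsTest {p q : ℕ} (g : E6 → Fib p q) : Prop :=
  ContDiff ℝ ∞ g ∧ HasCompactSupport g

/-- `𝒟f = u` in the weak sense: `⟨u, g⟩_φ = ⟨f, Θ g⟩_φ` for every test function `g`. (The inner
product of Mathlib is linear in its second argument.) -/
def IsWeakD {p q : ℕ} (f : L2phi (p + 1) q) (u : L2phi p (q + 1)) : Prop :=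
  ∀ g : E6 → Fib p (q + 1), IsTest g →
    ∫ x, inner ℂ (g x) (u x) ∂gaussWeight = ∫ x, inner ℂ (Theta g x) (f x) ∂gaussWeight

instance : IsLocallyFiniteMeasure gaussWeight := by
  unfold gaussWeight
  exact IsLocallyFiniteMeasure.withDensity_ofReal (by unfold phi; fun_prop)

theorem levi_eq (v : Fin 4 → Fin 4) :
    levi v = ∏ j, ∏ i ∈ Finset.Iio j, ((v j : ℤ) - v i).sign := by
  by_cases h : Function.Bijective v
  · rw [levi, dif_pos h, Equiv.Perm.sign_eq_prod_prod_Iio]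
    push_cast
    refine Finset.prod_congr rfl fun j _ => Finset.prod_congr rfl fun i hi => ?_
    have hij : i ≠ j := (Finset.mem_Iio.1 hi).ne
    have hv : v i ≠ v j := fun e => hij (h.1 e)
    simp only [Equiv.ofBijective_apply]
    split_ifs with hlt
    · rw [Int.sign_eq_one_of_pos] <;> simp; omega
    · rw [Int.sign_eq_neg_one_of_neg] <;> simp; omega
  · rw [levi, dif_neg h]
    have h' : ¬ Function.Injective v := fun hi => h (Finite.injective_iff_bijective.1 hi)
    simp only [Function.Injective, not_forall] at h'
    obtain ⟨i, j, hv, hij⟩ := h'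
    symm
    rcases lt_or_gt_of_ne hij with hl | hl
    · exact Finset.prod_eq_zero (Finset.mem_univ j)
        (Finset.prod_eq_zero (Finset.mem_Iio.2 hl) (by simp [hv]))
    · exact Finset.prod_eq_zero (Finset.mem_univ i)
        (Finset.prod_eq_zero (Finset.mem_Iio.2 hl) (by simp [hv]))

theorem levi_eq' (A B C D : Fin 4) : levi ![A, B, C, D] = ((B : ℤ) - A).sign * (((C : ℤ) - A).sign * ((C : ℤ) - B).sign) * (((D : ℤ) - A).sign * (((D : ℤ) - B).sign * ((D : ℤ) - C).sign)) := by
  rw [levi_eq, Fin.prod_univ_four]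
  have h0 : (Finset.Iio (0 : Fin 4)) = ∅ := by decide
  have h1 : (Finset.Iio (1 : Fin 4)) = {0} := by decide
  have h2 : (Finset.Iio (2 : Fin 4)) = {0, 1} := by decide
  have h3 : (Finset.Iio (3 : Fin 4)) = {0, 1, 2} := by decide
  rw [h0, h1, h2, h3]
  simp
/-- The coefficient of `∂_{x^j}` in `∇^{AB}`. -/
def sym (j : Fin 6) (A B : Fin 4) : ℂ := iota (Pi.single j 1) A B

theorem iota_eq (z : Fin 6 → ℂ) (A B : Fin 4) : iota z A B = ∑ j, sym j A B * z j := by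
  rw [Fin.sum_univ_six]
  fin_cases A <;> fin_cases B <;> simp [sym, iota, Pi.single_apply] <;> ring

theorem sym_swap (j A B) : sym j A B = - sym j B A := by
  fin_cases A <;> fin_cases B <;> simp [sym, iota] <;> ring

theorem sym_self (j A) : sym j A A = 0 := by
  fin_cases A <;> simp [sym, iota]

/-- Lowering the indices of `ι(z)` conjugates its coefficients. -/
theorem dual_iota (z : Fin 6 → ℂ) (A B : Fin 4) :
    1 / 2 * ∑ C : Fin 4, ∑ D : Fin 4, (levi ![A, B, C, D] : ℂ) * iota z C D =
      conj (iota (fun j => conj (z j)) A B) := by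
  have h2 : Int.sign 2 = 1 := rfl
  have h3 : Int.sign 3 = 1 := rfl
  simp only [levi_eq', Fin.sum_univ_four]
  fin_cases A <;> fin_cases B <;> simp [iota, h2, h3] <;> ring

theorem dual_sym (j : Fin 6) (A B : Fin 4) :
    1 / 2 * ∑ C : Fin 4, ∑ D : Fin 4, (levi ![A, B, C, D] : ℂ) * sym j C D = conj (sym j A B) := by
  have h : (fun i => conj ((Pi.single j 1 : Fin 6 → ℂ) i)) = Pi.single j 1 := by
    ext i; by_cases hij : i = j <;> simp [hij]
  have := dual_iota (Pi.single j 1) A B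
  rw [h] at this
  exact this

theorem nablaUp_eq (A B f x) : nablaUp A B f x = ∑ j, sym j A B * partialD j f x := iota_eq _ _ _

theorem nablaDown_eq (A B f x) : nablaDown A B f x = ∑ j, conj (sym j A B) * partialD j f x := by
  simp only [nablaDown, nablaUp_eq, ← dual_sym, Finset.mul_sum, Finset.sum_mul]
  rw [Finset.sum_comm_cycle]
  simp only [mul_assoc]

theorem contDiff_partialD {f : E6 → ℂ} (hf : ContDiff ℝ ∞ f) (j : Fin 6) :
    ContDiff ℝ ∞ (partialD j f) := by
  unfold partialD
  exact (hf.fderiv_right (m := ∞) (by simp)).clm_apply contDiff_const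

theorem partialD_of_notMem {f : E6 → ℂ} {x : E6} (hx : x ∉ tsupport f) (j : Fin 6) :
    partialD j f x = 0 := by
  have : fderiv ℝ f x = 0 := by
    by_contra h
    exact hx (support_fderiv_subset ℝ (Function.mem_support.2 h))
  simp [partialD, this]

theorem contDiff_weight : ContDiff ℝ ∞ (fun y : E6 => ((Real.exp (-phi y) : ℝ) : ℂ)) := by
  unfold phi
  exact Complex.ofRealCLM.contDiff.comp ((contDiff_norm_sq ℝ).neg.exp)

theorem contDiff_weight' : ContDiff ℝ ∞ (fun y : E6 => ((Real.exp (phi y) : ℝ) : ℂ)) := by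
  unfold phi
  exact Complex.ofRealCLM.contDiff.comp ((contDiff_norm_sq ℝ).exp)

theorem contDiff_nablaUp {f : E6 → ℂ} (hf : ContDiff ℝ ∞ f) (A B : Fin 4) :
    ContDiff ℝ ∞ (nablaUp A B f) := by
  have : nablaUp A B f = fun x => ∑ j, sym j A B * partialD j f x :=
    funext fun x => nablaUp_eq A B f x
  rw [this]
  exact ContDiff.sum fun j _ => contDiff_const.mul (contDiff_partialD hf j)

theorem contDiff_thetaAB {f : E6 → ℂ} (hf : ContDiff ℝ ∞ f) (A B : Fin 4) :
    ContDiff ℝ ∞ (thetaAB A B f) := by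
  unfold thetaAB
  simp only [nablaDown_eq]
  exact contDiff_weight'.neg.mul (ContDiff.sum fun j _ =>
    contDiff_const.mul (contDiff_partialD (contDiff_weight.mul hf) j))

theorem nablaUp_of_notMem {f : E6 → ℂ} {x : E6} (hx : x ∉ tsupport f) (A B : Fin 4) :
    nablaUp A B f x = 0 := by
  simp [nablaUp_eq, partialD_of_notMem hx]

theorem thetaAB_of_notMem {f : E6 → ℂ} {x : E6} (hx : x ∉ tsupport f) (A B : Fin 4) :
    thetaAB A B f x = 0 := by
  have : x ∉ tsupport (fun y => ((Real.exp (-phi y) : ℝ) : ℂ) * f y) := fun h =>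
    hx (tsupport_mul_subset_right h)
  simp only [thetaAB, nablaDown_eq, partialD_of_notMem this, mul_zero, Finset.sum_const_zero]

theorem IsTest.comp_contDiff {p q : ℕ} {g : E6 → Fib p q} (hg : IsTest g)
    (i : (Fin q → Fin 4) × (Fin p → Fin 4)) :
    ContDiff ℝ ∞ (fun y => incl p q (g y) i) := by
  let L : Fib p q →L[ℝ] ℂ :=
    ((EuclideanSpace.proj i : Tens p q →L[ℂ] ℂ).comp
      (incl p q).toContinuousLinearMap).restrictScalars ℝ
  exact L.contDiff.comp hg.1

theorem tsupport_comp_subset {p q : ℕ} (g : E6 → Fib p q)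
    (i : (Fin q → Fin 4) × (Fin p → Fin 4)) :
    tsupport (fun y => incl p q (g y) i) ⊆ tsupport g := by
  refine closure_mono fun x hx => ?_
  rw [Function.mem_support] at hx ⊢
  intro h
  simp [h] at hx

theorem IsTest.comp_compact {p q : ℕ} {g : E6 → Fib p q} (hg : IsTest g)
    (i : (Fin q → Fin 4) × (Fin p → Fin 4)) :
    HasCompactSupport (fun y => incl p q (g y) i) :=
  hg.2.mono' ((subset_tsupport _).trans (tsupport_comp_subset g i))

theorem IsTest.calDStar_contDiff {p q : ℕ} {g : E6 → Fib p (q + 1)} (hg : IsTest g) :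
    ContDiff ℝ ∞ (calDStar fun y => incl p (q + 1) (g y)) := by
  rw [contDiff_piLp]
  intro i
  simp only [calDStar, symB]
  exact contDiff_const.mul (ContDiff.sum fun σ _ => (ContDiff.sum fun e _ =>
    contDiff_thetaAB (hg.comp_contDiff _) _ _).neg)

theorem IsTest.calD_contDiff {p q : ℕ} {g : E6 → Fib (p + 1) q} (hg : IsTest g) :
    ContDiff ℝ ∞ (calD fun y => incl (p + 1) q (g y)) := by
  rw [contDiff_piLp]
  intro i
  simp only [calD, altA]
  exact contDiff_const.mul (ContDiff.sum fun σ _ => contDiff_const.mul (ContDiff.sum fun e _ =>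
    contDiff_nablaUp (hg.comp_contDiff _) _ _))

theorem IsTest.proj {p q : ℕ} {f : E6 → Tens p q} (hf : ContDiff ℝ ∞ f)
    (hs : HasCompactSupport f) : IsTest fun x => proj p q (f x) :=
  ⟨((Monogenic.proj p q).restrictScalars ℝ).contDiff.comp hf, hs.comp_left (map_zero _)⟩

/-- `Θ` maps test functions to test functions. -/
theorem IsTest.theta {p q : ℕ} {g : E6 → Fib p (q + 1)} (hg : IsTest g) : IsTest (Theta g) := by
  refine IsTest.proj hg.calDStar_contDiff (HasCompactSupport.intro hg.2 fun x hx => ?_)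
  ext i
  simp [calDStar, symB, thetaAB_of_notMem fun h => hx (tsupport_comp_subset g _ h)]

theorem IsTest.calD_compact {p q : ℕ} {g : E6 → Fib (p + 1) q} (hg : IsTest g) :
    HasCompactSupport (calD fun y => incl (p + 1) q (g y)) := by
  refine HasCompactSupport.intro hg.2 fun x hx => ?_
  ext i
  simp [calD, altA, nablaUp_of_notMem fun h => hx (tsupport_comp_subset g _ h)]

theorem IsTest.memLp {p q : ℕ} {g : E6 → Fib p q} (hg : IsTest g) : MemLp g 2 gaussWeight :=
  hg.1.continuous.memLp_of_hasCompactSupport hg.2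

theorem IsTest.integral_eq {p q : ℕ} {g : E6 → Fib p q} (hg : IsTest g) (u : L2phi p q) :
    ∫ x, inner ℂ (g x) (u x) ∂gaussWeight = inner ℂ hg.memLp.toLp u := by
  rw [L2.inner_def]
  refine integral_congr_ae ?_
  filter_upwards [hg.memLp.coeFn_toLp] with x hx
  rw [hx]

theorem isWeakD_iff {p q : ℕ} (f : L2phi (p + 1) q) (u : L2phi p (q + 1)) :
    IsWeakD f u ↔ ∀ (g : E6 → Fib p (q + 1)) (hg : IsTest g),
      inner ℂ (hg.memLp.toLp g) u = inner ℂ (hg.theta.memLp.toLp (Theta g)) f := by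
  refine forall_congr' fun g => forall_congr' fun hg => ?_
  rw [hg.integral_eq, hg.theta.integral_eq]

/-- The graph of the weak operator `𝒟` on `L²_φ(ℝ⁶, 𝒱)`. -/
def scrDGraph (p q : ℕ) : Submodule ℂ (L2phi (p + 1) q × L2phi p (q + 1)) where
  carrier := {fu | IsWeakD fu.1 fu.2}
  add_mem' := by
    intro a b ha hb
    simp only [Set.mem_ofPred_eq, isWeakD_iff] at *
    intro g hg
    simp [inner_add_right, ha g hg, hb g hg]
  zero_mem' := by simp [isWeakD_iff]
  smul_mem' := by
    intro c a ha
    simp only [Set.mem_ofPred_eq, isWeakD_iff] at *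
    intro g hg
    simp [inner_smul_right, ha g hg]

theorem eq_zero_of_test {p q : ℕ} (u : L2phi p q)
    (h : ∀ g : E6 → Fib p q, IsTest g → ∫ x, inner ℂ (g x) (u x) ∂gaussWeight = 0) :
    u = 0 := by
  have hu : LocallyIntegrable u gaussWeight := (Lp.memLp u).locallyIntegrable (by norm_num)
  suffices h : ∀ᵐ x ∂gaussWeight, u x = 0 by
    refine Lp.ext ?_
    filter_upwards [h, Lp.coeFn_zero (Fib p q) 2 gaussWeight] with x h1 h2
    rw [h1, h2, Pi.zero_apply]
  refine ae_eq_zero_of_integral_contDiff_smul_eq_zero hu fun ψ h1 h2 => ?_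
  have hψ : Integrable (fun x => ψ x • u x) gaussWeight :=
    hu.integrable_smul_left_of_hasCompactSupport h1.continuous h2
  refine ext_inner_left ℂ fun c => ?_
  rw [← integral_inner hψ, inner_zero_right]
  have hg : IsTest fun x => ψ x • c := ⟨h1.smul contDiff_const, h2.smul_right⟩
  rw [← h _ hg]
  refine integral_congr_ae (Filter.Eventually.of_forall fun x => ?_)
  show inner ℂ c (ψ x • u x) = inner ℂ (ψ x • c) (u x)
  rw [inner_smul_left_eq_smul, inner_smul_right_eq_smul]
  

theorem scrDGraph_functional (p q : ℕ) (x : L2phi (p + 1) q × L2phi p (q + 1))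
    (hx : x ∈ scrDGraph p q) (h0 : x.1 = 0) : x.2 = 0 := by
  refine eq_zero_of_test _ fun g hg => ?_
  rw [hx g hg, hg.theta.integral_eq, h0, inner_zero_right]

/-- The operator `𝒟 : L²_φ(ℝ⁶, 𝒱) → L²_φ(ℝ⁶, 𝒱)` with its maximal domain. -/
def scrD (p q : ℕ) : L2phi (p + 1) q →ₗ.[ℂ] L2phi p (q + 1) := (scrDGraph p q).toLinearPMap

/-- `f ∈ Dom 𝒟` and `𝒟f = u` hold exactly when `𝒟f = u` in the weak sense. -/
theorem mem_scrD_graph {p q : ℕ} (f : L2phi (p + 1) q) (u : L2phi p (q + 1)) :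
    (f, u) ∈ (scrD p q).graph ↔ IsWeakD f u := by
  rw [scrD, Submodule.toLinearPMap_graph_eq _ (scrDGraph_functional p q)]
  rfl

theorem inner_proj {p q : ℕ} (ξ : Tens p q) (η : Fib p q) :
    inner ℂ (proj p q ξ) η = inner ℂ ξ (incl p q η) :=
  (scrV p q).inner_orthogonalProjectionOnto_eq_of_mem_right (η : scrV p q) ξ

theorem inner_proj' {p q : ℕ} (ξ : Tens p q) (η : Fib p q) :
    inner ℂ η (proj p q ξ) = inner ℂ (incl p q η) ξ :=
  (scrV p q).inner_orthogonalProjectionOnto_eq_of_mem_left (η : scrV p q) ξ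

theorem scrV_le (p q : ℕ) : scrV p q ≤ symAlt p q := by
  match p, q with
  | 0, q => exact le_rfl
  | p + 1, 0 => exact le_rfl
  | p + 1, q + 1 => exact inf_le_left

theorem incl_mem {p q : ℕ} (η : Fib p q) : incl p q η ∈ symAlt p q :=
  scrV_le p q (Subtype.property (p := fun x => x ∈ scrV p q) η)

theorem sum_symB {p q : ℕ} (T : (Fin q → Fin 4) → (Fin p → Fin 4) → ℂ) {η : Tens p q}
    (hη : η ∈ symAlt p q) :
    ∑ A, ∑ B, conj (symB T A B) * η (A, B) = ∑ A, ∑ B, conj (T A B) * η (A, B) := by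
  refine Finset.sum_congr rfl fun A _ => ?_
  have key : ∀ σ : Equiv.Perm (Fin p), ∑ B : Fin p → Fin 4, conj (T A (B ∘ σ)) * η (A, B) =
      ∑ B, conj (T A B) * η (A, B) := fun σ => by
    rw [← Equiv.sum_comp (σ.symm.arrowCongr (Equiv.refl (Fin 4)))
      (fun B => conj (T A B) * η (A, B))]
    refine Finset.sum_congr rfl fun B _ => ?_
    have : (σ.symm.arrowCongr (Equiv.refl (Fin 4))) B = B ∘ σ := by ext; simp
    rw [this, hη.1]
  simp only [symB, map_mul, map_sum, map_inv₀, map_natCast, mul_assoc, Finset.sum_mul]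
  rw [← Finset.mul_sum, Finset.sum_comm, Finset.sum_congr rfl fun σ _ => key σ]
  simp [Fintype.card_perm, Nat.factorial_ne_zero]

theorem sum_altA {p q : ℕ} (T : (Fin q → Fin 4) → (Fin p → Fin 4) → ℂ) {η : Tens p q}
    (hη : η ∈ symAlt p q) :
    ∑ A, ∑ B, conj (η (A, B)) * altA T A B = ∑ A, ∑ B, conj (η (A, B)) * T A B := by
  rw [Finset.sum_comm, Finset.sum_comm (f := fun A B => conj (η (A, B)) * T A B)]
  refine Finset.sum_congr rfl fun B _ => ?_
  have key : ∀ σ : Equiv.Perm (Fin q), ∑ A : Fin q → Fin 4,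
      conj (η (A, B)) * (((Equiv.Perm.sign σ : ℤ) : ℂ) * T (A ∘ σ) B) =
      ∑ A, conj (η (A, B)) * T A B := fun σ => by
    rw [← Equiv.sum_comp (σ.symm.arrowCongr (Equiv.refl (Fin 4)))
      (fun A => conj (η (A, B)) * T A B)]
    refine Finset.sum_congr rfl fun A _ => ?_
    have : (σ.symm.arrowCongr (Equiv.refl (Fin 4))) A = A ∘ σ := by ext; simp
    rw [this, hη.2]
    simp
    ring
  simp only [altA, mul_left_comm _ ((q.factorial : ℂ))⁻¹]
  rw [← Finset.mul_sum]
  simp only [Finset.mul_sum (s := (Finset.univ : Finset (Equiv.Perm (Fin q))))]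
  rw [Finset.sum_comm, Finset.sum_congr rfl fun σ _ => key σ]
  simp [Fintype.card_perm, Nat.factorial_ne_zero]

theorem integral_gaussWeight (F : E6 → ℂ) :
    ∫ x, F x ∂gaussWeight = ∫ x, ((Real.exp (-phi x) : ℝ) : ℂ) * F x := by
  rw [gaussWeight, integral_withDensity_eq_integral_toReal_smul]
  · refine integral_congr_ae (Filter.Eventually.of_forall fun x => ?_)
    simp [ENNReal.toReal_ofReal (Real.exp_pos _).le, Complex.real_smul]
  · unfold phi; fun_prop
  · exact Filter.Eventually.of_forall fun x => ENNReal.ofReal_lt_top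

theorem partialD_conj (j : Fin 6) (f : E6 → ℂ) (x : E6) :
    partialD j (fun y => conj (f y)) x = conj (partialD j f x) := by
  have := Complex.conjCLE.comp_fderiv (f := f) (x := x)
  unfold partialD
  change fderiv ℝ (Complex.conjCLE ∘ f) x _ = _
  rw [this]
  rfl

theorem partialD_by_parts {F G : E6 → ℂ} (hF : ContDiff ℝ ∞ F) (hG : ContDiff ℝ ∞ G)
    (cF : HasCompactSupport F) (j : Fin 6) :
    ∫ x, F x * partialD j G x = - ∫ x, partialD j F x * G x := by
  have hcd : HasCompactSupport (partialD j F) := cF.fderiv_apply ℝ _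
  refine integral_mul_fderiv_eq_neg_fderiv_mul_of_integrable ?_ ?_ ?_
    (fun x _ => hF.differentiable (by simp) x) (fun x _ => hG.differentiable (by simp) x)
  · exact ((contDiff_partialD hF j).continuous.mul hG.continuous).integrable_of_hasCompactSupport
      hcd.mul_right
  · exact (hF.continuous.mul (contDiff_partialD hG j).continuous).integrable_of_hasCompactSupport
      cF.mul_right
  · exact (hF.continuous.mul hG.continuous).integrable_of_hasCompactSupport cF.mul_right

/-- `-Θ_{AB}` is the formal adjoint of `∇^{BA}`. -/
theorem theta_by_parts {F G : E6 → ℂ} (hF : ContDiff ℝ ∞ F) (hG : ContDiff ℝ ∞ G)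
    (cF : HasCompactSupport F) (A B : Fin 4) :
    ∫ x, conj (F x) * nablaUp B A G x ∂gaussWeight =
      ∫ x, conj (-thetaAB A B F x) * G x ∂gaussWeight := by
  rw [integral_gaussWeight, integral_gaussWeight]
  set K : E6 → ℂ := fun x => ((Real.exp (-phi x) : ℝ) : ℂ) * conj (F x) with hK
  have sK : ContDiff ℝ ∞ K := contDiff_weight.mul (Complex.conjCLE.contDiff.comp hF)
  have cK : HasCompactSupport K := (cF.comp_left (map_zero (starRingEnd ℂ))).mul_left
  have e1 : ∀ x, ((Real.exp (-phi x) : ℝ) : ℂ) * (conj (F x) * nablaUp B A G x) =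
      ∑ j, sym j B A * (K x * partialD j G x) := fun x => by
    rw [nablaUp_eq, Finset.mul_sum, Finset.mul_sum]
    exact Finset.sum_congr rfl fun j _ => by rw [hK]; ring
  have e2 : ∀ x, ((Real.exp (-phi x) : ℝ) : ℂ) * (conj (-thetaAB A B F x) * G x) =
      ∑ j, sym j A B * (partialD j K x * G x) := fun x => by
    have hc : ∀ j, partialD j K x =
        conj (partialD j (fun y => ((Real.exp (-phi y) : ℝ) : ℂ) * F y) x) := fun j => by
      rw [← partialD_conj]
      congr 1
      ext y
      rw [map_mul, Complex.conj_ofReal]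
    have he : ((Real.exp (-phi x) : ℝ) : ℂ) * ((Real.exp (phi x) : ℝ) : ℂ) = 1 := by
      rw [← Complex.ofReal_mul, ← Real.exp_add]; simp
    rw [thetaAB, nablaDown_eq]
    simp only [hc, map_mul, map_sum, Complex.conj_ofReal, Complex.conj_conj, neg_mul,
      neg_neg]
    rw [← mul_assoc, ← mul_assoc, he, one_mul, Finset.sum_mul]
    exact Finset.sum_congr rfl fun j _ => by ring
  simp only [e1, e2]
  rw [integral_finsetSum, integral_finsetSum]
  · refine Finset.sum_congr rfl fun j _ => ?_
    rw [integral_const_mul, integral_const_mul, partialD_by_parts sK hG cK, sym_swap j B A]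
    ring
  · intro j _
    have hcd : HasCompactSupport (partialD j K) := cK.fderiv_apply ℝ _
    exact (((contDiff_partialD sK j).continuous.mul hG.continuous).integrable_of_hasCompactSupport
      hcd.mul_right).const_mul _
  · intro j _
    exact ((sK.continuous.mul (contDiff_partialD hG j).continuous).integrable_of_hasCompactSupport
      cK.mul_right).const_mul _

theorem sum_cons {n : ℕ} (f : (Fin (n + 1) → Fin 4) → ℂ) :
    ∑ A, f A = ∑ a : Fin 4, ∑ A : Fin n → Fin 4, f (Fin.cons (α := fun _ => Fin 4) a A) := by
  rw [← Fintype.sum_prod_type', ← Equiv.sum_comp (Fin.consEquiv fun _ => Fin 4)]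
  rfl

/-- `Θ` is the formal adjoint of `𝒟` on test functions. -/
theorem formal_adjoint {p q : ℕ} {h : E6 → Fib (p + 1) q} {g : E6 → Fib p (q + 1)}
    (hh : IsTest h) (hg : IsTest g) :
    ∫ x, inner ℂ (incl p (q + 1) (g x)) (calD (fun y => incl (p + 1) q (h y)) x) ∂gaussWeight =
      ∫ x, inner ℂ (Theta g x) (h x) ∂gaussWeight := by
  have e1 : ∀ x, inner ℂ (incl p (q + 1) (g x)) (calD (fun y => incl (p + 1) q (h y)) x) =
      ∑ a : Fin 4, ∑ A : Fin q → Fin 4, ∑ B : Fin p → Fin 4, ∑ b : Fin 4,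
        conj (incl p (q + 1) (g x) (Fin.cons (α := fun _ => Fin 4) a A, B)) *
          nablaUp b a (fun y => incl (p + 1) q (h y)
            (A, Fin.cons (α := fun _ => Fin 4) b B)) x := fun x => by
    rw [PiLp.inner_apply, Fintype.sum_prod_type]
    simp only [RCLike.inner_apply', calD]
    rw [sum_altA _ (incl_mem (g x)), sum_cons]
    simp [Finset.mul_sum]
  have e2 : ∀ x, inner ℂ (Theta g x) (h x) =
      ∑ a : Fin 4, ∑ A : Fin q → Fin 4, ∑ B : Fin p → Fin 4, ∑ b : Fin 4,
        conj (-thetaAB a b (fun y => incl p (q + 1) (g y)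
          (Fin.cons (α := fun _ => Fin 4) a A, B)) x) *
            incl (p + 1) q (h x) (A, Fin.cons (α := fun _ => Fin 4) b B) := fun x => by
    rw [Theta, inner_proj, PiLp.inner_apply, Fintype.sum_prod_type]
    simp only [RCLike.inner_apply', calDStar]
    rw [sum_symB _ (incl_mem (h x)), Finset.sum_comm (γ := Fin 4)]
    refine Finset.sum_congr rfl fun A _ => ?_
    rw [sum_cons]
    simp only [← Finset.sum_neg_distrib, map_sum, Finset.sum_mul, Fin.cons_zero, Fin.tail_cons]
    rw [Finset.sum_comm_cycle]
    refine Finset.sum_congr rfl fun a _ => Finset.sum_comm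
  simp only [e1, e2]
  have i1 : ∀ a A B b, Integrable (fun x =>
      conj (incl p (q + 1) (g x) (Fin.cons (α := fun _ => Fin 4) a A, B)) *
          nablaUp b a (fun y => incl (p + 1) q (h y)
            (A, Fin.cons (α := fun _ => Fin 4) b B)) x) gaussWeight := fun a A B b =>
    ((Complex.conjCLE.contDiff.comp (hg.comp_contDiff _)).continuous.mul
      (contDiff_nablaUp (hh.comp_contDiff _) b a).continuous).integrable_of_hasCompactSupport
        ((hg.comp_compact _).comp_left (map_zero (starRingEnd ℂ))).mul_right
  have i2 : ∀ a A B b, Integrable (fun x =>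
      conj (-thetaAB a b (fun y => incl p (q + 1) (g y)
          (Fin.cons (α := fun _ => Fin 4) a A, B)) x) *
            incl (p + 1) q (h x) (A, Fin.cons (α := fun _ => Fin 4) b B)) gaussWeight :=
    fun a A B b =>
    ((Complex.conjCLE.contDiff.comp
      (contDiff_thetaAB (hg.comp_contDiff _) a b).neg).continuous.mul
        (hh.comp_contDiff _).continuous).integrable_of_hasCompactSupport
          (hh.comp_compact _).mul_left
  have j1 := fun a A B => integrable_finsetSum Finset.univ fun b _ => i1 a A B b
  have j2 := fun a A B => integrable_finsetSum Finset.univ fun b _ => i2 a A B b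
  have k1 := fun a A => integrable_finsetSum Finset.univ fun B _ => j1 a A B
  have k2 := fun a A => integrable_finsetSum Finset.univ fun B _ => j2 a A B
  rw [integral_finsetSum _ fun a _ => integrable_finsetSum Finset.univ fun A _ => k1 a A,
    integral_finsetSum _ fun a _ => integrable_finsetSum Finset.univ fun A _ => k2 a A]
  refine Finset.sum_congr rfl fun a _ => ?_
  rw [integral_finsetSum _ fun A _ => k1 a A, integral_finsetSum _ fun A _ => k2 a A]
  refine Finset.sum_congr rfl fun A _ => ?_
  rw [integral_finsetSum _ fun B _ => j1 a A B, integral_finsetSum _ fun B _ => j2 a A B]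
  refine Finset.sum_congr rfl fun B _ => ?_
  rw [integral_finsetSum _ fun b _ => i1 a A B b, integral_finsetSum _ fun b _ => i2 a A B b]
  refine Finset.sum_congr rfl fun b _ => ?_
  exact theta_by_parts (hg.comp_contDiff _) (hh.comp_contDiff _) (hg.comp_compact _) a b

theorem IsTest.mem_scrD_domain {p q : ℕ} {h : E6 → Fib (p + 1) q} (hh : IsTest h) :
    hh.memLp.toLp h ∈ (scrD p q).domain := by
  have hu : IsTest fun x => Monogenic.proj p (q + 1) (calD (fun y => incl (p + 1) q (h y)) x) :=
    IsTest.proj hh.calD_contDiff hh.calD_compact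
  refine LinearPMap.mem_domain_of_mem_graph (y := hu.memLp.toLp _)
    ((mem_scrD_graph _ _).2 fun g hg => ?_)
  have a1 : ∀ᵐ x ∂gaussWeight, inner ℂ (g x) (hu.memLp.toLp _ x) =
      inner ℂ (incl p (q + 1) (g x)) (calD (fun y => incl (p + 1) q (h y)) x) := by
    filter_upwards [hu.memLp.coeFn_toLp] with x hx
    rw [hx, inner_proj']
  have a2 : ∀ᵐ x ∂gaussWeight, inner ℂ (Theta g x) (hh.memLp.toLp h x) =
      inner ℂ (Theta g x) (h x) := by
    filter_upwards [hh.memLp.coeFn_toLp] with x hx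
    rw [hx]
  rw [integral_congr_ae a1, integral_congr_ae a2]
  exact formal_adjoint hh hg

/-- `𝒟` is densely defined, so that its Hilbert space adjoint makes sense. -/
theorem scrD_dense (p q : ℕ) : Dense ((scrD p q).domain : Set (L2phi (p + 1) q)) := by
  rw [Submodule.dense_iff_topologicalClosure_eq_top, Submodule.topologicalClosure_eq_top_iff,
    Submodule.eq_bot_iff]
  intro u hu
  refine eq_zero_of_test u fun g hg => ?_
  rw [hg.integral_eq]
  exact hu _ hg.mem_scrD_domain

end Monogenic

end

open Monogenic

/-! In the Gaussian space the adjoint of `∂_j` is `2 x_j - ∂_j`, and the commutator of `∂_i` with it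
is `2 δ_ij`. For constant linear maps `M_i` this gives `‖∑ M_i (2 x_i - ∂_i) f‖² = ∫ swapForm M (∂f)
+ 2 ∑ ‖M_i f‖²` (`integral_normSq_sum_rv`): a positive zero-order term, plus a quadratic form in the
first derivatives with two indices exchanged. The estimate follows once that form is bounded below
by `-2 ‖𝒟f‖²`, which is linear algebra at a point.

On `𝒱` the adjoint of `𝒟` has the symbol `starMap` followed by the orthogonal projection to `𝒱`. The
identity is therefore applied to the unprojected symbol and, with a factor `-β`, to a second symbol
`N` (`apriori_of_pointwise`). For `l = 2, 3`, `N` is `pairMap`, the trace of `starMap` up to a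
factor, which measures what the projection loses (`normSq_theta_ge`). For `l = 1` the projection
loses nothing, and `N` is `rotMap`, chosen to cancel the negative part of the exchanged form.

The exchanged form of `starMap` is a combination of `swapA`, the square of `gup`, and a negative
multiple of `‖altUp‖²` (`swapForm_starFib`). Up to sign `altUp` is the symbol of `𝒟`, so the
negative term is paid for by `‖𝒟f‖²` (`norm_altUp_le`). The rest is handled degree by degree in
`swapForm_nonneg_one`, `swapForm_nonneg_two` and `swapForm_nonneg_three`, from the antisymmetry of
`∇` and the vanishing of traces. The zero-order terms leave at least `4 ‖f‖²`, whence `4 ‖f‖² ≤ 2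
‖𝒟f‖² + ‖𝒟^*f‖²` for test functions.

Cutting off and mollifying an element of both domains, then applying Fatou's lemma, carries the
inequality to the closed operators (`estimate_of_weak`). -/

noncomputable section

namespace Monogenic

/-! ### Vector-valued derivatives and their adjoints in the weighted space -/

section Gaussian

variable {V W : Type*} [NormedAddCommGroup V] [InnerProductSpace ℂ V]
  [NormedAddCommGroup W] [InnerProductSpace ℂ W]

/-- The partial derivative of a vector-valued function. -/
def dv (j : Fin 6) (f : E6 → V) (x : E6) : V := fderiv ℝ f x (EuclideanSpace.single j 1)

/-- The adjoint `2 x_j - ∂_j` of `∂_j` in the weighted space. -/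
def rv (j : Fin 6) (f : E6 → V) (x : E6) : V := (2 * x j : ℝ) • f x - dv j f x

/-- Smooth compactly supported functions. -/
def TestFun (f : E6 → V) : Prop := ContDiff ℝ ∞ f ∧ HasCompactSupport f

theorem TestFun.continuous {f : E6 → V} (hf : TestFun f) : Continuous f := hf.1.continuous

theorem TestFun.differentiable {f : E6 → V} (hf : TestFun f) : Differentiable ℝ f :=
  hf.1.differentiable (by simp)

theorem TestFun.dv {f : E6 → V} (hf : TestFun f) (j : Fin 6) : TestFun (dv j f) :=
  ⟨(hf.1.fderiv_right (m := ∞) (by simp)).clm_apply contDiff_const, hf.2.fderiv_apply ℝ _⟩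

theorem contDiff_coord (j : Fin 6) : ContDiff ℝ ∞ (fun x : E6 => x j) :=
  (EuclideanSpace.proj j : E6 →L[ℝ] ℝ).contDiff

theorem TestFun.smul {f : E6 → V} (hf : TestFun f) {a : E6 → ℝ} (ha : ContDiff ℝ ∞ a) :
    TestFun fun x => a x • f x :=
  ⟨ha.smul hf.1, hf.2.smul_left⟩

theorem TestFun.sub {f g : E6 → V} (hf : TestFun f) (hg : TestFun g) :
    TestFun fun x => f x - g x :=
  ⟨hf.1.sub hg.1, HasCompactSupport.intro (hf.2.union hg.2) fun x hx => by
    rw [Set.mem_union, not_or] at hx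
    rw [image_eq_zero_of_notMem_tsupport hx.1, image_eq_zero_of_notMem_tsupport hx.2, sub_zero]⟩

theorem TestFun.sum {ι : Type*} {s : Finset ι} {f : ι → E6 → V} (hf : ∀ i ∈ s, TestFun (f i)) :
    TestFun fun x => ∑ i ∈ s, f i x := by
  classical
  induction s using Finset.induction_on with
  | empty =>
    simp only [Finset.sum_empty]
    exact ⟨contDiff_const, HasCompactSupport.zero⟩
  | insert a s ha ih =>
    simp only [Finset.sum_insert ha]
    have h1 := hf a (by simp)
    have h2 := ih fun i hi => hf i (by simp [hi])
    exact ⟨h1.1.add h2.1, h1.2.add h2.2⟩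

theorem TestFun.rv {f : E6 → V} (hf : TestFun f) (j : Fin 6) : TestFun (rv j f) :=
  (hf.smul (contDiff_const.mul (contDiff_coord j))).sub (hf.dv j)

theorem TestFun.clm {f : E6 → V} (hf : TestFun f) (L : V →L[ℂ] W) : TestFun fun x => L (f x) :=
  ⟨(L.restrictScalars ℝ).contDiff.comp hf.1, hf.2.comp_left (map_zero L)⟩

theorem dv_clm {f : E6 → V} (hf : Differentiable ℝ f) (L : V →L[ℂ] W) (j : Fin 6) (x : E6) :
    dv j (fun y => L (f y)) x = L (dv j f x) := by
  have := (L.restrictScalars ℝ).hasFDerivAt.comp x (hf x).hasFDerivAt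
  unfold dv
  have h2 : fderiv ℝ (fun y => L (f y)) x = _ := this.fderiv
  rw [h2]
  rfl

theorem rv_clm {f : E6 → V} (hf : Differentiable ℝ f) (L : V →L[ℂ] W) (j : Fin 6) (x : E6) :
    rv j (fun y => L (f y)) x = L (rv j f x) := by
  unfold rv
  rw [dv_clm hf, map_sub, ← Complex.coe_smul, ← Complex.coe_smul, map_smul]

theorem dv_smul {f : E6 → V} (hf : Differentiable ℝ f) {a : E6 → ℝ} (ha : Differentiable ℝ a)
    (j : Fin 6) (x : E6) :
    dv j (fun y => a y • f y) x =
      a x • dv j f x + (fderiv ℝ a x (EuclideanSpace.single j 1)) • f x := by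
  unfold dv
  rw [fderiv_fun_smul (ha x) (hf x)]
  simp

theorem contDiff_expPhi : ContDiff ℝ ∞ (fun y : E6 => Real.exp (phi y)) := by
  unfold phi
  exact (contDiff_norm_sq ℝ).exp

theorem contDiff_expNegPhi : ContDiff ℝ ∞ (fun y : E6 => Real.exp (-phi y)) := by
  unfold phi
  exact (contDiff_norm_sq ℝ).neg.exp

theorem hasFDerivAt_phi (x : E6) : HasFDerivAt phi (2 • innerSL ℝ x) x :=
  (hasStrictFDerivAt_norm_sq x).hasFDerivAt

theorem fderiv_expNegPhi (x : E6) (j : Fin 6) :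
    fderiv ℝ (fun y : E6 => Real.exp (-phi y)) x (EuclideanSpace.single j 1) =
      -(2 * x j) * Real.exp (-phi x) := by
  have h : HasFDerivAt (fun y : E6 => -phi y) (-(2 • innerSL ℝ x)) x := (hasFDerivAt_phi x).neg
  rw [h.exp.fderiv]
  simp [EuclideanSpace.inner_single_right]
  ring

theorem fderiv_expPhi (x : E6) (j : Fin 6) :
    fderiv ℝ (fun y : E6 => Real.exp (phi y)) x (EuclideanSpace.single j 1) =
      (2 * x j) * Real.exp (phi x) := by
  rw [((hasFDerivAt_phi x).exp).fderiv]
  simp [EuclideanSpace.inner_single_right]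
  ring

/-- Conjugation by the Gaussian turns `-∂_j` into its weighted adjoint; the term `2 x_j` is the
derivative of `φ`. -/
theorem dv_expNegPhi_smul {f : E6 → V} (hf : Differentiable ℝ f) (j : Fin 6) (x : E6) :
    dv j (fun y => Real.exp (-phi y) • f y) x = -(Real.exp (-phi x) • rv j f x) := by
  rw [dv_smul hf (contDiff_expNegPhi.differentiable (by simp)), fderiv_expNegPhi, rv]
  module

theorem rv_expPhi_smul {f : E6 → V} (hf : Differentiable ℝ f) (j : Fin 6) (x : E6) :
    rv j (fun y => Real.exp (phi y) • f y) x = -(Real.exp (phi x) • dv j f x) := by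
  rw [rv, dv_smul hf (contDiff_expPhi.differentiable (by simp)), fderiv_expPhi]
  module

theorem TestFun.integrable_inner {F G : E6 → V} (hF : TestFun F) (hG : Continuous G) :
    Integrable (fun x => inner ℂ (F x) (G x)) gaussWeight :=
  (hF.continuous.inner hG).integrable_of_hasCompactSupport
    (HasCompactSupport.intro hF.2 fun x hx => by simp [image_eq_zero_of_notMem_tsupport hx])

theorem integral_inner_dv {F G : E6 → V} (hF : TestFun F) (hG : TestFun G) (j : Fin 6) :
    ∫ x, inner ℂ (dv j F x) (G x) ∂gaussWeight = ∫ x, inner ℂ (F x) (rv j G x) ∂gaussWeight := by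
  rw [integral_gaussWeight, integral_gaussWeight]
  -- With the weight absorbed in the second factor, unweighted integration by parts applies.
  have hK : TestFun fun y => Real.exp (-phi y) • G y := hG.smul contDiff_expNegPhi
  let B : V →L[ℝ] V →L[ℝ] ℂ := (isBoundedBilinearMap_inner (𝕜 := ℂ) (E := V)).toContinuousLinearMap
  have hB : ∀ a b, B a b = inner ℂ a b := fun a b => rfl
  have key : ∀ {f g : E6 → V}, TestFun f → TestFun g →
      Integrable fun x => B (f x) (g x) := fun {f g} hf hg =>
    (hf.continuous.inner hg.continuous).integrable_of_hasCompactSupport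
      (HasCompactSupport.intro hf.2 fun x hx => by simp [image_eq_zero_of_notMem_tsupport hx])
  have h := integral_bilinear_fderiv_right_eq_neg_left_of_integrable (μ := volume) (B := B)
    (v := EuclideanSpace.single j (1 : ℝ))
    (key (hF.dv j) hK) (key hF (hK.dv j)) (key hF hK)
    (fun x _ => hF.differentiable x) (fun x _ => hK.differentiable x)
  have h' : ∫ x, inner ℂ (F x) (dv j (fun y => Real.exp (-phi y) • G y) x) =
    -∫ x, inner ℂ (dv j F x) (Real.exp (-phi x) • G x) := h
  simp only [dv_expNegPhi_smul hG.differentiable, inner_neg_right, integral_neg, neg_inj,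
    inner_smul_right_eq_smul, Complex.real_smul] at h'
  exact h'.symm

theorem integral_inner_rv {F G : E6 → V} (hF : TestFun F) (hG : TestFun G) (j : Fin 6) :
    ∫ x, inner ℂ (rv j F x) (G x) ∂gaussWeight = ∫ x, inner ℂ (F x) (dv j G x) ∂gaussWeight := by
  have h := congrArg conj (integral_inner_dv hG hF j)
  rw [← integral_conj, ← integral_conj] at h
  simpa only [inner_conj_symm] using h.symm

theorem dv_comm {f : E6 → V} (hf : ContDiff ℝ ∞ f) (i j : Fin 6) (x : E6) :
    dv i (dv j f) x = dv j (dv i f) x := by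
  have hs : IsSymmSndFDerivAt ℝ f x :=
    (hf.contDiffAt).isSymmSndFDerivAt (by
      rw [minSmoothness_of_isRCLikeNormedField]; exact WithTop.coe_le_coe.2 le_top)
  have hd : DifferentiableAt ℝ (fderiv ℝ f) x :=
    (hf.fderiv_right (m := ∞) (by simp)).differentiable (by simp) x
  have key : ∀ i j, dv i (dv j f) x =
      fderiv ℝ (fderiv ℝ f) x (EuclideanSpace.single i 1) (EuclideanSpace.single j 1) := by
    intro i j
    unfold dv
    rw [fderiv_clm_apply hd (by fun_prop)]
    simp
  rw [key, key]
  exact hs _ _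

theorem dv_rv {f : E6 → V} (hf : TestFun f) (i j : Fin 6) (x : E6) :
    dv i (rv j f) x = rv j (dv i f) x + (if i = j then (2 : ℝ) else 0) • f x := by
  have h1 : Differentiable ℝ (fun x : E6 => 2 * x j) :=
    (contDiff_const.mul (contDiff_coord j)).differentiable (by simp)
  have h2 : dv i (rv j f) x = dv i (fun y => (2 * y j) • f y) x - dv i (dv j f) x := by
    have e : rv j f = fun y => (2 * y j) • f y - dv j f y := rfl
    rw [e]
    unfold dv
    rw [fderiv_fun_sub]
    · rfl
    · exact (h1.smul hf.differentiable) x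
    · exact (hf.dv j).differentiable x
  have h3 : fderiv ℝ (fun x : E6 => 2 * x j) x (EuclideanSpace.single i 1) =
      if i = j then 2 else 0 := by
    have : HasFDerivAt (fun x : E6 => 2 * x j)
      ((2 : ℝ) • (EuclideanSpace.proj j : E6 →L[ℝ] ℝ)) x :=
      ((EuclideanSpace.proj j : E6 →L[ℝ] ℝ).hasFDerivAt).const_mul 2
    rw [this.fderiv]
    by_cases h : i = j <;> simp [h, eq_comm]
  rw [h2, dv_smul hf.differentiable h1, h3, dv_comm hf.1 i j, rv]
  abel

/-- Moving both operators across costs the commutator from `dv_rv`, nonzero only for `i = j`, and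
the derivatives come back with their indices exchanged. This is the only source of the positive
zero-order term. -/
theorem integral_inner_rv_rv {F G : E6 → V} (hF : TestFun F) (hG : TestFun G) (i j : Fin 6) :
    ∫ x, inner ℂ (rv i F x) (rv j G x) ∂gaussWeight =
      ∫ x, inner ℂ (dv j F x) (dv i G x) ∂gaussWeight +
        (if i = j then 2 else 0) * ∫ x, inner ℂ (F x) (G x) ∂gaussWeight := by
  rw [integral_inner_rv hF (hG.rv j), integral_inner_dv hF (hG.dv i)]
  simp only [dv_rv hG, inner_add_right]
  rw [integral_add (hF.integrable_inner ((hG.dv i).rv j).continuous)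
    (hF.integrable_inner
      (G := fun x => (if i = j then (2 : ℝ) else 0) • G x) (hG.continuous.const_smul _)), ← integral_const_mul]
  congr 2
  ext x
  rw [inner_smul_right_eq_smul, Complex.real_smul]
  split_ifs <;> simp

end Gaussian

/-! ### A priori estimates for test functions from pointwise algebra. -/

section Apriori

variable {V W W' U U' : Type*} [NormedAddCommGroup V] [InnerProductSpace ℂ V]
  [NormedAddCommGroup W] [InnerProductSpace ℂ W] [NormedAddCommGroup W'] [InnerProductSpace ℂ W']
  [NormedAddCommGroup U] [InnerProductSpace ℂ U] [NormedAddCommGroup U'] [InnerProductSpace ℂ U']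

theorem TestFun.integrable_normSq {f : E6 → V} (hf : TestFun f) :
    Integrable (fun x => ‖f x‖ ^ 2) gaussWeight :=
  (hf.continuous.norm.pow 2).integrable_of_hasCompactSupport
    (HasCompactSupport.intro hf.2 fun x hx => by simp [image_eq_zero_of_notMem_tsupport hx])

/-- The form obtained from `‖∑ M_i ζ_i‖²` by interchanging the two summation indices. -/
def swapForm (M : Fin 6 → V →L[ℂ] W) (ξ : Fin 6 → V) : ℝ :=
  (∑ i, ∑ j, inner ℂ (M i (ξ j)) (M j (ξ i))).re

theorem integrable_swapForm {f : E6 → V} (hf : TestFun f) (M : Fin 6 → V →L[ℂ] W) :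
    Integrable (fun x => swapForm M fun j => dv j f x) gaussWeight := by
  have h := (integrable_finsetSum (μ := gaussWeight) Finset.univ fun i _ =>
    integrable_finsetSum Finset.univ fun j _ =>
      ((hf.dv j).clm (M i)).integrable_inner ((hf.dv i).clm (M j)).continuous).re
  exact h

/-- The Bochner-type identity behind the estimate: expand the square and apply
`integral_inner_rv_rv` to each pair of terms. -/
theorem integral_normSq_sum_rv {f : E6 → V} (hf : TestFun f) (M : Fin 6 → V →L[ℂ] W) :
    ∫ x, ‖∑ i, M i (rv i f x)‖ ^ 2 ∂gaussWeight =
      ∫ x, (swapForm M (fun j => dv j f x) + 2 * ∑ i, ‖M i (f x)‖ ^ 2) ∂gaussWeight := by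
  have hM : ∀ i, TestFun fun x => M i (f x) := fun i => hf.clm (M i)
  have hMr : ∀ i j, TestFun fun x => M i (rv j f x) := fun i j => (hf.rv j).clm (M i)
  have hMd : ∀ i j, TestFun fun x => M i (dv j f x) := fun i j => (hf.dv j).clm (M i)
  have i1 : ∀ i j, Integrable (fun x => inner ℂ (M i (rv i f x)) (M j (rv j f x))) gaussWeight :=
    fun i j => (hMr i i).integrable_inner (hMr j j).continuous
  have i2 : ∀ i j, Integrable (fun x => inner ℂ (M i (dv j f x)) (M j (dv i f x))) gaussWeight :=
    fun i j => (hMd i j).integrable_inner (hMd j i).continuous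
  have i3 : ∀ i, Integrable (fun x => inner ℂ (M i (f x)) (M i (f x))) gaussWeight :=
    fun i => (hM i).integrable_inner (hM i).continuous
  have i4 := integrable_finsetSum Finset.univ fun i _ =>
    integrable_finsetSum Finset.univ fun j _ => i2 j i
  have i5 := (integrable_finsetSum Finset.univ fun i _ => i3 i).const_mul 2
  have main : ∫ x, inner ℂ (∑ i, M i (rv i f x)) (∑ i, M i (rv i f x)) ∂gaussWeight =
      ∫ x, ((∑ i, ∑ j, inner ℂ (M i (dv j f x)) (M j (dv i f x))) +
        2 * ∑ i, inner ℂ (M i (f x)) (M i (f x))) ∂gaussWeight := by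
    simp only [sum_inner, inner_sum]
    simp only [Finset.sum_comm (f := fun i j => inner ℂ (M i (dv j f _)) (M j (dv i f _)))]
    rw [integral_add i4 i5, integral_const_mul,
      integral_finsetSum _ fun i _ => integrable_finsetSum _ fun j _ => i1 j i,
      integral_finsetSum _ fun i _ => integrable_finsetSum _ fun j _ => i2 j i,
      integral_finsetSum _ fun i _ => i3 i, Finset.mul_sum, ← Finset.sum_add_distrib]
    refine Finset.sum_congr rfl fun i _ => ?_
    rw [integral_finsetSum _ fun j _ => i1 j i, integral_finsetSum _ fun j _ => i2 j i]
    have : ∀ j, ∫ x, inner ℂ (M j (rv j f x)) (M i (rv i f x)) ∂gaussWeight =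
        ∫ x, inner ℂ (M j (dv i f x)) (M i (dv j f x)) ∂gaussWeight +
          (if j = i then 2 else 0) * ∫ x, inner ℂ (M j (f x)) (M i (f x)) ∂gaussWeight := by
      intro j
      have := integral_inner_rv_rv (hM j) (hM i) j i
      simpa only [rv_clm hf.differentiable, dv_clm hf.differentiable] using this
    simp only [this, Finset.sum_add_distrib, ite_mul, zero_mul, Finset.sum_ite_eq',
      Finset.mem_univ, if_true]
  have hre := congrArg Complex.re main
  have r1 := integral_re (𝕜 := ℂ) ((TestFun.sum (s := Finset.univ) fun i _ => hMr i i).integrable_inner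
    (TestFun.sum (s := Finset.univ) fun i _ => hMr i i).continuous)
  have i4' := integrable_finsetSum Finset.univ fun i _ =>
    integrable_finsetSum Finset.univ fun j _ => i2 i j
  have r2 := integral_re (𝕜 := ℂ) (i4'.add i5)
  simp only [RCLike.re_eq_complex_re] at r1 r2
  refine (Eq.trans ?_ (r1.trans hre)).trans (r2.symm.trans ?_)
  · refine integral_congr_ae (Filter.Eventually.of_forall fun x => ?_)
    simp only
    rw [← inner_self_eq_norm_sq (𝕜 := ℂ)]
    rfl
  · refine integral_congr_ae (Filter.Eventually.of_forall fun x => ?_)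
    simp only [Pi.add_apply, Complex.add_re, swapForm, Complex.mul_re, Complex.re_sum]
    simp [← inner_self_eq_norm_sq (𝕜 := ℂ)]

/-- An a priori estimate from pointwise algebraic inequalities. -/
theorem apriori_of_pointwise (Q : Fin 6 → V →L[ℂ] U) (P : Fin 6 → V →L[ℂ] U')
    (M : Fin 6 → V →L[ℂ] W) (N : Fin 6 → V →L[ℂ] W') {A β c : ℝ}
    (h1 : ∀ ζ : Fin 6 → V, ‖∑ i, M i (ζ i)‖ ^ 2 - β * ‖∑ i, N i (ζ i)‖ ^ 2 ≤ ‖∑ i, Q i (ζ i)‖ ^ 2)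
    (h2 : ∀ ξ : Fin 6 → V, 0 ≤ swapForm M ξ - β * swapForm N ξ + A * ‖∑ i, P i (ξ i)‖ ^ 2)
    (h3 : ∀ η : V, c * ‖η‖ ^ 2 ≤ 2 * ∑ i, ‖M i η‖ ^ 2 - β * (2 * ∑ i, ‖N i η‖ ^ 2))
    {f : E6 → V} (hf : TestFun f) :
    c * ∫ x, ‖f x‖ ^ 2 ∂gaussWeight ≤
      A * ∫ x, ‖∑ i, P i (dv i f x)‖ ^ 2 ∂gaussWeight +
        ∫ x, ‖∑ i, Q i (rv i f x)‖ ^ 2 ∂gaussWeight := by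
  have tM : TestFun fun x => ∑ i, M i (rv i f x) := TestFun.sum fun i _ => (hf.rv i).clm (M i)
  have tN : TestFun fun x => ∑ i, N i (rv i f x) := TestFun.sum fun i _ => (hf.rv i).clm (N i)
  have tQ : TestFun fun x => ∑ i, Q i (rv i f x) := TestFun.sum fun i _ => (hf.rv i).clm (Q i)
  have tP : TestFun fun x => ∑ i, P i (dv i f x) := TestFun.sum fun i _ => (hf.dv i).clm (P i)
  have e1 : ∫ x, ‖∑ i, M i (rv i f x)‖ ^ 2 ∂gaussWeight -
      β * ∫ x, ‖∑ i, N i (rv i f x)‖ ^ 2 ∂gaussWeight ≤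
      ∫ x, ‖∑ i, Q i (rv i f x)‖ ^ 2 ∂gaussWeight := by
    rw [← integral_const_mul, ← integral_sub tM.integrable_normSq
      (tN.integrable_normSq.const_mul β)]
    exact integral_mono (tM.integrable_normSq.sub (tN.integrable_normSq.const_mul β))
      tQ.integrable_normSq fun x => h1 _
  have gM : Integrable (fun x => 2 * ∑ i, ‖M i (f x)‖ ^ 2) gaussWeight :=
    (integrable_finsetSum _ fun i _ => (hf.clm (M i)).integrable_normSq).const_mul 2
  have gN : Integrable (fun x => 2 * ∑ i, ‖N i (f x)‖ ^ 2) gaussWeight :=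
    (integrable_finsetSum _ fun i _ => (hf.clm (N i)).integrable_normSq).const_mul 2
  have gM' := (integrable_swapForm hf M).add gM
  have gN' := ((integrable_swapForm hf N).add gN).const_mul β
  -- Both squares are traded for their exchanged forms at `∂f` and zero-order terms, to which `h2`
  -- and `h3` apply pointwise.
  have e2 := integral_normSq_sum_rv hf M
  have e3 : β * ∫ x, ‖∑ i, N i (rv i f x)‖ ^ 2 ∂gaussWeight = _ :=
    (congrArg (β * ·) (integral_normSq_sum_rv hf N)).trans (integral_const_mul _ _).symm
  rw [e2, e3] at e1
  refine le_trans ?_ (add_le_add le_rfl ((integral_sub gM' gN').trans_le e1))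
  rw [← integral_const_mul, ← integral_const_mul]
  refine le_trans ?_ (integral_add (tP.integrable_normSq.const_mul A) (gM'.sub gN')).le
  refine integral_mono (hf.integrable_normSq.const_mul c)
    ((tP.integrable_normSq.const_mul A).add (gM'.sub gN')) fun x => ?_
  have a1 := h2 fun j => dv j f x
  have a2 := h3 (f x)
  simp only [Pi.add_apply, Pi.sub_apply]
  linarith

end Apriori

/-! ### Mollification in the Gaussian weight. -/

section Mollify

open Filter Topology

variable {V : Type*} [NormedAddCommGroup V] [InnerProductSpace ℂ V]

theorem integrable_gaussWeight_iff {E : Type*} [NormedAddCommGroup E] [NormedSpace ℝ E]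
    {F : E6 → E} :
    Integrable F gaussWeight ↔ Integrable fun x => Real.exp (-phi x) • F x := by
  unfold gaussWeight
  rw [integrable_withDensity_iff_integrable_smul' (by unfold phi; fun_prop)
    (Eventually.of_forall fun x => ENNReal.ofReal_lt_top)]
  simp only [ENNReal.toReal_ofReal (Real.exp_pos _).le]

theorem integral_gaussWeight_real (F : E6 → ℝ) :
    ∫ x, F x ∂gaussWeight = ∫ x, Real.exp (-phi x) * F x := by
  rw [gaussWeight, integral_withDensity_eq_integral_toReal_smul]
  · refine integral_congr_ae (Filter.Eventually.of_forall fun x => ?_)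
    simp [ENNReal.toReal_ofReal (Real.exp_pos _).le]
  · unfold phi; fun_prop
  · exact Filter.Eventually.of_forall fun x => ENNReal.ofReal_lt_top

theorem gaussWeight_absolutelyContinuous : gaussWeight ≪ volume :=
  withDensity_absolutelyContinuous _ _

theorem continuous_expPhi : Continuous fun y : E6 => Real.exp (phi y) :=
  contDiff_expPhi.continuous

/-- On a compact set the weight can be divided out, because `e^φ` is continuous. -/
theorem locallyIntegrable_volume {E : Type*} [NormedAddCommGroup E] [NormedSpace ℝ E]
    {f : E6 → E} (hf : LocallyIntegrable f gaussWeight) :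
    LocallyIntegrable f volume := by
  rw [locallyIntegrable_iff] at hf ⊢
  intro K hK
  have h1 : IntegrableOn (fun x => Real.exp (phi x) • f x) K gaussWeight :=
    (hf K hK).continuousOn_smul continuous_expPhi.continuousOn hK
  have h2 : Integrable (K.indicator fun x => Real.exp (phi x) • f x) gaussWeight :=
    (integrable_indicator_iff hK.measurableSet).2 h1
  rw [integrable_gaussWeight_iff] at h2
  refine (integrable_indicator_iff hK.measurableSet).1 (h2.congr (Eventually.of_forall fun x => ?_))
  by_cases hx : x ∈ K
  · simp [hx, smul_smul, ← Real.exp_add]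
  · simp [hx]

/-- Convolution with a real function. -/
def mollify (ρ : E6 → ℝ) (f : E6 → V) (x : E6) : V := ∫ y, ρ (x - y) • f y

theorem mollify_eq (ρ : E6 → ℝ) (f : E6 → V) :
    mollify ρ f = convolution ρ f (ContinuousLinearMap.lsmul ℝ ℝ) volume := by
  ext x
  rw [convolution_eq_swap]
  rfl

variable {ρ : E6 → ℝ} {f : E6 → V}

theorem integrable_mollify (hρ : Continuous ρ) (cρ : HasCompactSupport ρ)
    (hf : LocallyIntegrable f volume) (x : E6) : Integrable fun y => ρ (x - y) • f y :=
  (convolutionExistsAt_iff_integrable_swap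
    (L := ContinuousLinearMap.lsmul ℝ ℝ)).1 (cρ.convolutionExists_left _ hρ hf x)

theorem contDiff_mollify (hρ : ContDiff ℝ ∞ ρ) (cρ : HasCompactSupport ρ)
    (hf : LocallyIntegrable f volume) : ContDiff ℝ ∞ (mollify ρ f) := by
  rw [mollify_eq]
  exact cρ.contDiff_convolution_left _ (n := ⊤) hρ hf

theorem dv_mollify (hρ : ContDiff ℝ ∞ ρ) (cρ : HasCompactSupport ρ)
    (hf : LocallyIntegrable f volume) (j : Fin 6) (x : E6) :
    dv j (mollify ρ f) x =
      mollify (fun y => fderiv ℝ ρ y (EuclideanSpace.single j 1)) f x := by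
  have h := (cρ.hasFDerivAt_convolution_left (ContinuousLinearMap.lsmul ℝ ℝ : ℝ →L[ℝ] V →L[ℝ] V)
    (hρ.of_le (by simp)) hf x).fderiv
  rw [dv, mollify_eq, h, convolution_eq_swap, ContinuousLinearMap.integral_apply]
  · rfl
  · refine (convolutionExistsAt_iff_integrable_swap
      (L := (ContinuousLinearMap.lsmul ℝ ℝ : ℝ →L[ℝ] V →L[ℝ] V).precompL E6)).1
      ((cρ.fderiv ℝ).convolutionExists_left _ (hρ.continuous_fderiv (by simp)) hf x)

theorem norm_mollify_le (h0 : ∀ x, 0 ≤ ρ x) (x : E6) :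
    ‖mollify ρ f x‖ ≤ ∫ y, ρ (x - y) * ‖f y‖ := by
  refine (norm_integral_le_integral_norm _).trans (le_of_eq ?_)
  simp [norm_smul, abs_of_nonneg (h0 _)]

/-- Jensen's inequality for a mollified function. -/
theorem sq_integral_mollify_le (hρ : Continuous ρ) (cρ : HasCompactSupport ρ) (h0 : ∀ x, 0 ≤ ρ x)
    (h1 : ∫ x, ρ x = 1) {F : E6 → ℝ} (hF : LocallyIntegrable F volume)
    (hF2 : LocallyIntegrable (fun x => F x ^ 2) volume) (x : E6) :
    (∫ y, ρ (x - y) * F y) ^ 2 ≤ ∫ y, ρ (x - y) * F y ^ 2 := by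
  have key : ∀ {G : E6 → ℝ}, LocallyIntegrable G volume → Integrable fun y => ρ (x - y) * G y :=
    fun {G} hG => (convolutionExistsAt_iff_integrable_swap
      (L := ContinuousLinearMap.lsmul ℝ ℝ)).1 (cρ.convolutionExists_left _ hρ hG x)
  set m := ∫ y, ρ (x - y) * F y with hm
  have i1 := key hF
  have i2 := key hF2
  have i0 : Integrable fun y => ρ (x - y) := by
    simpa using key (G := fun _ => 1) (continuous_const.locallyIntegrable)
  have e0 : ∫ y, ρ (x - y) = 1 := by rw [integral_sub_left_eq_self ρ]; exact h1
  -- The integrand is `ρ (x - y) (F y - m)²`: a variance is nonnegative.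
  have h : 0 ≤ ∫ y, (ρ (x - y) * F y ^ 2 - 2 * m * (ρ (x - y) * F y) + m ^ 2 * ρ (x - y)) := by
    refine integral_nonneg fun y => ?_
    have : ρ (x - y) * F y ^ 2 - 2 * m * (ρ (x - y) * F y) + m ^ 2 * ρ (x - y) =
      ρ (x - y) * (F y - m) ^ 2 := by ring
    simp only [this]
    exact mul_nonneg (h0 _) (sq_nonneg _)
  have e1 := integral_add (i2.sub (i1.const_mul (2 * m))) (i0.const_mul (m ^ 2))
  have e2 := integral_sub i2 (i1.const_mul (2 * m))
  rw [integral_const_mul] at e1 e2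
  simp only [Pi.sub_apply] at e1
  rw [e1, e2, e0, ← hm] at h
  nlinarith

theorem phi_le_phi_add {x y : E6} {R ε : ℝ} (hx : ‖x‖ ≤ R) (hε : 0 ≤ ε) (hxy : ‖x - y‖ ≤ ε) :
    phi y ≤ phi x + ε * (2 * R + ε) := by
  unfold phi
  have h : ‖y‖ ≤ ‖x‖ + ε := by
    have := norm_sub_norm_le y x
    rw [norm_sub_rev] at this
    linarith
  have := norm_nonneg x
  have := norm_nonneg y
  nlinarith

/-- A function supported in a ball and dominated by a mollified function has weighted norm at
most that of the original function, up to a factor close to `1`. -/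
theorem integral_normSq_le_of_mollify {E : Type*} [NormedAddCommGroup E] (hρ : Continuous ρ) (cρ : HasCompactSupport ρ)
    (h0 : ∀ x, 0 ≤ ρ x) (h1 : ∫ x, ρ x = 1) {ε R : ℝ} (hε : 0 ≤ ε)
    (hs : ∀ x, ε < ‖x‖ → ρ x = 0) {F : E6 → ℝ} (hF : MemLp F 2 gaussWeight)
    {w : E6 → E} (hw : Integrable (fun x => ‖w x‖ ^ 2) gaussWeight)
    (hwR : ∀ x, R < ‖x‖ → w x = 0) (hwF : ∀ x, ‖w x‖ ≤ ∫ y, ρ (x - y) * F y) :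
    ∫ x, ‖w x‖ ^ 2 ∂gaussWeight ≤
      Real.exp (ε * (2 * R + ε)) * ∫ x, F x ^ 2 ∂gaussWeight := by
  have hF1 : LocallyIntegrable F volume :=
    locallyIntegrable_volume (hF.locallyIntegrable (by norm_num))
  have hFi : Integrable (fun x => F x ^ 2) gaussWeight := hF.integrable_sq
  have hF2 : LocallyIntegrable (fun x => F x ^ 2) volume :=
    locallyIntegrable_volume hFi.locallyIntegrable
  have hG : Integrable (fun x => Real.exp (-phi x) * F x ^ 2) volume :=
    integrable_gaussWeight_iff.1 hFi
  rw [integral_gaussWeight_real, integral_gaussWeight_real]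
  have hρi : Integrable ρ := hρ.integrable_of_hasCompactSupport cρ
  -- Since `ρ` has mass one, convolving `e^{-φ} F²` with it preserves the integral; the task is then
  -- to compare integrands at each `x`.
  have e1 := integral_convolution (ContinuousLinearMap.lsmul ℝ ℝ : ℝ →L[ℝ] ℝ →L[ℝ] ℝ) hρi hG
  have e2 := hρi.integrable_convolution (ContinuousLinearMap.lsmul ℝ ℝ : ℝ →L[ℝ] ℝ →L[ℝ] ℝ) hG
  simp only [h1, ContinuousLinearMap.lsmul_apply, one_smul] at e1
  rw [← e1, ← integral_const_mul]
  refine integral_mono (integrable_gaussWeight_iff.1 hw) (e2.const_mul _) fun x => ?_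
  simp only [convolution_eq_swap, ContinuousLinearMap.lsmul_apply, smul_eq_mul]
  have hn : 0 ≤ ∫ y, ρ (x - y) * (Real.exp (-phi y) * F y ^ 2) :=
    integral_nonneg fun y => mul_nonneg (h0 _) (mul_nonneg (Real.exp_pos _).le (sq_nonneg _))
  rcases lt_or_ge R ‖x‖ with hx | hx
  · rw [hwR x hx]
    simp only [norm_zero]
    have := mul_nonneg (Real.exp_pos (ε * (2 * R + ε))).le hn
    simpa using this
  · have a1 : ‖w x‖ ^ 2 ≤ ∫ y, ρ (x - y) * F y ^ 2 :=
      (pow_le_pow_left₀ (norm_nonneg _) (hwF x) 2).trans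
        (sq_integral_mollify_le hρ cρ h0 h1 hF1 hF2 x)
    refine (mul_le_mul_of_nonneg_left a1 (Real.exp_pos _).le).trans ?_
    rw [← integral_const_mul, ← integral_const_mul]
    have key : ∀ {G : E6 → ℝ}, LocallyIntegrable G volume → Integrable fun y => ρ (x - y) * G y :=
      fun {G} hG => (convolutionExistsAt_iff_integrable_swap
        (L := ContinuousLinearMap.lsmul ℝ ℝ)).1 (cρ.convolutionExists_left _ hρ hG x)
    refine integral_mono ((key hF2).const_mul _) ((key hG.locallyIntegrable).const_mul _)
      fun y => ?_
    simp only
    by_cases hy : ε < ‖x - y‖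
    · simp [hs _ hy]
    · have := phi_le_phi_add hx hε (not_lt.1 hy)
      -- For `‖x - y‖ ≤ ε` the weights at `x` and `y` differ by at most this factor. It is finite
      -- because `‖x‖ ≤ R`, the reason for requiring `w` to vanish outside a ball.
      have h3 : Real.exp (-phi x) ≤ Real.exp (ε * (2 * R + ε)) * Real.exp (-phi y) := by
        rw [← Real.exp_add]
        exact Real.exp_le_exp.2 (by linarith)
      have h4 := mul_le_mul_of_nonneg_right h3 (mul_nonneg (h0 (x - y)) (sq_nonneg (F y)))
      linarith

end Mollify

/-! ### Mollified weak solutions. -/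

section Weak

open Filter Topology

variable {U V W : Type*} [NormedAddCommGroup V] [InnerProductSpace ℂ V]
  [NormedAddCommGroup W] [InnerProductSpace ℂ W]
  [NormedAddCommGroup U] [InnerProductSpace ℂ U]

variable {ρ : E6 → ℝ} {f : E6 → V}

theorem testFun_translate (hρ : ContDiff ℝ ∞ ρ) (cρ : HasCompactSupport ρ) (x : E6) (c : W) :
    TestFun fun y => ρ (x - y) • c :=
  ⟨(hρ.comp (contDiff_const.sub contDiff_id)).smul contDiff_const,
    (cρ.comp_homeomorph (Homeomorph.subLeft x)).smul_right⟩

theorem dv_translate (hρ : ContDiff ℝ ∞ ρ) (x : E6) (c : W) (j : Fin 6) (y : E6) :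
    dv j (fun y => ρ (x - y) • c) y =
      -((fderiv ℝ ρ (x - y) (EuclideanSpace.single j 1)) • c) := by
  have h1 : HasFDerivAt ρ (fderiv ℝ ρ (x - y)) (x - y) :=
    (hρ.differentiable (by simp) _).hasFDerivAt
  have h2 : HasFDerivAt (fun y => ρ (x - y)) (-fderiv ℝ ρ (x - y)) y := by
    have := h1.comp y ((hasFDerivAt_id y).const_sub x)
    have e : -fderiv ℝ ρ (x - y) = (fderiv ℝ ρ (x - y)).comp (-ContinuousLinearMap.id ℝ E6) := by
      ext; simp
    rw [e]
    exact this
  rw [dv, (h2.smul_const c).fderiv]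
  simp

theorem dv_expPhi_smul {g : E6 → W} (hg : Differentiable ℝ g) (j : Fin 6) (x : E6) :
    dv j (fun y => Real.exp (phi y) • g y) x =
      Real.exp (phi x) • (dv j g x + (2 * x j) • g x) := by
  rw [dv_smul hg (contDiff_expPhi.differentiable (by simp)), fderiv_expPhi]
  module

theorem integral_gaussWeight_exp_smul_inner (g f : E6 → V) :
    ∫ y, inner ℂ (Real.exp (phi y) • g y) (f y) ∂gaussWeight = ∫ y, inner ℂ (g y) (f y) := by
  rw [integral_gaussWeight]
  refine integral_congr_ae (Eventually.of_forall fun y => ?_)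
  simp only [inner_smul_left_eq_smul, Complex.real_smul]
  rw [← mul_assoc, ← Complex.ofReal_mul, ← Real.exp_add]
  simp

theorem integrable_inner_mollify (hρ : Continuous ρ) (cρ : HasCompactSupport ρ)
    (hf : LocallyIntegrable f volume) (x : E6) (c : V) :
    Integrable fun y => inner ℂ (ρ (x - y) • c) (f y) := by
  have := (integrable_mollify hρ cρ hf x).const_inner (𝕜 := ℂ) c
  simpa only [inner_smul_left_eq_smul, inner_smul_right_eq_smul] using this

variable [CompleteSpace V]

theorem inner_mollify (hρ : Continuous ρ) (cρ : HasCompactSupport ρ)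
    (hf : LocallyIntegrable f volume) (x : E6) (c : V) :
    inner ℂ c (mollify ρ f x) = ∫ y, inner ℂ (ρ (x - y) • c) (f y) := by
  rw [mollify, ← integral_inner (integrable_mollify hρ cρ hf x)]
  simp only [inner_smul_left_eq_smul, inner_smul_right_eq_smul]

variable [CompleteSpace U] [CompleteSpace W]

open ContinuousLinearMap in
/-- A weak solution of `∑ P_j ∂_j f = u` mollifies to a solution. -/
theorem sum_dv_mollify (P : Fin 6 → V →L[ℂ] W) {u : E6 → W}
    (hf : LocallyIntegrable f volume) (hu : LocallyIntegrable u volume)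
    (hw : ∀ g : E6 → W, TestFun g → ∫ x, inner ℂ (g x) (u x) ∂gaussWeight =
      ∫ x, inner ℂ (∑ j, adjoint (P j) (rv j g x)) (f x) ∂gaussWeight)
    (hρ : ContDiff ℝ ∞ ρ) (cρ : HasCompactSupport ρ) (x : E6) :
    ∑ j, P j (dv j (mollify ρ f) x) = mollify ρ u x := by
  refine ext_inner_left ℂ fun c => ?_
  have hg := testFun_translate hρ cρ x c
  have hd : ∀ j : Fin 6, Continuous fun y => fderiv ℝ ρ y (EuclideanSpace.single j 1) := fun j =>
    (hρ.continuous_fderiv (by simp)).clm_apply continuous_const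
  have cd : ∀ j : Fin 6, HasCompactSupport fun y => fderiv ℝ ρ y (EuclideanSpace.single j 1) :=
    fun j => cρ.fderiv_apply ℝ _
  -- The test function `e^φ ρ(x - ·) c` cancels the weight and turns the weak equation into a
  -- convolution evaluated at `x`.
  have h := hw _ (hg.smul contDiff_expPhi)
  rw [integral_gaussWeight_exp_smul_inner] at h
  rw [inner_mollify hρ.continuous cρ hu, h]
  have e : ∀ y, ∑ j, adjoint (P j) (rv j (fun y => Real.exp (phi y) • ρ (x - y) • c) y) =
      Real.exp (phi y) • ∑ j, fderiv ℝ ρ (x - y) (EuclideanSpace.single j 1) •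
        adjoint (P j) c := fun y => by
    rw [Finset.smul_sum]
    refine Finset.sum_congr rfl fun j _ => ?_
    rw [rv_expPhi_smul hg.differentiable, dv_translate hρ, smul_neg, neg_neg,
      ← Complex.coe_smul, ← Complex.coe_smul, map_smul, map_smul]
    simp only [Complex.coe_smul]
  simp only [e]
  rw [integral_gaussWeight_exp_smul_inner]
  simp only [sum_inner, inner_sum]
  rw [integral_finsetSum _ fun j _ => integrable_inner_mollify (hd j) (cd j) hf x _]
  refine Finset.sum_congr rfl fun j _ => ?_
  rw [← inner_mollify (hd j) (cd j) hf, adjoint_inner_left, dv_mollify hρ cρ hf]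

open ContinuousLinearMap in
/-- A weak solution of `∑ Q_j (2 x_j - ∂_j) f = v` mollifies to a solution up to a small error. -/
theorem sum_rv_mollify (Q : Fin 6 → V →L[ℂ] U) {v : E6 → U}
    (hf : LocallyIntegrable f volume) (hv : LocallyIntegrable v volume)
    (hw : ∀ h : E6 → U, TestFun h → ∫ x, inner ℂ (h x) (v x) ∂gaussWeight =
      ∫ x, inner ℂ (∑ j, adjoint (Q j) (dv j h x)) (f x) ∂gaussWeight)
    (hρ : ContDiff ℝ ∞ ρ) (cρ : HasCompactSupport ρ) (x : E6) :
    ∑ j, Q j (rv j (mollify ρ f) x) =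
      mollify ρ v x + ∑ j, Q j (mollify (fun z => 2 * z j * ρ z) f x) := by
  refine ext_inner_left ℂ fun c => ?_
  have hg := testFun_translate hρ cρ x c
  have hd : ∀ j : Fin 6, Continuous fun y => fderiv ℝ ρ y (EuclideanSpace.single j 1) := fun j =>
    (hρ.continuous_fderiv (by simp)).clm_apply continuous_const
  have cd : ∀ j : Fin 6, HasCompactSupport fun y => fderiv ℝ ρ y (EuclideanSpace.single j 1) :=
    fun j => cρ.fderiv_apply ℝ _
  have he : ∀ j : Fin 6, Continuous fun z : E6 => 2 * z j * ρ z := fun j =>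
    (continuous_const.mul (contDiff_coord j).continuous).mul hρ.continuous
  have ce : ∀ j : Fin 6, HasCompactSupport fun z : E6 => 2 * z j * ρ z := fun j => cρ.mul_left
  have h := hw _ (hg.smul contDiff_expPhi)
  rw [integral_gaussWeight_exp_smul_inner] at h
  rw [inner_add_right, inner_mollify hρ.continuous cρ hv, h]
  -- The derivative of `e^φ` yields `2 y_j`, rewritten as `2 x_j - 2 (x - y)_j`: the first part
  -- belongs to the operator at `x`, the second is the error kernel `2 z_j ρ(z)`.
  have e : ∀ y, ∑ j, adjoint (Q j) (dv j (fun y => Real.exp (phi y) • ρ (x - y) • c) y) =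
      Real.exp (phi y) • ∑ j, (2 * x j * ρ (x - y) - 2 * (x - y) j * ρ (x - y) -
        fderiv ℝ ρ (x - y) (EuclideanSpace.single j 1)) • adjoint (Q j) c := fun y => by
    rw [Finset.smul_sum]
    refine Finset.sum_congr rfl fun j _ => ?_
    have : dv j (fun y => Real.exp (phi y) • ρ (x - y) • c) y =
        ((Real.exp (phi y) * (2 * x j * ρ (x - y) - 2 * (x - y) j * ρ (x - y) -
        fderiv ℝ ρ (x - y) (EuclideanSpace.single j 1)) : ℝ) : ℂ) • c := by
      rw [dv_expPhi_smul hg.differentiable, dv_translate hρ, Complex.coe_smul]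
      simp only [PiLp.sub_apply]
      module
    rw [this, map_smul, Complex.coe_smul, smul_smul]
  simp only [e]
  rw [integral_gaussWeight_exp_smul_inner]
  simp only [sum_inner, inner_sum]
  have i1 : ∀ (j : Fin 6) (c : V), Integrable fun y => inner ℂ ((2 * x j * ρ (x - y)) • c) (f y) :=
    fun j c => integrable_inner_mollify (ρ := fun z => 2 * x j * ρ z)
      (continuous_const.mul hρ.continuous) cρ.mul_left hf x c
  have i2 : ∀ (j : Fin 6) (c : V), Integrable fun y =>
      inner ℂ ((2 * (x - y) j * ρ (x - y)) • c) (f y) :=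
    fun j c => integrable_inner_mollify (he j) (ce j) hf x c
  have i3 : ∀ (j : Fin 6) (c : V), Integrable fun y =>
      inner ℂ ((fderiv ℝ ρ (x - y) (EuclideanSpace.single j 1)) • c) (f y) :=
    fun j c => integrable_inner_mollify (hd j) (cd j) hf x c
  rw [integral_finsetSum, ← Finset.sum_add_distrib]
  · refine Finset.sum_congr rfl fun j _ => ?_
    simp only [sub_smul, inner_sub_left]
    have a1 := integral_sub ((i1 j (adjoint (Q j) c)).sub (i2 j (adjoint (Q j) c)))
      (i3 j (adjoint (Q j) c))
    simp only [Pi.sub_apply] at a1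
    rw [a1, integral_sub (i1 j _) (i2 j _), ← inner_mollify (hd j) (cd j) hf,
      ← inner_mollify (he j) (ce j) hf, ← inner_mollify (ρ := fun z => 2 * x j * ρ z)
      (continuous_const.mul hρ.continuous) cρ.mul_left hf, adjoint_inner_left,
      adjoint_inner_left, adjoint_inner_left, rv, dv_mollify hρ cρ hf, map_sub, inner_sub_right]
    have : mollify (fun z => 2 * x j * ρ z) f x = (2 * x j) • mollify ρ f x := by
      simp only [mollify, ← integral_smul, smul_smul]
    rw [this]
    ring
  · intro j _
    simp only [sub_smul, inner_sub_left]
    exact ((i1 j _).sub (i2 j _)).sub (i3 j _)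

end Weak

/-! ### Passage from test functions to weak solutions. -/

section WeakEstimate

open Filter Topology

variable {U V W : Type*} [NormedAddCommGroup V] [InnerProductSpace ℂ V]
  [NormedAddCommGroup W] [InnerProductSpace ℂ W] [NormedAddCommGroup U] [InnerProductSpace ℂ U]

theorem dv_of_notMem {f : E6 → V} {x : E6} (hx : x ∉ tsupport f) (j : Fin 6) : dv j f x = 0 := by
  have : fderiv ℝ f x = 0 := by
    by_contra h
    exact hx (support_fderiv_subset ℝ (Function.mem_support.2 h))
  simp [dv, this]

theorem norm_sum_clm_le (P : Fin 6 → V →L[ℂ] W) {ξ : Fin 6 → V} {t : ℝ} (h : ∀ j, ‖ξ j‖ ≤ t) :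
    ‖∑ j, P j (ξ j)‖ ≤ (∑ j, ‖P j‖) * t := by
  rw [Finset.sum_mul]
  refine (norm_sum_le _ _).trans (Finset.sum_le_sum fun j _ => ((P j).le_opNorm _).trans ?_)
  exact mul_le_mul_of_nonneg_left (h j) (norm_nonneg _)

theorem clm_real_smul (L : V →L[ℂ] W) (a : ℝ) (z : V) : L (a • z) = a • L z := by
  rw [← Complex.coe_smul, map_smul, Complex.coe_smul]

theorem norm_smul_le_of_le_one {a : ℝ} (h0 : 0 ≤ a) (h1 : a ≤ 1) (z : V) : ‖a • z‖ ≤ ‖z‖ := by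
  rw [norm_smul, Real.norm_of_nonneg h0]
  exact mul_le_of_le_one_left (norm_nonneg _) h1

theorem locallyIntegrable_norm {E : Type*} [NormedAddCommGroup E] {f : E6 → E} {μ : Measure E6}
    (hf : LocallyIntegrable f μ) : LocallyIntegrable (fun x => ‖f x‖) μ := fun x =>
  let ⟨s, hs, h⟩ := hf x
  ⟨s, hs, h.norm⟩

theorem memLp_norm_add {E F : Type*} [NormedAddCommGroup E] [NormedAddCommGroup F] {f : E6 → E}
    {u : E6 → F} (hf : MemLp f 2 gaussWeight) (hu : MemLp u 2 gaussWeight) (t : ℝ) :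
    MemLp (fun y => ‖u y‖ + t * ‖f y‖) 2 gaussWeight :=
  hu.norm.add (hf.norm.const_mul t)

theorem tendsto_integral_sq_add {E F : Type*} [NormedAddCommGroup E] [NormedAddCommGroup F]
    {f : E6 → E} {u : E6 → F} (hf : MemLp f 2 gaussWeight)
    (hu : MemLp u 2 gaussWeight) {t : ℕ → ℝ} (ht : Tendsto t atTop (𝓝 0)) :
    Tendsto (fun n => ∫ x, (‖u x‖ + t n * ‖f x‖) ^ 2 ∂gaussWeight) atTop
      (𝓝 (∫ x, ‖u x‖ ^ 2 ∂gaussWeight)) := by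
  have i1 : Integrable (fun x => ‖u x‖ ^ 2) gaussWeight := hu.norm.integrable_sq
  have i2 : Integrable (fun x => ‖f x‖ ^ 2) gaussWeight := hf.norm.integrable_sq
  have i3 : Integrable (fun x => ‖u x‖ * ‖f x‖) gaussWeight := hu.norm.integrable_mul hf.norm
  have e : ∀ n, ∫ x, (‖u x‖ + t n * ‖f x‖) ^ 2 ∂gaussWeight =
      ∫ x, ‖u x‖ ^ 2 ∂gaussWeight + (2 * t n) * ∫ x, ‖u x‖ * ‖f x‖ ∂gaussWeight +
        (t n) ^ 2 * ∫ x, ‖f x‖ ^ 2 ∂gaussWeight := fun n => by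
    rw [← integral_const_mul, ← integral_const_mul, ← integral_add i1 (i3.const_mul _)]
    refine Eq.trans ?_ (integral_add (i1.add (i3.const_mul _)) (i2.const_mul _))
    congr 1
    ext x
    ring
  simp only [e]
  have := ((tendsto_const_nhds (x := ∫ x, ‖u x‖ ^ 2 ∂gaussWeight)).add
    ((ht.const_mul 2).mul_const (∫ x, ‖u x‖ * ‖f x‖ ∂gaussWeight))).add
    ((ht.pow 2).mul_const (∫ x, ‖f x‖ ^ 2 ∂gaussWeight))
  simpa using this

/-- Fatou's lemma for squared norms. -/
theorem integral_normSq_le_of_tendsto {E : Type*} [NormedAddCommGroup E] {f : E6 → E}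
    {w : ℕ → E6 → E} {d : ℕ → ℝ} {D : ℝ} 
    (hf : MemLp f 2 gaussWeight)
    (hw : ∀ n, Integrable (fun x => ‖w n x‖ ^ 2) gaussWeight)
    (hd : ∀ n, ∫ x, ‖w n x‖ ^ 2 ∂gaussWeight ≤ d n) (hD : Tendsto d atTop (𝓝 D))
    (hlim : ∀ᵐ x ∂gaussWeight, Tendsto (fun n => w n x) atTop (𝓝 (f x))) :
    ∫ x, ‖f x‖ ^ 2 ∂gaussWeight ≤ D := by
  have i2 : Integrable (fun x => ‖f x‖ ^ 2) gaussWeight := hf.norm.integrable_sq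
  have hD0 : 0 ≤ D := ge_of_tendsto' hD fun n => (integral_nonneg fun x => sq_nonneg _).trans (hd n)
  rw [integral_eq_lintegral_of_nonneg_ae (Eventually.of_forall fun x => sq_nonneg _)
    i2.aestronglyMeasurable]
  refine ENNReal.toReal_le_of_le_ofReal hD0 ?_
  have h1 : ∫⁻ x, ENNReal.ofReal (‖f x‖ ^ 2) ∂gaussWeight ≤
      liminf (fun n => ∫⁻ x, ENNReal.ofReal (‖w n x‖ ^ 2) ∂gaussWeight) atTop := by
    refine le_trans (lintegral_mono_ae ?_) (lintegral_liminf_le' fun n =>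
      (hw n).aestronglyMeasurable.aemeasurable.ennreal_ofReal)
    filter_upwards [hlim] with x hx
    exact (ENNReal.tendsto_ofReal (hx.norm.pow 2)).liminf_eq.ge
  refine h1.trans ?_
  rw [← (ENNReal.tendsto_ofReal hD).liminf_eq]
  refine liminf_le_liminf (Eventually.of_forall fun n => ?_)
  rw [← ofReal_integral_eq_lintegral_ofReal (hw n) (Eventually.of_forall fun x => sq_nonneg _)]
  exact ENNReal.ofReal_le_ofReal (hd n)

variable {ρ χ : E6 → ℝ} {f : E6 → V}

theorem norm_mollify_coord_le (hρ : Continuous ρ) (cρ : HasCompactSupport ρ)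
    (h0 : ∀ x, 0 ≤ ρ x) {ε : ℝ} (hs : ∀ x, ε < ‖x‖ → ρ x = 0)
    (hf : LocallyIntegrable f volume) (j : Fin 6) (x : E6) :
    ‖mollify (fun z => 2 * z j * ρ z) f x‖ ≤ 2 * ε * ∫ y, ρ (x - y) * ‖f y‖ := by
  have i1 : Integrable fun y => ρ (x - y) * ‖f y‖ :=
    (convolutionExistsAt_iff_integrable_swap
        (L := ContinuousLinearMap.lsmul ℝ ℝ)).1 (cρ.convolutionExists_left _ hρ (locallyIntegrable_norm hf) x)
  rw [← integral_const_mul]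
  refine norm_integral_le_of_norm_le (i1.const_mul _) (Eventually.of_forall fun y => ?_)
  rw [norm_smul, ← mul_assoc]
  refine mul_le_mul_of_nonneg_right ?_ (norm_nonneg _)
  by_cases hy : ε < ‖x - y‖
  · simp [hs _ hy]
  · rw [norm_mul, norm_mul, Real.norm_of_nonneg (h0 _)]
    have h1 : ‖(x - y) j‖ ≤ ε := (PiLp.norm_apply_le _ _).trans (not_lt.1 hy)
    have h2 := h0 (x - y)
    rw [Real.norm_of_nonneg (show (0 : ℝ) ≤ 2 by norm_num)]
    nlinarith

theorem integral_mollify_add {E F : Type*} [NormedAddCommGroup E] [NormedAddCommGroup F]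
    {f : E6 → E} {u : E6 → F} (hρ : Continuous ρ) (cρ : HasCompactSupport ρ)
    (hf : LocallyIntegrable f volume) (hu : LocallyIntegrable u volume) (t : ℝ) (x : E6) :
    ∫ y, ρ (x - y) * (‖u y‖ + t * ‖f y‖) =
      (∫ y, ρ (x - y) * ‖u y‖) + t * ∫ y, ρ (x - y) * ‖f y‖ := by
  have key : ∀ {G : E6 → ℝ}, LocallyIntegrable G volume → Integrable fun y => ρ (x - y) * G y :=
    fun {G} hG => (convolutionExistsAt_iff_integrable_swap
      (L := ContinuousLinearMap.lsmul ℝ ℝ)).1 (cρ.convolutionExists_left _ hρ hG x)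
  rw [← integral_const_mul]
  refine Eq.trans ?_ (integral_add (key (locallyIntegrable_norm hu))
    ((key (locallyIntegrable_norm hf)).const_mul t))
  congr 1
  ext y
  ring

variable [CompleteSpace U] [CompleteSpace V] [CompleteSpace W]

-- The function `χ • mollify ρ f` is a test function, and the two operators send it to `χ • mollify
-- ρ u` and `χ • mollify ρ v` up to errors bounded by a mollified `‖f‖`. The error `δ` comes from
-- the gradient of `χ`, and `2 ε` from the coefficients `2 x_j`, which do not commute with
-- convolution. The exponential is the distortion of the weight.
open ContinuousLinearMap in
theorem estimate_cutoff_mollify (P : Fin 6 → V →L[ℂ] W) (Q : Fin 6 → V →L[ℂ] U) {A c : ℝ}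
    (hA : 0 ≤ A)
    (ap : ∀ w : E6 → V, TestFun w → c * ∫ x, ‖w x‖ ^ 2 ∂gaussWeight ≤
      A * ∫ x, ‖∑ i, P i (dv i w x)‖ ^ 2 ∂gaussWeight +
        ∫ x, ‖∑ i, Q i (rv i w x)‖ ^ 2 ∂gaussWeight)
    {u : E6 → W} {v : E6 → U} (hf : MemLp f 2 gaussWeight) (hu : MemLp u 2 gaussWeight)
    (hv : MemLp v 2 gaussWeight)
    (hwu : ∀ g : E6 → W, TestFun g → ∫ x, inner ℂ (g x) (u x) ∂gaussWeight =
      ∫ x, inner ℂ (∑ j, adjoint (P j) (rv j g x)) (f x) ∂gaussWeight)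
    (hwv : ∀ h : E6 → U, TestFun h → ∫ x, inner ℂ (h x) (v x) ∂gaussWeight =
      ∫ x, inner ℂ (∑ j, adjoint (Q j) (dv j h x)) (f x) ∂gaussWeight)
    (hρ : ContDiff ℝ ∞ ρ) (cρ : HasCompactSupport ρ) (h0 : ∀ x, 0 ≤ ρ x) (h1 : ∫ x, ρ x = 1)
    {ε R δ : ℝ} (hε : 0 ≤ ε) (hs : ∀ x, ε < ‖x‖ → ρ x = 0)
    (hχ : ContDiff ℝ ∞ χ) (cχ : HasCompactSupport χ) (χ0 : ∀ x, 0 ≤ χ x) (χ1 : ∀ x, χ x ≤ 1)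
    (χR : ∀ x, R < ‖x‖ → x ∉ tsupport χ)
    (χδ : ∀ x, ‖fderiv ℝ χ x‖ ≤ δ) :
    c * ∫ x, ‖χ x • mollify ρ f x‖ ^ 2 ∂gaussWeight ≤
      Real.exp (ε * (2 * R + ε)) *
        (A * ∫ x, (‖u x‖ + δ * (∑ j, ‖P j‖) * ‖f x‖) ^ 2 ∂gaussWeight +
          ∫ x, (‖v x‖ + (2 * ε + δ) * (∑ j, ‖Q j‖) * ‖f x‖) ^ 2 ∂gaussWeight) := by
  have lf := locallyIntegrable_volume (hf.locallyIntegrable (by norm_num))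
  have lu := locallyIntegrable_volume (hu.locallyIntegrable (by norm_num))
  have lv := locallyIntegrable_volume (hv.locallyIntegrable (by norm_num))
  have sm := contDiff_mollify hρ cρ lf
  have dm : Differentiable ℝ (mollify ρ f) := sm.differentiable (by simp)
  have dχ : Differentiable ℝ χ := hχ.differentiable (by simp)
  set w : E6 → V := fun x => χ x • mollify ρ f x with hw
  have tw : TestFun w := ⟨hχ.smul sm, cχ.smul_right⟩
  have wsupp : ∀ x, R < ‖x‖ → x ∉ tsupport w := fun x hx h =>
    χR x hx (closure_mono (Function.support_smul_subset_left _ _) h)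
  have dw : ∀ j x, dv j w x =
      χ x • dv j (mollify ρ f) x + (fderiv ℝ χ x (EuclideanSpace.single j 1)) • mollify ρ f x :=
    fun j x => dv_smul dm dχ j x
  have rw' : ∀ j x, rv j w x =
      χ x • rv j (mollify ρ f) x - (fderiv ℝ χ x (EuclideanSpace.single j 1)) • mollify ρ f x :=
    fun j x => by
      rw [rv, dw, rv, hw]
      module
  have dj : ∀ j x, ‖fderiv ℝ χ x (EuclideanSpace.single j 1)‖ ≤ δ := fun j x => by
    have := (fderiv ℝ χ x).le_opNorm (EuclideanSpace.single j 1)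
    rw [PiLp.norm_single, norm_one, mul_one] at this
    exact this.trans (χδ x)
  have δ0 : 0 ≤ δ := (norm_nonneg _).trans (χδ 0)
  have bm : ∀ j x, ‖(fderiv ℝ χ x (EuclideanSpace.single j 1)) • mollify ρ f x‖ ≤
      δ * ∫ y, ρ (x - y) * ‖f y‖ := fun j x => by
    rw [norm_smul]
    exact mul_le_mul (dj j x) (norm_mollify_le h0 x) (norm_nonneg _) δ0
  refine (ap w tw).trans ?_
  rw [mul_add, mul_left_comm]
  have tP : TestFun fun x => ∑ i, P i (dv i w x) := TestFun.sum fun i _ => (tw.dv i).clm (P i)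
  have tQ : TestFun fun x => ∑ i, Q i (rv i w x) := TestFun.sum fun i _ => (tw.rv i).clm (Q i)
  refine add_le_add (mul_le_mul_of_nonneg_left ?_ hA) ?_
  · refine integral_normSq_le_of_mollify hρ.continuous cρ h0 h1 hε hs
      (memLp_norm_add hf hu _) tP.integrable_normSq (fun x hx => ?_) fun x => ?_
    · simp [dv_of_notMem (wsupp x hx)]
    · rw [integral_mollify_add hρ.continuous cρ lf lu]
      have e : ∑ i, P i (dv i w x) = χ x • mollify ρ u x +
          ∑ i, P i ((fderiv ℝ χ x (EuclideanSpace.single i 1)) • mollify ρ f x) := by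
        rw [← sum_dv_mollify P lf lu hwu hρ cρ x, Finset.smul_sum, ← Finset.sum_add_distrib]
        refine Finset.sum_congr rfl fun i _ => ?_
        rw [dw, map_add, clm_real_smul]
      rw [e]
      have b0 := (norm_smul_le_of_le_one (χ0 x) (χ1 x) (mollify ρ u x)).trans
        (norm_mollify_le h0 x)
      refine (norm_add_le _ _).trans (add_le_add b0 ?_)
      refine (norm_sum_clm_le P fun j => bm j x).trans (le_of_eq ?_)
      ring
  · refine integral_normSq_le_of_mollify hρ.continuous cρ h0 h1 hε hs
      (memLp_norm_add hf hv _) tQ.integrable_normSq (fun x hx => ?_) fun x => ?_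
    · have hx' := wsupp x hx
      simp [rv, dv_of_notMem hx', image_eq_zero_of_notMem_tsupport hx']
    · rw [integral_mollify_add hρ.continuous cρ lf lv]
      have e : ∑ i, Q i (rv i w x) = χ x • mollify ρ v x +
          (χ x • ∑ i, Q i (mollify (fun z => 2 * z i * ρ z) f x) -
          ∑ i, Q i ((fderiv ℝ χ x (EuclideanSpace.single i 1)) • mollify ρ f x)) := by
        rw [← add_sub_assoc, ← smul_add, ← sum_rv_mollify Q lf lv hwv hρ cρ x, Finset.smul_sum,
          ← Finset.sum_sub_distrib]
        refine Finset.sum_congr rfl fun i _ => ?_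
        rw [rw', map_sub, clm_real_smul]
      rw [e]
      have b0 := (norm_smul_le_of_le_one (χ0 x) (χ1 x) (mollify ρ v x)).trans
        (norm_mollify_le h0 x)
      refine (norm_add_le _ _).trans (add_le_add b0 ?_)
      refine (norm_sub_le _ _).trans ?_
      have b1 := (norm_smul_le_of_le_one (χ0 x) (χ1 x) (∑ i, Q i (mollify (fun z => 2 * z i * ρ z) f x))).trans
        (norm_sum_clm_le Q fun j => norm_mollify_coord_le hρ.continuous cρ h0 hs lf j x)
      have b2 := norm_sum_clm_le Q fun j => bm j x
      refine (add_le_add b1 b2).trans (le_of_eq ?_)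
      ring

open ContinuousLinearMap in
/-- An a priori estimate for test functions extends to weak solutions. -/
theorem estimate_of_weak (P : Fin 6 → V →L[ℂ] W) (Q : Fin 6 → V →L[ℂ] U) {A c : ℝ}
    (hA : 0 ≤ A) (hc : 0 < c)
    (ap : ∀ w : E6 → V, TestFun w → c * ∫ x, ‖w x‖ ^ 2 ∂gaussWeight ≤
      A * ∫ x, ‖∑ i, P i (dv i w x)‖ ^ 2 ∂gaussWeight +
        ∫ x, ‖∑ i, Q i (rv i w x)‖ ^ 2 ∂gaussWeight)
    {u : E6 → W} {v : E6 → U} (hf : MemLp f 2 gaussWeight) (hu : MemLp u 2 gaussWeight)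
    (hv : MemLp v 2 gaussWeight)
    (hwu : ∀ g : E6 → W, TestFun g → ∫ x, inner ℂ (g x) (u x) ∂gaussWeight =
      ∫ x, inner ℂ (∑ j, adjoint (P j) (rv j g x)) (f x) ∂gaussWeight)
    (hwv : ∀ h : E6 → U, TestFun h → ∫ x, inner ℂ (h x) (v x) ∂gaussWeight =
      ∫ x, inner ℂ (∑ j, adjoint (Q j) (dv j h x)) (f x) ∂gaussWeight) :
    c * ∫ x, ‖f x‖ ^ 2 ∂gaussWeight ≤
      A * ∫ x, ‖u x‖ ^ 2 ∂gaussWeight + ∫ x, ‖v x‖ ^ 2 ∂gaussWeight := by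
  have lf := locallyIntegrable_volume (hf.locallyIntegrable (by norm_num))
  let r : ℕ → ℝ := fun n => 1 / ((n : ℝ) + 1)
  have r0 : ∀ n, 0 < r n := fun n => by positivity
  have rlim : Tendsto r atTop (𝓝 0) := tendsto_one_div_add_atTop_nhds_zero_nat
  -- The mollifying radius is `r²` against a cutoff radius `2 / r`, so that their product tends to
  -- `0` and the distortion `exp (ε (2 R + ε))` tends to `1`.
  let B : ℕ → ContDiffBump (0 : E6) := fun n =>
    ⟨r n ^ 2 / 2, r n ^ 2, by have := r0 n; positivity, by
      have := pow_pos (r0 n) 2; linarith⟩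
  let X : ContDiffBump (0 : E6) := ⟨1, 2, one_pos, one_lt_two⟩
  obtain ⟨K, hK⟩ : ∃ K, ∀ x, ‖fderiv ℝ X x‖ ≤ K :=
    ((X.contDiff (n := ⊤)).continuous_fderiv (by simp)).bounded_above_of_compact_support
      (X.hasCompactSupport.fderiv ℝ)
  let χ : ℕ → E6 → ℝ := fun n x => X (r n • x)
  have hχ : ∀ n, ContDiff ℝ ∞ (χ n) := fun n =>
    (X.contDiff (n := ⊤)).comp (contDiff_id.const_smul (r n))
  have χsupp : ∀ n, tsupport (χ n) ⊆ Metric.closedBall 0 (2 / r n) := fun n => by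
    refine closure_minimal (fun x hx => ?_) Metric.isClosed_closedBall
    rw [Function.mem_support] at hx
    by_contra h
    refine hx (X.zero_of_le_dist ?_)
    rw [Metric.mem_closedBall, dist_zero_right, not_le, div_lt_iff₀ (r0 n)] at h
    rw [dist_zero_right, norm_smul, Real.norm_of_nonneg (r0 n).le]
    change (2 : ℝ) ≤ _
    linarith
  have dχ : ∀ n x, ‖fderiv ℝ (χ n) x‖ ≤ K * r n := fun n x => by
    have h1 : HasFDerivAt (fun x : E6 => r n • x) (r n • ContinuousLinearMap.id ℝ E6) x :=
      (hasFDerivAt_id x).const_smul (r n)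
    have h2 : HasFDerivAt (χ n) _ x :=
      (((X.contDiff (n := ⊤)).differentiable (by simp)) (r n • x)).hasFDerivAt.comp x h1
    rw [h2.fderiv, ContinuousLinearMap.comp_smul, ContinuousLinearMap.comp_id, norm_smul,
      Real.norm_of_nonneg (r0 n).le, mul_comm]
    exact mul_le_mul_of_nonneg_right (hK _) (r0 n).le
  let d : ℕ → ℝ := fun n => Real.exp (r n ^ 2 * (2 * (2 / r n) + r n ^ 2)) *
    (A * ∫ x, (‖u x‖ + K * r n * (∑ j, ‖P j‖) * ‖f x‖) ^ 2 ∂gaussWeight +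
      ∫ x, (‖v x‖ + (2 * r n ^ 2 + K * r n) * (∑ j, ‖Q j‖) * ‖f x‖) ^ 2 ∂gaussWeight) / c
  let w : ℕ → E6 → V := fun n x => χ n x • mollify ((B n).normed volume) f x
  have cχ : ∀ n, HasCompactSupport (χ n) := fun n =>
    (isCompact_closedBall _ _).of_isClosed_subset (isClosed_tsupport _) (χsupp n)
  have hw : ∀ n, TestFun (w n) := fun n =>
    ⟨(hχ n).smul (contDiff_mollify (B n).contDiff_normed (B n).hasCompactSupport_normed lf),
      (cχ n).smul_right⟩
  have hd : ∀ n, ∫ x, ‖w n x‖ ^ 2 ∂gaussWeight ≤ d n := fun n => by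
    rw [le_div_iff₀' hc]
    refine estimate_cutoff_mollify P Q hA ap hf hu hv hwu hwv (B n).contDiff_normed
      (B n).hasCompactSupport_normed (B n).nonneg_normed (B n).integral_normed (sq_nonneg _)
      (fun x hx => ?_) (hχ n) (cχ n) (fun x => X.nonneg) (fun x => X.le_one) (fun x hx h => ?_)
      (dχ n)
    · rw [← Function.notMem_support, (B n).support_normed_eq, Metric.mem_ball, dist_zero_right,
        not_lt]
      exact hx.le
    · have := χsupp n h
      rw [Metric.mem_closedBall, dist_zero_right] at this
      linarith
  have hexp : Tendsto (fun n => Real.exp (r n ^ 2 * (2 * (2 / r n) + r n ^ 2))) atTop (𝓝 1) := by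
    have e : ∀ n, r n ^ 2 * (2 * (2 / r n) + r n ^ 2) = 4 * r n + r n ^ 4 := fun n => by
      have := (r0 n).ne'
      field_simp
      ring
    simp only [e]
    have h := (rlim.const_mul 4).add (rlim.pow 4)
    have h' := (Real.continuous_exp.tendsto _).comp h
    simp only [mul_zero, ne_eq, OfNat.ofNat_ne_zero, not_false_eq_true, zero_pow, add_zero,
      Real.exp_zero] at h'
    exact h'
  have t1 : Tendsto (fun n => K * r n * ∑ j, ‖P j‖) atTop (𝓝 0) := by
    simpa using (rlim.const_mul K).mul_const (∑ j, ‖P j‖)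
  have t2 : Tendsto (fun n => (2 * r n ^ 2 + K * r n) * ∑ j, ‖Q j‖) atTop (𝓝 0) := by
    simpa using (((rlim.pow 2).const_mul 2).add (rlim.const_mul K)).mul_const (∑ j, ‖Q j‖)
  have hD := ((hexp.mul (((tendsto_integral_sq_add hf hu t1).const_mul A).add
    (tendsto_integral_sq_add hf hv t2))).div_const c)
  rw [one_mul] at hD
  -- Mollifications converge at almost every point by Lebesgue differentiation, and each point
  -- eventually lies where the cutoff is `1`.
  have hlim : ∀ᵐ x ∂gaussWeight, Tendsto (fun n => w n x) atTop (𝓝 (f x)) := by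
    have h := ContDiffBump.ae_convolution_tendsto_right_of_locallyIntegrable (φ := B) (l := atTop)
      (K := 2) (by simpa using rlim.pow 2)
      (Eventually.of_forall fun n => by
        change r n ^ 2 ≤ 2 * (r n ^ 2 / 2)
        linarith) lf
    filter_upwards [gaussWeight_absolutelyContinuous.ae_le h] with x hx
    have hx1 : ∀ᶠ n in atTop, χ n x = 1 := by
      have h3 : Tendsto (fun n => r n * ‖x‖) atTop (𝓝 0) := by simpa using rlim.mul_const ‖x‖
      filter_upwards [h3.eventually_le_const one_pos] with n hn
      refine X.one_of_mem_closedBall ?_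
      rw [Metric.mem_closedBall, dist_zero_right, norm_smul, Real.norm_of_nonneg (r0 n).le]
      exact hn
    refine hx.congr' ?_
    filter_upwards [hx1] with n hn
    simp only [w, hn, one_smul, mollify_eq]
  have := integral_normSq_le_of_tendsto hf (fun n => (hw n).integrable_normSq) hd hD hlim
  rwa [le_div_iff₀' hc] at this

end WeakEstimate

/-! ### The operators of the theorem written with constant-coefficient symbols. -/

section Reduction

/-- The coefficient of `2 x_j - ∂_j` in the formal adjoint of `𝒟` on all tensors. -/
def starMap (p q : ℕ) (j : Fin 6) : Tens p (q + 1) →ₗ[ℂ] Tens (p + 1) q where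
  toFun η := WithLp.toLp 2 fun i => symB (fun A B =>
    -∑ e : Fin 4, conj (sym j e (B 0)) * η (Fin.cons (α := fun _ => Fin 4) e A, Fin.tail B)) i.1 i.2
  map_add' ξ η := by
    ext i
    simp only [symB, PiLp.add_apply, mul_add, Finset.sum_add_distrib, neg_add]
  map_smul' c ξ := by
    ext i
    simp only [symB, PiLp.smul_apply, smul_eq_mul, RingHom.id_apply, Finset.mul_sum, mul_neg,
      mul_left_comm c]

/-- The coefficient of `2 x_j - ∂_j` in `Θ`. -/
def thetaMap (p q : ℕ) (j : Fin 6) : Fib p (q + 1) →L[ℂ] Fib (p + 1) q :=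
  (proj (p + 1) q).comp (LinearMap.toContinuousLinearMap
    ((starMap p q j).comp (incl p (q + 1)).toLinearMap))

theorem thetaMap_apply (p q : ℕ) (j : Fin 6) (η : Fib p (q + 1)) :
    thetaMap p q j η = proj (p + 1) q (starMap p q j (incl p (q + 1) η)) := rfl

theorem partialD_eq_dv (j : Fin 6) (f : E6 → ℂ) (x : E6) : partialD j f x = dv j f x := rfl

theorem thetaAB_eq {f : E6 → ℂ} (hf : Differentiable ℝ f) (A B : Fin 4) (x : E6) :
    thetaAB A B f x = ∑ j, conj (sym j A B) * rv j f x := by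
  have he : ((Real.exp (phi x) : ℝ) : ℂ) * ((Real.exp (-phi x) : ℝ) : ℂ) = 1 := by
    rw [← Complex.ofReal_mul, ← Real.exp_add]; simp
  have h : ∀ j, partialD j (fun y => ((Real.exp (-phi y) : ℝ) : ℂ) * f y) x =
      -(((Real.exp (-phi x) : ℝ) : ℂ) * rv j f x) := fun j => by
    have := dv_expNegPhi_smul hf j x
    rw [partialD_eq_dv]
    simpa only [Complex.real_smul] using this
  rw [thetaAB, nablaDown_eq, Finset.mul_sum]
  refine Finset.sum_congr rfl fun j _ => ?_
  rw [h]
  linear_combination conj (sym j A B) * rv j f x * he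

/-- Conjugation by `e^φ` turns the `-∂_j` inside `thetaAB` into `rv j`, which commutes with constant
linear maps. -/
theorem theta_eq_sum {p q : ℕ} {g : E6 → Fib p (q + 1)} (hg : TestFun g) (x : E6) :
    Theta g x = ∑ j, thetaMap p q j (rv j g x) := by
  simp only [thetaMap_apply, ← map_sum]
  rw [Theta]
  congr 1
  ext i
  have h : ∀ (e b : Fin 4) (k : (Fin (q + 1) → Fin 4) × (Fin p → Fin 4)),
      thetaAB e b (fun y => incl p (q + 1) (g y) k) x =
        ∑ j, conj (sym j e b) * incl p (q + 1) (rv j g x) k := fun e b k => by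
    let L : Fib p (q + 1) →L[ℂ] ℂ := (EuclideanSpace.proj k : Tens p (q + 1) →L[ℂ] ℂ).comp
      (incl p (q + 1)).toContinuousLinearMap
    have hL : Differentiable ℝ fun y => L (g y) :=
      (L.restrictScalars ℝ).differentiable.comp hg.differentiable
    refine (thetaAB_eq hL e b x).trans (Finset.sum_congr rfl fun j _ => ?_)
    rw [rv_clm hg.differentiable]
    rfl
  simp only [calDStar, starMap, symB, h, LinearMap.coe_mk, AddHom.coe_mk, WithLp.ofLp_sum, Finset.sum_apply]
  rw [← Finset.mul_sum, Finset.sum_comm]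
  congr 1
  refine Finset.sum_congr rfl fun σ _ => ?_
  rw [Finset.sum_neg_distrib, Finset.sum_comm]

open ContinuousLinearMap in
/-- `∑ Q_j^* ∂_j h` is `𝒟h` for a test function `h`. -/
theorem isWeakD_test {p q : ℕ} {h : E6 → Fib (p + 1) q} (hh : IsTest h) :
    ∃ hu : MemLp (fun x => ∑ j, adjoint (thetaMap p q j) (dv j h x)) 2 gaussWeight,
      IsWeakD (hh.memLp.toLp h) (hu.toLp _) := by
  have hh' : TestFun h := hh
  have tu : TestFun fun x => ∑ j, adjoint (thetaMap p q j) (dv j h x) :=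
    TestFun.sum fun i _ => (hh'.dv i).clm _
  have hu : IsTest fun x => ∑ j, adjoint (thetaMap p q j) (dv j h x) := tu
  refine ⟨hu.memLp, fun g hg => ?_⟩
  have hg' : TestFun g := hg
  have a1 : ∀ᵐ x ∂gaussWeight, inner ℂ (g x) (hu.memLp.toLp _ x) =
      ∑ j, inner ℂ (thetaMap p q j (g x)) (dv j h x) := by
    filter_upwards [hu.memLp.coeFn_toLp] with x hx
    rw [hx, inner_sum]
    simp only [adjoint_inner_right]
  have a2 : ∀ᵐ x ∂gaussWeight, inner ℂ (Theta g x) (hh.memLp.toLp h x) =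
      ∑ j, inner ℂ (rv j (fun y => thetaMap p q j (g y)) x) (h x) := by
    filter_upwards [hh.memLp.coeFn_toLp] with x hx
    rw [hx, theta_eq_sum hg', sum_inner]
    simp only [rv_clm hg'.differentiable]
  rw [integral_congr_ae a1, integral_congr_ae a2, integral_finsetSum, integral_finsetSum]
  · refine Finset.sum_congr rfl fun j _ => ?_
    rw [integral_inner_rv (hg'.clm _) hh']
  · exact fun j _ => ((hg'.clm _).rv j).integrable_inner hh'.continuous
  · exact fun j _ => (hg'.clm _).integrable_inner (hh'.dv j).continuous

theorem normSq_eq_integral {p q : ℕ} (f : L2phi p q) : ‖f‖ ^ 2 = ∫ x, ‖f x‖ ^ 2 ∂gaussWeight := by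
  have h := L2.inner_def (𝕜 := ℂ) f f
  rw [inner_self_eq_norm_sq_to_K] at h
  have h2 : ∀ x, inner ℂ (f x) (f x) = ((‖f x‖ ^ 2 : ℝ) : ℂ) := fun x => by
    rw [inner_self_eq_norm_sq_to_K]; simp
  simp only [h2] at h
  rw [integral_complex_ofReal] at h
  exact Complex.ofReal_injective (by simpa using h)

open ContinuousLinearMap in
/-- The closed operators satisfy an estimate that holds for test functions. -/
theorem estimate_of_apriori {p q : ℕ} {A c : ℝ} (hA : 0 ≤ A) (hc : 0 < c)
    (ap : ∀ w : E6 → Fib (p + 1) (q + 1), TestFun w → c * ∫ x, ‖w x‖ ^ 2 ∂gaussWeight ≤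
      A * ∫ x, ‖∑ i, adjoint (thetaMap p (q + 1) i) (dv i w x)‖ ^ 2 ∂gaussWeight +
        ∫ x, ‖∑ i, thetaMap (p + 1) q i (rv i w x)‖ ^ 2 ∂gaussWeight)
    (f : L2phi (p + 1) (q + 1)) (h₁ : f ∈ (scrD p (q + 1)).domain)
    (h₂ : f ∈ (scrD (p + 1) q).adjoint.domain) :
    c * ‖f‖ ^ 2 ≤ A * ‖scrD p (q + 1) ⟨f, h₁⟩‖ ^ 2 + ‖(scrD (p + 1) q).adjoint ⟨f, h₂⟩‖ ^ 2 := by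
  set u := scrD p (q + 1) ⟨f, h₁⟩ with hu
  set v := (scrD (p + 1) q).adjoint ⟨f, h₂⟩ with hv
  have wu : IsWeakD f u := (mem_scrD_graph f u).1 ((scrD p (q + 1)).mem_graph ⟨f, h₁⟩)
  rw [normSq_eq_integral, normSq_eq_integral, normSq_eq_integral]
  refine estimate_of_weak (fun i => adjoint (thetaMap p (q + 1) i)) (fun i => thetaMap (p + 1) q i)
    hA hc ap (Lp.memLp f) (Lp.memLp u) (Lp.memLp v) (fun g hg => ?_) fun h hh => ?_
  · rw [wu g hg]
    simp only [adjoint_adjoint, theta_eq_sum hg]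
  · have hh' : IsTest h := hh
    obtain ⟨hw, hwD⟩ := isWeakD_test hh'
    have hg := (mem_scrD_graph _ _).2 hwD
    obtain ⟨y, hy1, hy2⟩ := (LinearPMap.mem_graph_iff _).1 hg
    -- The adjoint enters only through its pairing with test functions, which lie in the domain of
    -- `𝒟`; no density of test functions in the graph norm is needed.
    have hadj := (LinearPMap.adjoint_isFormalAdjoint (scrD_dense (p + 1) q)) ⟨f, h₂⟩ y
    simp only at hy1 hy2
    rw [hy1, hy2] at hadj
    have hadj' := congrArg conj hadj
    rw [inner_conj_symm, inner_conj_symm, L2.inner_def, L2.inner_def] at hadj'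
    have e1 : ∫ x, inner ℂ (h x) (v x) ∂gaussWeight =
        ∫ x, inner ℂ (hh'.memLp.toLp h x) (v x) ∂gaussWeight :=
      integral_congr_ae (by filter_upwards [hh'.memLp.coeFn_toLp] with x hx; rw [hx])
    rw [e1]
    refine hadj'.trans (integral_congr_ae ?_)
    filter_upwards [hw.coeFn_toLp] with x hx
    rw [hx]

end Reduction

/-! ### Symmetrizations, exchanges of indices and traces. -/

section Symmetrization

/-- A multi-index with a first entry prepended. -/
abbrev icons {n : ℕ} (a : Fin 4) (A : Fin n → Fin 4) : Fin (n + 1) → Fin 4 :=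
  Fin.cons (α := fun _ => Fin 4) a A

theorem icons_comp_decomposeFin {n : ℕ} (b : Fin 4) (B : Fin n → Fin 4) (i : Fin (n + 1))
    (e : Equiv.Perm (Fin n)) :
    icons b B ∘ Equiv.Perm.decomposeFin.symm (i, e) =
      icons (icons b B i) ((fun x => icons b B (Equiv.swap 0 i x.succ)) ∘ e) := by
  ext x
  refine Fin.cases ?_ (fun x => ?_) x
  · simp
  · simp

theorem icons_swap_succ {n : ℕ} (b : Fin 4) (B : Fin n → Fin 4) (k : Fin n) :
    (fun x : Fin n => icons b B (Equiv.swap 0 k.succ x.succ)) = Function.update B k b := by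
  ext x
  by_cases h : x = k
  · subst h
    simp
  · rw [Equiv.swap_apply_of_ne_of_ne (Fin.succ_ne_zero _) (by simpa using h)]
    simp [h]

/-- Covers symmetrization (`ε = 1`) and antisymmetrization (`ε = -1`) at once. A permutation is a
choice of the entry moved to the front and a permutation of the rest; since `T` already has the
symmetry in the rest, each choice contributes `n!` equal terms. -/
theorem sum_perm_icons {n : ℕ} (s : Equiv.Perm (Fin (n + 1)) → ℂ) (t : Equiv.Perm (Fin n) → ℂ)
    (ε : ℂ) (h0 : ∀ e, s (Equiv.Perm.decomposeFin.symm (0, e)) = t e)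
    (h1 : ∀ (k : Fin n) e, s (Equiv.Perm.decomposeFin.symm (k.succ, e)) = ε * t e)
    (T : (Fin (n + 1) → Fin 4) → ℂ)
    (hT : ∀ b B e, t e * T (icons b (B ∘ e)) = T (icons b B)) (b : Fin 4) (B : Fin n → Fin 4) :
    ∑ σ, s σ * T (icons b B ∘ σ) =
      n.factorial * (T (icons b B) + ε * ∑ k, T (icons (B k) (Function.update B k b))) := by
  rw [← Equiv.sum_comp Equiv.Perm.decomposeFin.symm, Fintype.sum_prod_type, Fin.sum_univ_succ]
  simp only [icons_comp_decomposeFin, h0, h1, icons_swap_succ, mul_assoc, hT]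
  simp only [Equiv.swap_self, Equiv.refl_apply, Fin.cons_zero, Fin.cons_succ,
    Finset.sum_const, Finset.card_univ, Fintype.card_perm, Fintype.card_fin, nsmul_eq_mul]
  rw [← Finset.mul_sum, ← Finset.mul_sum]
  ring

theorem symB_icons {n q : ℕ} (T : (Fin q → Fin 4) → (Fin (n + 1) → Fin 4) → ℂ)
    (A : Fin q → Fin 4)
    (hT : ∀ b B (e : Equiv.Perm (Fin n)), T A (icons b (B ∘ e)) = T A (icons b B))
    (b : Fin 4) (B : Fin n → Fin 4) :
    symB T A (icons b B) = ((n : ℂ) + 1)⁻¹ *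
      (T A (icons b B) + ∑ k, T A (icons (B k) (Function.update B k b))) := by
  have h := sum_perm_icons (n := n) (fun _ => 1) (fun _ => 1) 1 (by simp) (by simp) (T A)
    (by simpa using hT) b B
  simp only [one_mul] at h
  rw [symB, h, Nat.factorial_succ]
  have : (n.factorial : ℂ) ≠ 0 := by exact_mod_cast n.factorial_ne_zero
  have : (n : ℂ) + 1 ≠ 0 := by exact_mod_cast n.succ_ne_zero
  push_cast
  field_simp

theorem altA_icons {n p : ℕ} (T : (Fin (n + 1) → Fin 4) → (Fin p → Fin 4) → ℂ)
    (B : Fin p → Fin 4)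
    (hT : ∀ a A (e : Equiv.Perm (Fin n)),
      T (icons a (A ∘ e)) B = ((Equiv.Perm.sign e : ℤ) : ℂ) * T (icons a A) B)
    (a : Fin 4) (A : Fin n → Fin 4) :
    altA T (icons a A) B = ((n : ℂ) + 1)⁻¹ *
      (T (icons a A) B - ∑ k, T (icons (A k) (Function.update A k a)) B) := by
  have hs : ∀ e : Equiv.Perm (Fin n),
      ((Equiv.Perm.sign e : ℤ) : ℂ) * ((Equiv.Perm.sign e : ℤ) : ℂ) = 1 := fun e => by
    rw [← Int.cast_mul, Int.units_coe_mul_self, Int.cast_one]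
  have h := sum_perm_icons (n := n) (fun σ => ((Equiv.Perm.sign σ : ℤ) : ℂ))
    (fun e => ((Equiv.Perm.sign e : ℤ) : ℂ)) (-1) (by simp)
    (fun k e => by simp [Fin.succ_ne_zero]) (fun A => T A B)
    (fun a A e => by rw [hT, ← mul_assoc, hs, one_mul]) a A
  rw [altA, h, Nat.factorial_succ]
  have : (n.factorial : ℂ) ≠ 0 := by exact_mod_cast n.factorial_ne_zero
  have : (n : ℂ) + 1 ≠ 0 := by exact_mod_cast n.succ_ne_zero
  push_cast
  field_simp
  ring

theorem update_eq_icons_comp_swap {n : ℕ} (B : Fin (n + 1) → Fin 4) (k : Fin (n + 1)) (c : Fin 4) :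
    Function.update B k c = icons c (Fin.tail (B ∘ Equiv.swap 0 k)) ∘ Equiv.swap 0 k := by
  ext x
  by_cases h : x = k
  · subst h
    simp
  · rw [Function.update_of_ne h, Function.comp_apply]
    by_cases h0 : x = 0
    · subst h0
      rw [Equiv.swap_apply_left]
      obtain ⟨y, rfl⟩ := Fin.exists_succ_eq.2 (Ne.symm h)
      simp [Fin.tail]
    · rw [Equiv.swap_apply_of_ne_of_ne h0 h]
      obtain ⟨y, rfl⟩ := Fin.exists_succ_eq.2 h0
      simp [Fin.tail, Equiv.swap_apply_of_ne_of_ne h0 h]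

theorem sum_comp_perm {n : ℕ} (F : (Fin n → Fin 4) → ℂ) (σ : Equiv.Perm (Fin n)) :
    ∑ B, F (B ∘ σ) = ∑ B, F B := by
  rw [← Equiv.sum_comp (σ.symm.arrowCongr (Equiv.refl (Fin 4))) F]
  refine Finset.sum_congr rfl fun B _ => ?_
  congr 1

/-- Exchanging an index with any other index is the same as exchanging it with the first. -/
theorem sum_update_swap {n : ℕ} (F G : Fin 4 → (Fin (n + 1) → Fin 4) → ℂ)
    (h : ∀ b d B B' (σ : Equiv.Perm (Fin (n + 1))), F b (B ∘ σ) * G d (B' ∘ σ) = F b B * G d B')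
    (k : Fin (n + 1)) :
    ∑ b, ∑ B, F b B * G (B k) (Function.update B k b) =
      ∑ b, ∑ d, ∑ B : Fin n → Fin 4, F b (icons d B) * G d (icons b B) := by
  refine Finset.sum_congr rfl fun b _ => ?_
  rw [← sum_comp_perm _ (Equiv.swap 0 k), sum_cons]
  refine Finset.sum_congr rfl fun d _ => Finset.sum_congr rfl fun B _ => ?_
  have e : (icons d B ∘ Equiv.swap 0 k) ∘ Equiv.swap 0 k = icons d B := by
    ext x; simp
  rw [update_eq_icons_comp_swap, e, h]
  simp

/-- The contraction uses the last lower slot; by symmetry a cyclic rotation brings that slot to the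
front. -/
theorem symAlt_trace_snoc {p q : ℕ} {ξ : Tens (p + 1) (q + 1)} (hξ : ξ ∈ symAlt (p + 1) (q + 1))
    (A : Fin q → Fin 4) (B : Fin p → Fin 4) :
    contraction p q ξ (A, B) = ∑ c, ξ (icons c A, icons c B) := by
  change ∑ c : Fin 4, ξ (icons c A, Fin.snoc (α := fun _ => Fin 4) B c) = _
  refine Finset.sum_congr rfl fun c _ => ?_
  have e : Fin.snoc (α := fun _ => Fin 4) B c = icons c B ∘ finRotate (p + 1) := by
    rw [Fin.snoc_eq_cons_rotate]; rfl
  simp only [e, hξ.1]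

/-- Transpositions carry any upper and lower slot to the first ones, so one vanishing contraction
makes all of them vanish. -/
theorem symAlt_trace_update {p q : ℕ} {ξ : Tens (p + 1) (q + 1)}
    (hξ : ξ ∈ symAlt (p + 1) (q + 1)) (h0 : contraction p q ξ = 0)
    (A : Fin (q + 1) → Fin 4) (B : Fin (p + 1) → Fin 4) (k : Fin (q + 1)) (i : Fin (p + 1)) :
    ∑ c, ξ (Function.update A k c, Function.update B i c) = 0 := by
  simp only [update_eq_icons_comp_swap, hξ.1, hξ.2]
  rw [← Finset.mul_sum, ← symAlt_trace_snoc hξ, h0]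
  simp

theorem symB_comp {p q : ℕ} (T : (Fin q → Fin 4) → (Fin p → Fin 4) → ℂ) (A : Fin q → Fin 4)
    (B : Fin p → Fin 4) (τ : Equiv.Perm (Fin p)) : symB T A (B ∘ τ) = symB T A B := by
  unfold symB
  rw [← Equiv.sum_comp (Equiv.mulLeft τ) fun σ => T A (B ∘ σ)]
  rfl

theorem altA_comp {p q : ℕ} (T : (Fin q → Fin 4) → (Fin p → Fin 4) → ℂ) (A : Fin q → Fin 4)
    (B : Fin p → Fin 4) (τ : Equiv.Perm (Fin q)) :
    altA T (A ∘ τ) B = ((Equiv.Perm.sign τ : ℤ) : ℂ) * altA T A B := by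
  have hs : ((Equiv.Perm.sign τ : ℤ) : ℂ) * ((Equiv.Perm.sign τ : ℤ) : ℂ) = 1 := by
    rw [← Int.cast_mul, Int.units_coe_mul_self, Int.cast_one]
  unfold altA
  rw [← Equiv.sum_comp (Equiv.mulLeft τ) fun σ => ((Equiv.Perm.sign σ : ℤ) : ℂ) * T (A ∘ σ) B,
    mul_left_comm, Finset.mul_sum (a := ((Equiv.Perm.sign τ : ℤ) : ℂ))]
  congr 1
  refine Finset.sum_congr rfl fun σ _ => ?_
  simp only [Equiv.coe_mulLeft, Equiv.Perm.sign_mul, Units.val_mul, Int.cast_mul,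
    Equiv.Perm.coe_mul, ← Function.comp_assoc]
  rw [← mul_assoc, ← mul_assoc, hs, one_mul]

theorem symB_mem_symAlt {p q : ℕ} (T : (Fin q → Fin 4) → (Fin p → Fin 4) → ℂ)
    (hT : ∀ A B (σ : Equiv.Perm (Fin q)), T (A ∘ σ) B = ((Equiv.Perm.sign σ : ℤ) : ℂ) * T A B) :
    (WithLp.toLp 2 fun i => symB T i.1 i.2 : Tens p q) ∈ symAlt p q := by
  refine ⟨fun A B σ => symB_comp T A B σ, fun A B σ => ?_⟩
  simp only [symB, hT, Finset.mul_sum]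
  exact Finset.sum_congr rfl fun τ _ => by ring

theorem altA_mem_symAlt {p q : ℕ} (T : (Fin q → Fin 4) → (Fin p → Fin 4) → ℂ)
    (hT : ∀ A B (σ : Equiv.Perm (Fin p)), T A (B ∘ σ) = T A B) :
    (WithLp.toLp 2 fun i => altA T i.1 i.2 : Tens p q) ∈ symAlt p q := by
  refine ⟨fun A B σ => ?_, fun A B σ => altA_comp T A B σ⟩
  simp only [altA, hT]

theorem icons_comp_succ {n : ℕ} (a : Fin 4) (A : Fin n → Fin 4) (σ : Equiv.Perm (Fin n)) :
    icons a (A ∘ σ) = icons a A ∘ Equiv.Perm.decomposeFin.symm (0, σ) := by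
  rw [icons_comp_decomposeFin]
  simp

theorem symAlt_icons_comp_right {p q : ℕ} {ξ : Tens (p + 1) q} (hξ : ξ ∈ symAlt (p + 1) q)
    (A : Fin q → Fin 4) (b : Fin 4) (B : Fin p → Fin 4) (σ : Equiv.Perm (Fin p)) :
    ξ (A, icons b (B ∘ σ)) = ξ (A, icons b B) := by
  rw [icons_comp_succ, hξ.1]

theorem symAlt_icons_comp_left {p q : ℕ} {ξ : Tens p (q + 1)} (hξ : ξ ∈ symAlt p (q + 1))
    (a : Fin 4) (A : Fin q → Fin 4) (B : Fin p → Fin 4) (σ : Equiv.Perm (Fin q)) :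
    ξ (icons a (A ∘ σ), B) = ((Equiv.Perm.sign σ : ℤ) : ℂ) * ξ (icons a A, B) := by
  rw [icons_comp_succ, hξ.2]
  simp

theorem icons_icons {n : ℕ} (a c : Fin 4) (A : Fin n → Fin 4) :
    icons a (icons c A) = icons c (icons a A) ∘ Equiv.swap 0 1 := by
  ext x
  refine Fin.cases ?_ (fun x => Fin.cases ?_ (fun x => ?_) x) x
  · simp
  · simp
  · have h : Equiv.swap (0 : Fin (n + 2)) 1 x.succ.succ = x.succ.succ := by
      refine Equiv.swap_apply_of_ne_of_ne (Fin.succ_ne_zero _) fun h => ?_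
      rw [← Fin.succ_zero_eq_one] at h
      exact Fin.succ_ne_zero _ (Fin.succ_injective _ h)
    rw [Function.comp_apply, h]
    simp

theorem symAlt_swap_left {p q : ℕ} {ξ : Tens p (q + 2)} (hξ : ξ ∈ symAlt p (q + 2))
    (a c : Fin 4) (A : Fin q → Fin 4) (B : Fin p → Fin 4) :
    ξ (icons a (icons c A), B) = -ξ (icons c (icons a A), B) := by
  rw [icons_icons, hξ.2]
  simp

theorem symAlt_swap_right {p q : ℕ} {ξ : Tens (p + 2) q} (hξ : ξ ∈ symAlt (p + 2) q)
    (a c : Fin 4) (A : Fin q → Fin 4) (B : Fin p → Fin 4) :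
    ξ (A, icons a (icons c B)) = ξ (A, icons c (icons a B)) := by
  rw [icons_icons, hξ.1]

end Symmetrization

/-! ### The symbol of the adjoint before projection to `𝒱`. -/

section StarMap

/-- Contraction of the first upper index with the conjugate coefficients of `∇`. -/
def low {p q : ℕ} (i : Fin 6) (η : Tens p (q + 1)) (A : Fin q → Fin 4) (b : Fin 4)
    (B : Fin p → Fin 4) : ℂ :=
  ∑ e, conj (sym i e b) * η (icons e A, B)

theorem starMap_apply {p q : ℕ} (i : Fin 6) (η : Tens p (q + 1)) (A : Fin q → Fin 4)
    (B : Fin (p + 1) → Fin 4) :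
    starMap p q i η (A, B) = symB (fun A B => -low i η A (B 0) (Fin.tail B)) A B := rfl

theorem low_comp_right {p q : ℕ} (i : Fin 6) {η : Tens p (q + 1)} (hη : η ∈ symAlt p (q + 1))
    (A : Fin q → Fin 4) (b : Fin 4) (B : Fin p → Fin 4) (σ : Equiv.Perm (Fin p)) :
    low i η A b (B ∘ σ) = low i η A b B := by
  simp only [low, hη.1]

theorem low_comp_left {p q : ℕ} (i : Fin 6) {η : Tens p (q + 1)} (hη : η ∈ symAlt p (q + 1))
    (A : Fin q → Fin 4) (b : Fin 4) (B : Fin p → Fin 4) (σ : Equiv.Perm (Fin q)) :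
    low i η (A ∘ σ) b B = ((Equiv.Perm.sign σ : ℤ) : ℂ) * low i η A b B := by
  simp only [low, symAlt_icons_comp_left hη, Finset.mul_sum]
  exact Finset.sum_congr rfl fun e _ => by ring

theorem starMap_mem {p q : ℕ} (i : Fin 6) {η : Tens p (q + 1)} (hη : η ∈ symAlt p (q + 1)) :
    starMap p q i η ∈ symAlt (p + 1) q :=
  symB_mem_symAlt (fun A B => -low i η A (B 0) (Fin.tail B)) fun A B σ => by
    simp only [low_comp_left i hη, mul_neg]

theorem starMap_icons {p q : ℕ} (i : Fin 6) {η : Tens p (q + 1)} (hη : η ∈ symAlt p (q + 1))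
    (A : Fin q → Fin 4) (b : Fin 4) (B : Fin p → Fin 4) :
    starMap p q i η (A, icons b B) = -(((p : ℂ) + 1)⁻¹ *
      (low i η A b B + ∑ k, low i η A (B k) (Function.update B k b))) := by
  rw [starMap_apply, symB_icons]
  · simp only [Fin.cons_zero, Fin.tail_cons, Finset.sum_neg_distrib]
    ring
  · intro b B e
    simp only [Fin.cons_zero, Fin.tail_cons, low_comp_right i hη]

/-- Symmetrization is an orthogonal projection, so it may be dropped on one side. Expanded on the
other side, it gives the identity term and `n + 1` exchanges, all equal after summation. -/
theorem inner_starMap {n q : ℕ} (i j : Fin 6) {η η' : Tens (n + 1) (q + 1)}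
    (hη : η ∈ symAlt (n + 1) (q + 1)) (hη' : η' ∈ symAlt (n + 1) (q + 1)) :
    ((n : ℂ) + 2) * inner ℂ (starMap (n + 1) q i η) (starMap (n + 1) q j η') =
      ∑ A, (∑ b, ∑ B, conj (low i η A b B) * low j η' A b B +
        (n + 1) * ∑ b, ∑ d, ∑ B : Fin n → Fin 4,
          conj (low i η A b (icons d B)) * low j η' A d (icons b B)) := by
  have hn : (n : ℂ) + 2 ≠ 0 := by exact_mod_cast (n + 1).succ_ne_zero
  rw [PiLp.inner_apply, Fintype.sum_prod_type]
  simp only [RCLike.inner_apply']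
  have h := sum_symB (fun A B => -low i η A (B 0) (Fin.tail B)) (starMap_mem j hη')
  simp only [starMap_apply i] 
  rw [h, Finset.mul_sum]
  refine Finset.sum_congr rfl fun A _ => ?_
  rw [sum_cons]
  simp only [Fin.cons_zero, Fin.tail_cons, starMap_icons j hη']
  have e2 : ∀ k : Fin (n + 1), ∑ b, ∑ B, conj (low i η A b B) *
      low j η' A (B k) (Function.update B k b) =
      ∑ b, ∑ d, ∑ B : Fin n → Fin 4,
          conj (low i η A b (icons d B)) * low j η' A d (icons b B) := fun k =>
    sum_update_swap (fun b B => conj (low i η A b B)) (fun b B => low j η' A b B)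
      (fun b d B B' σ => by rw [low_comp_right i hη, low_comp_right j hη']) k
  have e3 : (n + 1 : ℂ) * ∑ b, ∑ d, ∑ B : Fin n → Fin 4,
      conj (low i η A b (icons d B)) * low j η' A d (icons b B) =
      ∑ b, ∑ B, ∑ k, conj (low i η A b B) * low j η' A (B k) (Function.update B k b) := by
    have : ∀ b, ∑ B, ∑ k, conj (low i η A b B) * low j η' A (B k) (Function.update B k b) =
      ∑ k, ∑ B, conj (low i η A b B) * low j η' A (B k) (Function.update B k b) :=
      fun b => Finset.sum_comm
    simp only [this]
    refine Eq.trans ?_ Finset.sum_comm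
    rw [Finset.sum_congr rfl fun k _ => e2 k]
    simp
  rw [e3, ← Finset.sum_add_distrib, Finset.mul_sum]
  refine Finset.sum_congr rfl fun b _ => ?_
  rw [← Finset.sum_add_distrib, Finset.mul_sum]
  refine Finset.sum_congr rfl fun B _ => ?_
  rw [← Finset.mul_sum]
  push_cast
  have : (n : ℂ) + 1 + 1 ≠ 0 := by rwa [add_assoc, one_add_one_eq_two]
  simp only [map_neg]
  field_simp
  ring

/-- Contraction of the derivative index with the coefficients of `∇`. -/
def up {p q : ℕ} (ξ : Fin 6 → Tens p q) (a b : Fin 4)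
    (K : (Fin q → Fin 4) × (Fin p → Fin 4)) : ℂ := ∑ i, sym i a b * ξ i K

/-- The contraction of `up` with the first lower index. -/
def gup {p q : ℕ} (ξ : Fin 6 → Tens (p + 1) q) (a : Fin 4) (A : Fin q → Fin 4)
    (B : Fin p → Fin 4) : ℂ := ∑ d, up ξ a d (A, icons d B)

/-- Because `x` carries the index of `a'` and `y` that of `a`, regrouping the sums turns
contractions with conjugate coefficients, as in `low`, into contractions over the derivative index,
as in `up`. -/
theorem sum_swap_factor {ι κ : Type*} [Fintype ι] [Fintype κ] (a a' x y : ι → κ → ℂ) :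
    ∑ i, ∑ j, conj (∑ e, conj (a i e) * x j e) * (∑ c, conj (a' j c) * y i c) =
      ∑ e, ∑ c, conj (∑ j, a' j c * x j e) * ∑ i, a i e * y i c := by
  simp only [map_sum, map_mul, Complex.conj_conj, Finset.sum_mul_sum]
  rw [Finset.sum_comm_cycle]
  refine Finset.sum_congr rfl fun e _ => ?_
  rw [Finset.sum_comm_cycle]
  refine Finset.sum_congr rfl fun c _ => ?_
  rw [Finset.sum_comm]
  exact Finset.sum_congr rfl fun j _ => Finset.sum_congr rfl fun i _ => by ring

/-- In the exchange terms of `inner_starMap` the second index of `∇` is summed against a lower index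
of `ξ`, which produces `gup`; the direct terms keep the two apart. -/
theorem swapForm_starMap {n q : ℕ} {ξ : Fin 6 → Tens (n + 1) (q + 1)}
    (hξ : ∀ i, ξ i ∈ symAlt (n + 1) (q + 1)) :
    ((n : ℂ) + 2) * ∑ i, ∑ j, inner ℂ (starMap (n + 1) q i (ξ j)) (starMap (n + 1) q j (ξ i)) =
      ∑ A : Fin q → Fin 4, (∑ b, ∑ B, ∑ e, ∑ c,
        conj (up ξ c b (icons e A, B)) * up ξ e b (icons c A, B) +
        (n + 1) * ∑ B : Fin n → Fin 4, ∑ e, ∑ c,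
          conj (gup ξ c (icons e A) B) * gup ξ e (icons c A) B) := by
  simp only [Finset.mul_sum (a := (n : ℂ) + 2), inner_starMap _ _ (hξ _) (hξ _)]
  rw [Finset.sum_comm_cycle]
  refine Finset.sum_congr rfl fun A _ => ?_
  simp only [Finset.sum_add_distrib, ← Finset.mul_sum]
  congr 1
  · rw [Finset.sum_comm_cycle]
    refine Finset.sum_congr rfl fun b _ => ?_
    rw [Finset.sum_comm_cycle]
    refine Finset.sum_congr rfl fun B _ => ?_
    exact sum_swap_factor (fun i e => sym i e b) (fun j c => sym j c b)
      (fun j e => ξ j (icons e A, B)) fun i c => ξ i (icons c A, B)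
  · congr 1
    rw [Finset.sum_comm_cycle]
    have h : ∀ b, ∑ i, ∑ j, ∑ d, ∑ B : Fin n → Fin 4,
        conj (low i (ξ j) A b (icons d B)) * low j (ξ i) A d (icons b B) =
        ∑ d, ∑ B : Fin n → Fin 4, ∑ e, ∑ c,
          conj (up ξ c d (icons e A, icons d B)) * up ξ e b (icons c A, icons b B) := fun b => by
      rw [Finset.sum_comm_cycle]
      refine Finset.sum_congr rfl fun d _ => ?_
      rw [Finset.sum_comm_cycle]
      refine Finset.sum_congr rfl fun B _ => ?_
      exact sum_swap_factor (fun i e => sym i e b) (fun j c => sym j c d)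
        (fun j e => ξ j (icons e A, icons d B)) fun i c => ξ i (icons c A, icons b B)
    simp only [h, gup, map_sum, Finset.sum_mul_sum]
    rw [Finset.sum_comm_cycle]
    refine Finset.sum_congr rfl fun B _ => ?_
    rw [Finset.sum_comm_cycle]
    refine Finset.sum_congr rfl fun e _ => ?_
    rw [Finset.sum_comm_cycle]
    refine Finset.sum_congr rfl fun c _ => ?_
    rw [Finset.sum_comm]

/-- Real parts of the coefficients of `∇`. -/
def symRe (j : Fin 6) (a b : Fin 4) : ℤ :=
  ((![!![0, 0, 0, 0; 0, 0, 0, 0; 0, 0, 0, 0; 0, 0, 0, 0],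
    !![0, 0, 0, 1; 0, 0, 1, 0; 0, -1, 0, 0; -1, 0, 0, 0],
    !![0, 0, 0, 0; 0, 0, 0, 0; 0, 0, 0, 0; 0, 0, 0, 0],
    !![0, 0, 1, 0; 0, 0, 0, -1; -1, 0, 0, 0; 0, 1, 0, 0],
    !![0, 0, 0, 0; 0, 0, 0, 0; 0, 0, 0, 0; 0, 0, 0, 0],
    !![0, 1, 0, 0; -1, 0, 0, 0; 0, 0, 0, 1; 0, 0, -1, 0]] : Fin 6 → Matrix (Fin 4) (Fin 4) ℤ) j) a b

/-- Imaginary parts of the coefficients of `∇`. -/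
def symIm (j : Fin 6) (a b : Fin 4) : ℤ :=
  ((![!![0, 1, 0, 0; -1, 0, 0, 0; 0, 0, 0, -1; 0, 0, 1, 0],
    !![0, 0, 0, 0; 0, 0, 0, 0; 0, 0, 0, 0; 0, 0, 0, 0],
    !![0, 0, 0, 1; 0, 0, -1, 0; 0, 1, 0, 0; -1, 0, 0, 0],
    !![0, 0, 0, 0; 0, 0, 0, 0; 0, 0, 0, 0; 0, 0, 0, 0],
    !![0, 0, 1, 0; 0, 0, 0, 1; -1, 0, 0, 0; 0, -1, 0, 0],
    !![0, 0, 0, 0; 0, 0, 0, 0; 0, 0, 0, 0; 0, 0, 0, 0]] : Fin 6 → Matrix (Fin 4) (Fin 4) ℤ) j) a b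

theorem sym_eq_re_im (j : Fin 6) (a b : Fin 4) :
    sym j a b = (symRe j a b : ℂ) + (symIm j a b : ℂ) * Complex.I := by
  fin_cases j <;> fin_cases a <;> fin_cases b <;> simp [sym, iota, symRe, symIm]

/-- The six coefficient matrices form an orthogonal basis of the antisymmetric matrices, each of
squared norm `4`; the sum is thus four times the projection to antisymmetric matrices. -/
theorem sum_sym_conj (a b c d : Fin 4) :
    ∑ i, sym i a b * conj (sym i c d) =
      2 * ((if a = c then 1 else 0) * (if b = d then 1 else 0) -
        (if a = d then 1 else 0) * (if b = c then 1 else 0)) := by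
  -- Splitting the coefficients into integer real and imaginary parts leaves finitely many
  -- identities, which can be decided.
  have h1 : ∀ a b c d, ∑ i, (symRe i a b * symRe i c d + symIm i a b * symIm i c d) =
      2 * ((if a = c then 1 else 0) * (if b = d then 1 else 0) -
        (if a = d then 1 else 0) * (if b = c then 1 else 0)) := by decide +kernel
  have h2 : ∀ a b c d, ∑ i, (symIm i a b * symRe i c d - symRe i a b * symIm i c d) = 0 := by
    decide +kernel
  have h : ∀ i, sym i a b * conj (sym i c d) =
      ((symRe i a b * symRe i c d + symIm i a b * symIm i c d : ℤ) : ℂ) +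
        ((symIm i a b * symRe i c d - symRe i a b * symIm i c d : ℤ) : ℂ) * Complex.I := fun i => by
    rw [sym_eq_re_im, sym_eq_re_im]
    simp only [map_add, map_mul, Complex.conj_I, map_intCast]
    push_cast
    linear_combination -(symIm i a b * symIm i c d : ℂ) * Complex.I_sq
  simp only [h, Finset.sum_add_distrib, ← Finset.sum_mul, ← Int.cast_sum, h1, h2]
  push_cast
  ring

/-- Polarization of the fact that, for real `x`, the matrix `∑ x_i sym i` times its adjoint is
`|x|²`. -/
theorem clifford (i j : Fin 6) (a c : Fin 4) :
    ∑ b, (sym i c b * conj (sym j a b) + sym j c b * conj (sym i a b)) =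
      2 * ((if a = c then 1 else 0) * (if i = j then 1 else 0)) := by
  have h1 : ∀ i j a c, ∑ b, (symRe i c b * symRe j a b + symIm i c b * symIm j a b +
      (symRe j c b * symRe i a b + symIm j c b * symIm i a b)) =
      2 * ((if a = c then 1 else 0) * (if i = j then 1 else 0)) := by decide +kernel
  have h2 : ∀ i j a c, ∑ b, (symIm i c b * symRe j a b - symRe i c b * symIm j a b +
      (symIm j c b * symRe i a b - symRe j c b * symIm i a b)) = 0 := by decide +kernel
  have h : ∀ b, sym i c b * conj (sym j a b) + sym j c b * conj (sym i a b) =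
      ((symRe i c b * symRe j a b + symIm i c b * symIm j a b +
      (symRe j c b * symRe i a b + symIm j c b * symIm i a b) : ℤ) : ℂ) +
        ((symIm i c b * symRe j a b - symRe i c b * symIm j a b +
      (symIm j c b * symRe i a b - symRe j c b * symIm i a b) : ℤ) : ℂ) * Complex.I := fun b => by
    simp only [sym_eq_re_im, map_add, map_mul, Complex.conj_I, map_intCast]
    push_cast
    linear_combination -(symIm i c b * symIm j a b + symIm j c b * symIm i a b : ℂ) * Complex.I_sq
  simp only [h, Finset.sum_add_distrib, ← Finset.sum_mul, ← Int.cast_sum]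
  simp only [← Finset.sum_add_distrib, h1, h2]
  push_cast
  ring

theorem normSq_tens {p q : ℕ} (η : Tens p q) :
    ((‖η‖ ^ 2 : ℝ) : ℂ) = ∑ A, ∑ B, conj (η (A, B)) * η (A, B) := by
  have := inner_self_eq_norm_sq_to_K (𝕜 := ℂ) η
  rw [PiLp.inner_apply, Fintype.sum_prod_type] at this
  simp only [RCLike.inner_apply'] at this
  rw [this]
  simp

theorem sum_low_low {p q : ℕ} (η η' : Tens p (q + 1)) (A : Fin q → Fin 4) (b d : Fin 4)
    (B B' : Fin p → Fin 4) :
    ∑ i, conj (low i η A b B) * low i η' A d B' =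
      2 * ((if b = d then ∑ e, conj (η (icons e A, B)) * η' (icons e A, B') else 0) -
        conj (η (icons d A, B)) * η' (icons b A, B')) := by
  have h : ∀ i, conj (low i η A b B) * low i η' A d B' = ∑ e, ∑ c,
      sym i e b * conj (sym i c d) * (conj (η (icons e A, B)) * η' (icons c A, B')) := fun i => by
    simp only [low, map_sum, map_mul, Complex.conj_conj, Finset.sum_mul_sum]
    exact Finset.sum_congr rfl fun e _ => Finset.sum_congr rfl fun c _ => by ring
  simp only [h]
  rw [← Finset.sum_comm_cycle]
  simp only [← Finset.sum_mul, sum_sym_conj]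
  simp only [mul_sub, sub_mul, Finset.sum_sub_distrib]
  congr 1
  · by_cases hb : b = d <;> simp [hb, Finset.mul_sum]
  · simp

/-- The number `2 n + 8` is `6 + 2 (n + 1)`. By `sum_sym_conj` the direct terms give `2 (4 - 1)`;
the exchange terms give `2`, weighted by `n + 1`, once trace-freeness has removed their remaining
part. -/
theorem sum_normSq_starMap {n q : ℕ} {η : Tens (n + 1) (q + 1)}
    (hη : η ∈ symAlt (n + 1) (q + 1)) (h0 : contraction n q η = 0) :
    ((n : ℝ) + 2) * ∑ i, ‖starMap (n + 1) q i η‖ ^ 2 = (2 * n + 8) * ‖η‖ ^ 2 := by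
  have h : ∀ i, ((‖starMap (n + 1) q i η‖ ^ 2 : ℝ) : ℂ) =
      inner ℂ (starMap (n + 1) q i η) (starMap (n + 1) q i η) := fun i => by
    rw [inner_self_eq_norm_sq_to_K]; simp
  have tr : ∀ A B, ∑ c, η (icons c A, icons c B) = 0 := fun A B => by
    rw [← symAlt_trace_snoc hη, h0]; simp
  apply Complex.ofReal_injective
  rw [Complex.ofReal_mul, Complex.ofReal_mul, normSq_tens, Complex.ofReal_sum]
  push_cast [h]
  rw [Finset.mul_sum]
  simp only [inner_starMap _ _ hη hη]
  rw [Finset.sum_comm, sum_cons, Finset.sum_comm (γ := Fin 4), Finset.mul_sum]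
  refine Finset.sum_congr rfl fun A _ => ?_
  rw [Finset.sum_add_distrib, ← Finset.mul_sum]
  have e1 : ∑ i, ∑ b, ∑ B, conj (low i η A b B) * low i η A b B =
      6 * ∑ a, ∑ B, conj (η (icons a A, B)) * η (icons a A, B) := by
    rw [← Finset.sum_comm_cycle]
    simp only [sum_low_low, if_true, ← Finset.mul_sum, Finset.sum_sub_distrib, Finset.sum_const,
      Finset.card_univ, Fintype.card_fin, nsmul_eq_mul]
    rw [Finset.sum_comm (γ := Fin 4)]
    push_cast
    ring
  have e2 : ∑ i, ∑ b, ∑ d, ∑ B : Fin n → Fin 4,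
          conj (low i η A b (icons d B)) * low i η A d (icons b B) =
      2 * ∑ a, ∑ B, conj (η (icons a A, B)) * η (icons a A, B) := by
    rw [← Finset.sum_comm_cycle]
    have h3 : ∀ b d, ∑ i, ∑ B : Fin n → Fin 4,
        conj (low i η A b (icons d B)) * low i η A d (icons b B) = ∑ B : Fin n → Fin 4,
        2 * ((if b = d then
          ∑ e, conj (η (icons e A, icons d B)) * η (icons e A, icons b B) else 0) -
        conj (η (icons d A, icons d B)) * η (icons b A, icons b B)) := fun b d => by
      rw [Finset.sum_comm]
      simp only [sum_low_low]
    have h4 : ∀ B : Fin n → Fin 4, ∑ b, ∑ d,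
        conj (η (icons d A, icons d B)) * η (icons b A, icons b B) = 0 := fun B => by
      simp only [← Finset.sum_mul, ← Finset.mul_sum, tr, mul_zero]
    simp only [h3]
    rw [Finset.sum_comm_cycle]
    simp only [← Finset.mul_sum, Finset.sum_sub_distrib, h4, Finset.sum_ite_eq, Finset.mem_univ,
      if_true, sub_zero, sum_cons fun B : Fin (n + 1) → Fin 4 => conj (η (icons _ A, B)) * _]
    congr 1
    rw [Finset.sum_comm_cycle]
    refine Finset.sum_congr rfl fun e _ => ?_
    rw [Finset.sum_comm]
  rw [e1, e2]
  ring

end StarMap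

/-! ### The symbol of `𝒟`. -/

section AltUp

theorem up_swap {p q : ℕ} (ξ : Fin 6 → Tens p q) (a b : Fin 4)
    (K : (Fin q → Fin 4) × (Fin p → Fin 4)) : up ξ a b K = -up ξ b a K := by
  simp only [up, ← Finset.sum_neg_distrib]
  exact Finset.sum_congr rfl fun i _ => by rw [sym_swap]; ring

theorem gup_comp_left {n q : ℕ} {ξ : Fin 6 → Tens (n + 1) q} (hξ : ∀ i, ξ i ∈ symAlt (n + 1) q)
    (a : Fin 4) (A : Fin q → Fin 4) (B : Fin n → Fin 4) (σ : Equiv.Perm (Fin q)) :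
    gup ξ a (A ∘ σ) B = ((Equiv.Perm.sign σ : ℤ) : ℂ) * gup ξ a A B := by
  simp only [gup, up, (hξ _).2, Finset.mul_sum]
  exact Finset.sum_congr rfl fun d _ => Finset.sum_congr rfl fun i _ => by ring

theorem gup_comp_right {n q : ℕ} {ξ : Fin 6 → Tens (n + 1) q} (hξ : ∀ i, ξ i ∈ symAlt (n + 1) q)
    (a : Fin 4) (A : Fin q → Fin 4) (B : Fin n → Fin 4) (σ : Equiv.Perm (Fin n)) :
    gup ξ a A (B ∘ σ) = gup ξ a A B := by
  simp only [gup, up, symAlt_icons_comp_right (hξ _)]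

/-- The antisymmetrization of `gup` in all upper indices. -/
def altUp {n q : ℕ} (ξ : Fin 6 → Tens (n + 1) (q + 1)) : Tens n (q + 2) :=
  WithLp.toLp 2 fun i => altA (fun A B => gup ξ (A 0) (Fin.tail A) B) i.1 i.2

theorem altUp_mem {n q : ℕ} {ξ : Fin 6 → Tens (n + 1) (q + 1)}
    (hξ : ∀ i, ξ i ∈ symAlt (n + 1) (q + 1)) : altUp ξ ∈ symAlt n (q + 2) :=
  altA_mem_symAlt (fun A B => gup ξ (A 0) (Fin.tail A) B) fun A B σ => by
    simp only [gup_comp_right hξ]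

theorem altUp_icons {n q : ℕ} {ξ : Fin 6 → Tens (n + 1) (q + 1)}
    (hξ : ∀ i, ξ i ∈ symAlt (n + 1) (q + 1)) (a : Fin 4) (A : Fin (q + 1) → Fin 4)
    (B : Fin n → Fin 4) :
    altUp ξ (icons a A, B) = ((q : ℂ) + 2)⁻¹ *
      (gup ξ a A B - ∑ k, gup ξ (A k) (Function.update A k a) B) := by
  have h := altA_icons (fun A B => gup ξ (A 0) (Fin.tail A) B) B
    (fun a A e => by simp only [Fin.cons_zero, Fin.tail_cons, gup_comp_left hξ]) a A
  refine h.trans ?_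
  simp only [Fin.cons_zero, Fin.tail_cons]
  push_cast
  rw [add_assoc, one_add_one_eq_two]

theorem sum_altUp {n q : ℕ} (ξ : Fin 6 → Tens (n + 1) (q + 1)) {ζ : Tens n (q + 2)}
    (hζ : ζ ∈ symAlt n (q + 2)) :
    ∑ A, ∑ B, conj (ζ (A, B)) * altUp ξ (A, B) =
      ∑ a, ∑ A, ∑ B, conj (ζ (icons a A, B)) * gup ξ a A B := by
  refine (sum_altA (fun A B => gup ξ (A 0) (Fin.tail A) B) hζ).trans ?_
  rw [sum_cons]
  simp only [Fin.cons_zero, Fin.tail_cons]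

/-- Antisymmetrization is an orthogonal projection, so `‖altUp ξ‖²` is the pairing of `altUp ξ` with
`gup`. Expanding the remaining antisymmetrization leaves the identity term and `q + 1` equal
exchange terms. -/
theorem sum_gup_swap {n q : ℕ} {ξ : Fin 6 → Tens (n + 1) (q + 1)}
    (hξ : ∀ i, ξ i ∈ symAlt (n + 1) (q + 1)) :
    ((q : ℂ) + 1) * ∑ A : Fin q → Fin 4, ∑ B : Fin n → Fin 4, ∑ e, ∑ c,
          conj (gup ξ c (icons e A) B) * gup ξ e (icons c A) B =
      ∑ a, ∑ A, ∑ B, conj (gup ξ a A B) * gup ξ a A B -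
        ((q : ℂ) + 2) * ((‖altUp ξ‖ ^ 2 : ℝ) : ℂ) := by
  have hq : (q : ℂ) + 2 ≠ 0 := by exact_mod_cast (q + 1).succ_ne_zero
  have hs : ∀ σ : Equiv.Perm (Fin (q + 1)),
      ((Equiv.Perm.sign σ : ℤ) : ℂ) * ((Equiv.Perm.sign σ : ℤ) : ℂ) = 1 := fun e => by
    rw [← Int.cast_mul, Int.units_coe_mul_self, Int.cast_one]
  have e2 : ∀ (B : Fin n → Fin 4) (k : Fin (q + 1)), ∑ a, ∑ A, gup ξ a A B *
      conj (gup ξ (A k) (Function.update A k a) B) =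
      ∑ b, ∑ d, ∑ A : Fin q → Fin 4,
          gup ξ b (icons d A) B * conj (gup ξ d (icons b A) B) := fun B k =>
    sum_update_swap (fun a A => gup ξ a A B) (fun a A => conj (gup ξ a A B))
      (fun b d A A' σ => by
        rw [gup_comp_left hξ, gup_comp_left hξ, map_mul, map_intCast]
        linear_combination gup ξ b A B * conj (gup ξ d A' B) * hs σ) k
  have e3 : ∑ a, ∑ A : Fin (q + 1) → Fin 4, ∑ B, ∑ k, gup ξ a A B *
      conj (gup ξ (A k) (Function.update A k a) B) = ((q : ℂ) + 1) *
      ∑ A : Fin q → Fin 4, ∑ B : Fin n → Fin 4, ∑ e, ∑ c,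
          conj (gup ξ c (icons e A) B) * gup ξ e (icons c A) B := by
    rw [Finset.sum_comm_cycle, Finset.sum_comm (γ := Fin q → Fin 4), Finset.mul_sum]
    refine Finset.sum_congr rfl fun B _ => ?_
    rw [Finset.sum_comm_cycle, Finset.sum_congr rfl fun k _ => e2 B k]
    simp only [Finset.sum_const, Finset.card_univ, Fintype.card_fin, nsmul_eq_mul]
    push_cast
    congr 1
    rw [Finset.sum_comm_cycle]
    refine Finset.sum_congr rfl fun A _ => Finset.sum_congr rfl fun e _ =>
      Finset.sum_congr rfl fun c _ => ?_
    exact mul_comm _ _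
  rw [normSq_tens, sum_altUp ξ (altUp_mem hξ)]
  simp only [altUp_icons hξ, map_mul, map_sub, map_inv₀, map_sum, map_add, map_natCast,
    Complex.conj_ofNat]
  rw [eq_sub_iff_add_eq, ← e3]
  simp only [Finset.mul_sum (a := (q : ℂ) + 2), ← Finset.sum_add_distrib]
  refine Finset.sum_congr rfl fun a _ => Finset.sum_congr rfl fun A _ =>
    Finset.sum_congr rfl fun B _ => ?_
  rw [← Finset.mul_sum]
  field_simp
  ring

/-- A trace that meets the free index of `∇` vanishes because `∇` is antisymmetric and the lower
indices are symmetric; a trace between two indices of `ξ i` vanishes by hypothesis. -/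
theorem altUp_trace {m q : ℕ} {ξ : Fin 6 → Tens (m + 2) (q + 1)}
    (hξ : ∀ i, ξ i ∈ symAlt (m + 2) (q + 1)) (h0 : ∀ i, contraction (m + 1) q (ξ i) = 0) :
    contraction m (q + 1) (altUp ξ) = 0 := by
  ext ⟨A, B⟩
  rw [symAlt_trace_snoc (altUp_mem hξ)]
  simp only [altUp_icons hξ, ← Finset.mul_sum, Finset.sum_sub_distrib]
  have h1 : ∑ c, gup ξ c A (icons c B) = 0 := by
    have : ∑ c, gup ξ c A (icons c B) = -∑ c, gup ξ c A (icons c B) := by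
      conv_lhs => simp only [gup]
      rw [Finset.sum_comm]
      simp only [gup, ← Finset.sum_neg_distrib]
      refine Finset.sum_congr rfl fun c _ => Finset.sum_congr rfl fun d _ => ?_
      rw [up_swap]
      simp only [up, symAlt_swap_right (hξ _) c d]
    exact self_eq_neg.1 this
  have h2 : ∀ k, ∑ c, gup ξ (A k) (Function.update A k c) (icons c B) = 0 := fun k => by
    have h3 : ∀ (i : Fin 6) (d : Fin 4),
        ∑ c, ξ i (Function.update A k c, icons d (icons c B)) = 0 := fun i d => by
      have h := symAlt_trace_update (hξ i) (h0 i) A (icons 0 (icons d B)) k 0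
      simp only [Fin.update_cons_zero] at h
      simpa only [symAlt_swap_right (hξ i) d] using h
    simp only [gup, up]
    rw [Finset.sum_comm]
    refine Finset.sum_eq_zero fun d _ => ?_
    rw [Finset.sum_comm]
    refine Finset.sum_eq_zero fun i _ => ?_
    rw [← Finset.mul_sum, h3, mul_zero]
  rw [Finset.sum_comm]
  simp [h1, h2]

theorem mem_scrV_succ {p q : ℕ} {ξ : Tens (p + 1) (q + 1)} :
    ξ ∈ scrV (p + 1) (q + 1) ↔ ξ ∈ symAlt (p + 1) (q + 1) ∧ contraction p q ξ = 0 := Iff.rfl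

theorem incl_contraction {p q : ℕ} (η : Fib (p + 1) (q + 1)) :
    contraction p q (incl (p + 1) (q + 1) η) = 0 :=
  (mem_scrV_succ.1 (Subtype.property (p := fun x => x ∈ scrV (p + 1) (q + 1)) η)).2

theorem sum_inner_starMap {n q : ℕ} (ξ : Fin 6 → Tens (n + 1) (q + 1))
    (hξ : ∀ i, ξ i ∈ symAlt (n + 1) (q + 1)) {ζ : Tens n (q + 2)} (hζ : ζ ∈ symAlt n (q + 2)) :
    ∑ i, inner ℂ (starMap n (q + 1) i ζ) (ξ i) = -inner ℂ ζ (altUp ξ) := by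
  rw [PiLp.inner_apply, Fintype.sum_prod_type]
  simp only [RCLike.inner_apply']
  rw [sum_altUp ξ hζ]
  have h : ∀ i, inner ℂ (starMap n (q + 1) i ζ) (ξ i) =
      -∑ A, ∑ b, ∑ B, ∑ e, conj (ζ (icons e A, B)) * (sym i e b * ξ i (A, icons b B)) := fun i => by
    rw [PiLp.inner_apply, Fintype.sum_prod_type]
    simp only [RCLike.inner_apply', starMap_apply]
    rw [sum_symB _ (hξ i)]
    simp only [sum_cons (n := n), ← Finset.sum_neg_distrib]
    refine Finset.sum_congr rfl fun A _ => Finset.sum_congr rfl fun b _ =>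
      Finset.sum_congr rfl fun B _ => ?_
    simp only [Fin.cons_zero, Fin.tail_cons, low, map_neg, map_sum, map_mul, Complex.conj_conj,
      Finset.sum_mul, neg_mul, Finset.sum_neg_distrib]
    congr 1
    exact Finset.sum_congr rfl fun e _ => by ring
  simp only [h, Finset.sum_neg_distrib, gup, up, Finset.mul_sum]
  congr 1
  rw [Finset.sum_comm]
  refine Eq.trans ?_ Finset.sum_comm
  refine Finset.sum_congr rfl fun A _ => ?_
  rw [Finset.sum_comm_cycle]
  refine Eq.trans ?_ Finset.sum_comm
  refine Finset.sum_congr rfl fun B _ => ?_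
  rw [Finset.sum_comm_cycle]
  exact Finset.sum_congr rfl fun e _ => Finset.sum_comm

-- Since `altUp` takes values in `𝒱`, it can be paired with the symbol of `𝒟`. The projection in
-- `thetaMap` is invisible there because each `ξ i` lies in `𝒱`, the pairing is `-‖altUp‖²` by
-- `sum_inner_starMap`, and Cauchy–Schwarz concludes.
open ContinuousLinearMap in
theorem norm_altUp_le {m q : ℕ} (ξ : Fin 6 → Fib (m + 2) (q + 1)) :
    ‖altUp fun i => incl (m + 2) (q + 1) (ξ i)‖ ^ 2 ≤
      ‖∑ i, adjoint (thetaMap (m + 1) (q + 1) i) (ξ i)‖ ^ 2 := by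
  set Γ := altUp fun i => incl (m + 2) (q + 1) (ξ i) with hΓ
  have hm : Γ ∈ symAlt (m + 1) (q + 2) := altUp_mem fun i => incl_mem (ξ i)
  let ζ : Fib (m + 1) (q + 2) := (⟨Γ, mem_scrV_succ.2 ⟨hm, altUp_trace (fun i => incl_mem (ξ i))
    fun i => incl_contraction (ξ i)⟩⟩ : scrV (m + 1) (q + 2))
  have hζ : incl (m + 1) (q + 2) ζ = Γ := rfl
  have hn : ‖ζ‖ = ‖Γ‖ := by rw [← hζ, LinearIsometry.norm_map]
  have h : inner ℂ ζ (∑ i, adjoint (thetaMap (m + 1) (q + 1) i) (ξ i)) = -inner ℂ Γ Γ := by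
    rw [inner_sum]
    simp only [adjoint_inner_right, thetaMap_apply, inner_proj, hζ]
    exact sum_inner_starMap _ (fun i => incl_mem (ξ i)) hm
  have h2 := norm_inner_le_norm (𝕜 := ℂ) ζ (∑ i, adjoint (thetaMap (m + 1) (q + 1) i) (ξ i))
  rw [h, norm_neg, inner_self_eq_norm_sq_to_K, hn] at h2
  simp only [Complex.coe_algebraMap, norm_pow, Complex.norm_real, norm_norm] at h2
  rcases (norm_nonneg Γ).eq_or_lt with h0 | h0
  · rw [← h0, zero_pow two_ne_zero]; positivity
  · gcongr
    rw [pow_two] at h2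
    exact le_of_mul_le_mul_left h2 h0

end AltUp

/-! ### The loss of norm under projection to `𝒱`. -/

section ProjectionBound

/-- `u` tensored with the identity of `ℂ⁴`. -/
def deltaTens {p q : ℕ} (u : Tens p q) (A : Fin (q + 1) → Fin 4) (B : Fin (p + 1) → Fin 4) : ℂ :=
  if A 0 = B 0 then u (Fin.tail A, Fin.tail B) else 0

/-- The adjoint of the contraction on symmetric-antisymmetric tensors. -/
def expand {p q : ℕ} (u : Tens p q) : Tens (p + 1) (q + 1) :=
  WithLp.toLp 2 fun i => symB (altA (deltaTens u)) i.1 i.2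

theorem altA_delta_icons {p q : ℕ} {u : Tens p q} (hu : u ∈ symAlt p q) (a : Fin 4)
    (A : Fin q → Fin 4) (b : Fin 4) (B : Fin p → Fin 4) :
    altA (deltaTens u) (icons a A) (icons b B) = ((q : ℂ) + 1)⁻¹ *
      ((if a = b then u (A, B) else 0) -
        ∑ k, if A k = b then u (Function.update A k a, B) else 0) := by
  rw [altA_icons]
  · simp [deltaTens]
  · intro a A e
    simp [deltaTens, hu.2]

theorem altA_delta_mem {p q : ℕ} {u : Tens p q} (hu : u ∈ symAlt p q) (A : Fin (q + 1) → Fin 4)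
    (b : Fin 4) (B : Fin p → Fin 4) (e : Equiv.Perm (Fin p)) :
    altA (deltaTens u) A (icons b (B ∘ e)) = altA (deltaTens u) A (icons b B) := by
  simp [altA, deltaTens, hu.1]

theorem expand_mem {p q : ℕ} (u : Tens p q) : expand u ∈ symAlt (p + 1) (q + 1) :=
  symB_mem_symAlt (altA (deltaTens u)) fun A B σ => altA_comp _ A B σ

theorem expand_icons {p q : ℕ} {u : Tens p q} (hu : u ∈ symAlt p q) (a : Fin 4)
    (A : Fin q → Fin 4) (b : Fin 4) (B : Fin p → Fin 4) :
    expand u (icons a A, icons b B) = ((p : ℂ) + 1)⁻¹ * ((q : ℂ) + 1)⁻¹ *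
      ((if a = b then u (A, B) else 0) -
        (∑ k, if A k = b then u (Function.update A k a, B) else 0) +
      ∑ l, ((if a = B l then u (A, Function.update B l b) else 0) -
        ∑ k, if A k = B l then u (Function.update A k a, Function.update B l b) else 0)) := by
  change symB (altA (deltaTens u)) (icons a A) (icons b B) = _
  rw [symB_icons _ _ fun b B e => altA_delta_mem hu _ b B e]
  simp only [altA_delta_icons hu, ← Finset.mul_sum]
  ring

/-- The scalar counts traces of the identity: `4` from the free pair, `p` from exchanges of lower
indices, `-q` from exchanges of upper ones. Double exchanges are traces of `u` and vanish. -/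
theorem contraction_expand {p q : ℕ} {u : Tens p q} (hu : u ∈ symAlt p q)
    (h0 : ∀ A B k l, ∑ c, u (Function.update A k c, Function.update B l c) = 0) :
    contraction p q (expand u) =
      ((((p : ℂ) + 1)⁻¹ * ((q : ℂ) + 1)⁻¹ * (p + 4 - q)) : ℂ) • u := by
  ext ⟨A, B⟩
  rw [symAlt_trace_snoc (expand_mem u)]
  simp only [expand_icons hu, ← Finset.mul_sum, PiLp.smul_apply, smul_eq_mul, mul_assoc]
  congr 2
  have h1 : ∑ c : Fin 4, ∑ k, (if A k = c then u (Function.update A k c, B) else 0) =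
      q * u (A, B) := by
    rw [Finset.sum_comm]
    simp
  have h2 : ∑ c : Fin 4, ∑ l, (if c = B l then u (A, Function.update B l c) else 0) =
      p * u (A, B) := by
    rw [Finset.sum_comm]
    simp
  have h3 : ∑ c : Fin 4, ∑ l, ∑ k, (if A k = B l then
      u (Function.update A k c, Function.update B l c) else 0) = 0 := by
    rw [Finset.sum_comm]
    refine Finset.sum_eq_zero fun l _ => ?_
    rw [Finset.sum_comm]
    refine Finset.sum_eq_zero fun k _ => ?_
    split_ifs
    · exact h0 A B k l
    · simp
  simp only [Finset.sum_add_distrib, Finset.sum_sub_distrib, h1, h2, h3]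
  simp
  ring

theorem inner_expand {p q : ℕ} {H : Tens (p + 1) (q + 1)} (hH : H ∈ symAlt (p + 1) (q + 1))
    (u : Tens p q) : inner ℂ H (expand u) = inner ℂ (contraction p q H) u := by
  rw [← inner_conj_symm, PiLp.inner_apply, Fintype.sum_prod_type]
  simp only [RCLike.inner_apply']
  have h1 := sum_symB (altA (deltaTens u)) hH
  have h2 := sum_altA (deltaTens u) hH
  have h3 : ∑ A, ∑ B, conj (expand u (A, B)) * H (A, B) =
      ∑ A, ∑ B, conj (altA (deltaTens u) A B) * H (A, B) := h1
  rw [h3, map_sum]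
  simp only [map_sum, map_mul, Complex.conj_conj]
  simp only [mul_comm (altA _ _ _)]
  rw [h2, PiLp.inner_apply, Fintype.sum_prod_type, sum_cons]
  refine Finset.sum_comm.trans ?_
  refine Finset.sum_congr (M := ℂ) rfl fun A _ => ?_
  simp only [RCLike.inner_apply', symAlt_trace_snoc hH, map_sum, Finset.sum_mul]
  refine Eq.trans (Finset.sum_congr rfl fun a _ => ?_) Finset.sum_comm
  rw [sum_cons]
  refine Finset.sum_comm.trans (Finset.sum_congr rfl fun B _ => ?_)
  simp [deltaTens]

/-- By `inner_expand` the tensors `expand u` are orthogonal to trace-free ones. Subtracting from `H`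
the multiple of `expand u` that removes its trace leaves `v` in `𝒱` with `⟨v, H⟩ = ‖v‖²`, and
Pythagoras gives `‖v‖²` as the left side; pairing `v` with the projection of `H` then bounds it from
below. -/
theorem normSq_proj_ge {p q : ℕ} (hpq : q < p + 4) {H : Tens (p + 1) (q + 1)}
    (hH : H ∈ symAlt (p + 1) (q + 1)) (hu : contraction p q H ∈ symAlt p q)
    (h0 : ∀ A B k l, ∑ c,
      contraction p q H (Function.update A k c, Function.update B l c) = 0) :
    ‖H‖ ^ 2 - ((p + 1) * (q + 1) / (p + 4 - q) : ℝ) * ‖contraction p q H‖ ^ 2 ≤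
      ‖proj (p + 1) (q + 1) H‖ ^ 2 := by
  set u := contraction p q H with hu'
  have hp1 : (p : ℝ) + 1 ≠ 0 := by positivity
  have hq1 : (q : ℝ) + 1 ≠ 0 := by positivity
  have hpq' : (p : ℝ) + 4 - q ≠ 0 := by
    have : (q : ℝ) < p + 4 := by exact_mod_cast hpq
    linarith
  set lam : ℝ := (p + 1) * (q + 1) / (p + 4 - q) with hlam
  have hc : (lam : ℂ) * (((p : ℂ) + 1)⁻¹ * ((q : ℂ) + 1)⁻¹ * (p + 4 - q)) = 1 := by
    have : lam * (((p : ℝ) + 1)⁻¹ * ((q : ℝ) + 1)⁻¹ * (p + 4 - q)) = 1 := by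
      rw [hlam]; field_simp
    have := congrArg Complex.ofReal this
    push_cast at this
    exact this
  set v := H - (lam : ℂ) • expand u with hv
  have hCe : (lam : ℂ) • contraction p q (expand u) = u := by
    rw [contraction_expand hu h0, smul_smul, hc, one_smul]
  have hvm : v ∈ symAlt (p + 1) (q + 1) :=
    (symAlt _ _).sub_mem hH ((symAlt _ _).smul_mem _ (expand_mem u))
  have hCv : contraction p q v = 0 := by
    rw [hv, map_sub, map_smul, hCe, sub_self]
  have hve : inner ℂ v (expand u) = 0 := by
    rw [inner_expand hvm, hCv, inner_zero_left]
  have hHv : H = v + (lam : ℂ) • expand u := by rw [hv]; abel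
  have hiv : inner ℂ v H = ((‖v‖ ^ 2 : ℝ) : ℂ) := by
    conv_lhs => rw [hHv]
    rw [inner_add_right, inner_smul_right, hve, mul_zero, add_zero, inner_self_eq_norm_sq_to_K]
    simp
  have hnorm : ‖v‖ ^ 2 = ‖H‖ ^ 2 - lam * ‖u‖ ^ 2 := by
    have h1 : inner ℂ v H = inner ℂ H H - (lam : ℂ) * inner ℂ u u := by
      conv_lhs => rw [hv]
      rw [inner_sub_left, inner_smul_left, Complex.conj_ofReal, ← inner_conj_symm (expand u) H,
        inner_expand hH, inner_conj_symm]
    rw [hiv, inner_self_eq_norm_sq_to_K, inner_self_eq_norm_sq_to_K] at h1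
    exact Complex.ofReal_injective (by simpa using h1)
  rw [← hnorm]
  let w : Fib (p + 1) (q + 1) := (⟨v, mem_scrV_succ.2 ⟨hvm, hCv⟩⟩ : scrV (p + 1) (q + 1))
  have hw : incl (p + 1) (q + 1) w = v := rfl
  have hn : ‖w‖ = ‖v‖ := by rw [← hw, LinearIsometry.norm_map]
  have h2 := norm_inner_le_norm (𝕜 := ℂ) w (proj (p + 1) (q + 1) H)
  rw [inner_proj', hw, hiv, hn] at h2
  simp only [Complex.norm_real, norm_pow, norm_norm] at h2
  rcases (norm_nonneg v).eq_or_lt with h0 | h0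
  · rw [← h0, zero_pow two_ne_zero]; positivity
  · gcongr
    rw [pow_two] at h2
    exact le_of_mul_le_mul_left h2 h0

end ProjectionBound

/-! ### The trace of the adjoint symbol. -/

section PairContraction

/-- Contraction of the first two upper indices with the conjugate coefficients of `∇`. -/
def pairMap (p q : ℕ) (i : Fin 6) : Tens p (q + 2) →ₗ[ℂ] Tens p q where
  toFun η := WithLp.toLp 2 fun K =>
    ∑ e : Fin 4 × Fin 4, conj (sym i e.1 e.2) * η (icons e.1 (icons e.2 K.1), K.2)
  map_add' ξ η := by ext K; simp [Finset.sum_add_distrib, mul_add]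
  map_smul' c ξ := by ext K; simp [Finset.mul_sum, mul_left_comm]

theorem pairMap_apply {p q : ℕ} (i : Fin 6) (η : Tens p (q + 2)) (A : Fin q → Fin 4)
    (B : Fin p → Fin 4) : pairMap p q i η (A, B) =
      ∑ e : Fin 4 × Fin 4, conj (sym i e.1 e.2) * η (icons e.1 (icons e.2 A), B) := rfl

/-- Of the symmetrized terms only the one in which the contracted lower index sits on the
coefficient of `∇` survives; in the others it sits on `η`, and they are traces of `η`. -/
theorem contraction_starMap {n q : ℕ} (i : Fin 6) {η : Tens (n + 1) (q + 2)}
    (hη : η ∈ symAlt (n + 1) (q + 2)) (h0 : contraction n (q + 1) η = 0) :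
    contraction (n + 1) q (starMap (n + 1) (q + 1) i η) =
      (-((n : ℂ) + 2)⁻¹) • pairMap (n + 1) q i η := by
  ext ⟨A, B⟩
  rw [symAlt_trace_snoc (starMap_mem i hη), PiLp.smul_apply, pairMap_apply,
    Fintype.sum_prod_type, Finset.sum_comm]
  simp only [starMap_icons i hη, Finset.sum_neg_distrib, ← Finset.mul_sum, smul_eq_mul, neg_mul]
  push_cast
  rw [add_assoc, one_add_one_eq_two]
  congr 2
  rw [Finset.sum_add_distrib]
  have h : ∑ c, ∑ k, low i η (icons c A) (B k) (Function.update B k c) = 0 := by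
    rw [Finset.sum_comm]
    refine Finset.sum_eq_zero fun k _ => ?_
    simp only [low]
    rw [Finset.sum_comm]
    refine Finset.sum_eq_zero fun e _ => ?_
    have := symAlt_trace_update hη h0 (icons 0 (icons e A)) B 0 k
    simp only [Fin.update_cons_zero] at this
    simp only [symAlt_swap_left hη e, mul_neg, Finset.sum_neg_distrib, ← Finset.mul_sum, this,
      mul_zero, neg_zero]
  rw [h, add_zero]
  rfl

/-- Antisymmetry in the first two upper indices makes the two terms of `sum_sym_conj` contribute
equally, hence `4 = 2 + 2`. -/
theorem sum_normSq_pairMap {p q : ℕ} {η : Tens p (q + 2)} (hη : η ∈ symAlt p (q + 2)) :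
    ∑ i, ‖pairMap p q i η‖ ^ 2 = 4 * ‖η‖ ^ 2 := by
  apply Complex.ofReal_injective
  rw [Complex.ofReal_mul, normSq_tens, Complex.ofReal_sum]
  simp only [normSq_tens]
  have key : ∀ A B, ∑ i, conj (pairMap p q i η (A, B)) * pairMap p q i η (A, B) =
      4 * ∑ a, ∑ c, conj (η (icons a (icons c A), B)) * η (icons a (icons c A), B) := fun A B => by
    have h : ∀ i, conj (pairMap p q i η (A, B)) * pairMap p q i η (A, B) =
        ∑ a, ∑ b, ∑ c, ∑ d, sym i a b * conj (sym i c d) *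
          (conj (η (icons a (icons b A), B)) * η (icons c (icons d A), B)) := fun i => by
      simp only [pairMap_apply, Fintype.sum_prod_type, map_sum, map_mul, Complex.conj_conj,
        Finset.sum_mul]
      refine Finset.sum_congr rfl fun a _ => Finset.sum_congr rfl fun b _ => ?_
      simp only [Finset.mul_sum]
      exact Finset.sum_congr rfl fun c _ => Finset.sum_congr rfl fun d _ => by ring
    simp only [h]
    rw [← Finset.sum_comm_cycle, Finset.mul_sum]
    refine Finset.sum_congr rfl fun a _ => ?_
    rw [Finset.mul_sum]
    refine Finset.sum_congr rfl fun b _ => ?_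
    rw [← Finset.sum_comm_cycle]
    simp only [← Finset.sum_mul, sum_sym_conj, mul_sub, sub_mul, Finset.sum_sub_distrib]
    have e1 : ∑ c, ∑ d, 2 * ((if a = c then 1 else 0) * (if b = d then 1 else 0)) *
        (conj (η (icons a (icons b A), B)) * η (icons c (icons d A), B)) =
        2 * (conj (η (icons a (icons b A), B)) * η (icons a (icons b A), B)) := by
      rw [Finset.sum_eq_single a (fun c _ hc => by simp [hc.symm]) (by simp),
        Finset.sum_eq_single b (fun d _ hd => by simp [hd.symm]) (by simp)]
      simp
    have e2 : ∑ c, ∑ d, 2 * ((if a = d then 1 else 0) * (if b = c then 1 else 0)) *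
        (conj (η (icons a (icons b A), B)) * η (icons c (icons d A), B)) =
        -(2 * (conj (η (icons a (icons b A), B)) * η (icons a (icons b A), B))) := by
      rw [Finset.sum_eq_single b (fun c _ hc => by simp [hc.symm]) (by simp),
        Finset.sum_eq_single a (fun d _ hd => by simp [hd.symm]) (by simp),
        symAlt_swap_left hη b a]
      simp
    rw [e1, e2]
    ring
  rw [Finset.sum_comm]
  have h : ∀ A, ∑ i, ∑ B, conj (pairMap p q i η (A, B)) * pairMap p q i η (A, B) =
      ∑ B, 4 * ∑ a, ∑ c, conj (η (icons a (icons c A), B)) * η (icons a (icons c A), B) :=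
    fun A => by rw [Finset.sum_comm]; exact Finset.sum_congr rfl fun B _ => key A B
  simp only [h, sum_cons (n := q + 1), sum_cons (n := q), ← Finset.mul_sum]
  push_cast
  congr 1
  refine Eq.trans (Finset.sum_congr rfl fun A _ => ?_) Finset.sum_comm_cycle.symm
  exact Finset.sum_comm_cycle.symm

theorem swapForm_pairMap {p q : ℕ} (ξ : Fin 6 → Tens p (q + 2)) :
    ∑ i, ∑ j, inner ℂ (pairMap p q i (ξ j)) (pairMap p q j (ξ i)) =
      ∑ A, ∑ B, ∑ e : Fin 4 × Fin 4, ∑ c : Fin 4 × Fin 4,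
        conj (up ξ c.1 c.2 (icons e.1 (icons e.2 A), B)) *
          up ξ e.1 e.2 (icons c.1 (icons c.2 A), B) := by
  simp only [PiLp.inner_apply, Fintype.sum_prod_type (α₁ := Fin q → Fin 4), RCLike.inner_apply',
    pairMap_apply]
  rw [Finset.sum_comm_cycle]
  refine Finset.sum_congr rfl fun A _ => ?_
  rw [Finset.sum_comm_cycle]
  refine Finset.sum_congr rfl fun B _ => ?_
  exact sum_swap_factor (κ := Fin 4 × Fin 4) (fun i e => sym i e.1 e.2) (fun j c => sym j c.1 c.2)
    (fun j e => ξ j (icons e.1 (icons e.2 A), B)) fun i c => ξ i (icons c.1 (icons c.2 A), B)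

end PairContraction

/-! ### The pointwise inequalities on `𝒱`. -/

section Fibers

/-- `starMap` on `𝒱`. -/
def starFib (p q : ℕ) (i : Fin 6) : Fib p (q + 1) →L[ℂ] Tens (p + 1) q :=
  LinearMap.toContinuousLinearMap ((starMap p q i).comp (incl p (q + 1)).toLinearMap)

/-- `pairMap` on `𝒱`. -/
def pairFib (p q : ℕ) (i : Fin 6) : Fib p (q + 2) →L[ℂ] Tens p q :=
  LinearMap.toContinuousLinearMap ((pairMap p q i).comp (incl p (q + 2)).toLinearMap)

theorem starFib_apply (p q : ℕ) (i : Fin 6) (η : Fib p (q + 1)) :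
    starFib p q i η = starMap p q i (incl p (q + 1) η) := rfl

theorem pairFib_apply (p q : ℕ) (i : Fin 6) (η : Fib p (q + 2)) :
    pairFib p q i η = pairMap p q i (incl p (q + 2) η) := rfl

theorem sum_thetaMap (p q : ℕ) (ζ : Fin 6 → Fib p (q + 1)) :
    ∑ i, thetaMap p q i (ζ i) = proj (p + 1) q (∑ i, starFib p q i (ζ i)) := by
  rw [map_sum]; rfl

theorem pairMap_mem {p q : ℕ} (i : Fin 6) {η : Tens p (q + 2)} (hη : η ∈ symAlt p (q + 2)) :
    pairMap p q i η ∈ symAlt p q := by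
  refine ⟨fun A B σ => ?_, fun A B σ => ?_⟩
  · simp only [pairMap_apply, hη.1]
  · simp only [pairMap_apply, icons_comp_succ, hη.2, Finset.mul_sum]
    refine Finset.sum_congr rfl fun e _ => ?_
    simp
    ring

theorem pairMap_trace {p q : ℕ} (i : Fin 6) {η : Tens (p + 1) (q + 2)}
    (hη : η ∈ symAlt (p + 1) (q + 2)) (h0 : contraction p (q + 1) η = 0) (A : Fin q → Fin 4)
    (B : Fin (p + 1) → Fin 4) (k : Fin q) (l : Fin (p + 1)) :
    ∑ c, pairMap (p + 1) q i η (Function.update A k c, Function.update B l c) = 0 := by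
  simp only [pairMap_apply]
  rw [Finset.sum_comm]
  refine Finset.sum_eq_zero fun e _ => ?_
  have := symAlt_trace_update hη h0 (icons e.1 (icons e.2 A)) B k.succ.succ l
  rw [← Finset.mul_sum]
  simp only [Fin.cons_update, this, mul_zero]

/-- The factor is `(n + 2) (q + 1) / (n + 5 - q)`, from `normSq_proj_ge` with `p = n + 1`, times the
square of the `1 / (n + 2)` in `contraction_starMap`. The degree `l` is `q + 2`. -/
theorem normSq_theta_ge {n q : ℕ} (hq : q ≤ n + 4) (ζ : Fin 6 → Fib (n + 1) (q + 2)) :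
    ‖∑ i, starFib (n + 1) (q + 1) i (ζ i)‖ ^ 2 -
      ((q + 1) / ((n + 5 - q) * (n + 2)) : ℝ) * ‖∑ i, pairFib (n + 1) q i (ζ i)‖ ^ 2 ≤
        ‖∑ i, thetaMap (n + 1) (q + 1) i (ζ i)‖ ^ 2 := by
  rw [sum_thetaMap]
  set H := ∑ i, starFib (n + 1) (q + 1) i (ζ i) with hH
  have hHm : H ∈ symAlt (n + 2) (q + 1) :=
    (symAlt _ _).sum_mem fun i _ => starMap_mem i (incl_mem (ζ i))
  have hC : contraction (n + 1) q H =
      (-((n : ℂ) + 2)⁻¹) • ∑ i, pairFib (n + 1) q i (ζ i) := by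
    rw [hH, map_sum, Finset.smul_sum]
    exact Finset.sum_congr rfl fun i _ =>
      contraction_starMap i (incl_mem (ζ i)) (incl_contraction (ζ i))
  have hm : contraction (n + 1) q H ∈ symAlt (n + 1) q := by
    rw [hC]
    exact (symAlt _ _).smul_mem _ ((symAlt _ _).sum_mem fun i _ => pairMap_mem i (incl_mem (ζ i)))
  have h := normSq_proj_ge (by omega) hHm hm fun A B k l => by
    rw [hC]
    simp only [PiLp.smul_apply, ← Finset.smul_sum, WithLp.ofLp_sum, Finset.sum_apply]
    rw [Finset.sum_comm, Finset.sum_eq_zero, smul_zero]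
    intro i _
    exact pairMap_trace i (incl_mem (ζ i)) (incl_contraction (ζ i)) A B k l
  refine le_trans (le_of_eq ?_) h
  have hn : (n : ℝ) + 2 ≠ 0 := by positivity
  have hnorm : ‖contraction (n + 1) q H‖ = ((n : ℝ) + 2)⁻¹ * ‖∑ i, pairFib (n + 1) q i (ζ i)‖ := by
    rw [hC, norm_smul, norm_neg, norm_inv]
    congr 2
    have : (n : ℂ) + 2 = ((n + 2 : ℕ) : ℂ) := by push_cast; ring
    rw [this, Complex.norm_natCast]
    push_cast; ring
  have hq' : (n : ℝ) + 5 - q ≠ 0 := by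
    have : (q : ℝ) ≤ n + 4 := by exact_mod_cast hq
    linarith
  have hq2 : ((n : ℝ) + 1) + 4 - q ≠ 0 := by
    convert hq' using 1; ring
  rw [hnorm]
  push_cast
  field_simp
  ring

/-- With `α = (q + 1) / (n + 5 - q)` the right side exceeds the left by `8 (1 - α) ‖η‖² / (n + 2)`,
and `hq` says that `α ≤ 1`. -/
theorem const_le_of_starFib {n q : ℕ} (hq : 2 * q ≤ n + 4) (η : Fib (n + 1) (q + 2)) :
    4 * ‖η‖ ^ 2 ≤ 2 * ∑ i, ‖starFib (n + 1) (q + 1) i η‖ ^ 2 -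
      ((q + 1) / ((n + 5 - q) * (n + 2)) : ℝ) * (2 * ∑ i, ‖pairFib (n + 1) q i η‖ ^ 2) := by
  have h1 := sum_normSq_starMap (incl_mem η) (incl_contraction η)
  have h2 := sum_normSq_pairMap (incl_mem η)
  simp only [LinearIsometry.norm_map, ← starFib_apply, ← pairFib_apply] at h1 h2
  rw [h2]
  have hn : (0 : ℝ) < n + 2 := by positivity
  have hq' : (2 * q : ℝ) ≤ n + 4 := by exact_mod_cast hq
  have hd : (0 : ℝ) < n + 5 - q := by
    have : (0 : ℝ) ≤ q := Nat.cast_nonneg q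
    linarith
  have hα : ((q + 1) / (n + 5 - q) : ℝ) ≤ 1 := by rw [div_le_one hd]; linarith
  have hS : ∑ i, ‖starFib (n + 1) (q + 1) i η‖ ^ 2 = (2 * n + 8) / (n + 2) * ‖η‖ ^ 2 := by
    field_simp
    linarith
  have e : ((q + 1) / ((n + 5 - q) * (n + 2)) : ℝ) = (q + 1) / (n + 5 - q) / (n + 2) := by
    rw [div_div]
  rw [hS, e]
  set α : ℝ := (q + 1) / (n + 5 - q)
  have : 2 * ((2 * n + 8) / (n + 2) * ‖η‖ ^ 2) - α / (n + 2) * (2 * (4 * ‖η‖ ^ 2)) -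
      4 * ‖η‖ ^ 2 = 8 * (1 - α) * ‖η‖ ^ 2 / (n + 2) := by
    field_simp
    ring
  have : 0 ≤ 8 * (1 - α) * ‖η‖ ^ 2 / (n + 2) := by
    have : 0 ≤ 1 - α := by linarith
    positivity
  linarith

/-- The part of the swap form of `starMap` that involves no contraction with lower indices. -/
def swapA {p q : ℕ} (ξ : Fin 6 → Tens p (q + 1)) : ℂ :=
  ∑ A : Fin q → Fin 4, ∑ b, ∑ B, ∑ e, ∑ c,
    conj (up ξ c b (icons e A, B)) * up ξ e b (icons c A, B)

/-- The squared norm of `gup`. -/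
def normSqGup {n q : ℕ} (ξ : Fin 6 → Tens (n + 1) q) : ℂ :=
  ∑ a, ∑ A, ∑ B, conj (gup ξ a A B) * gup ξ a A B

theorem swapForm_starFib {n q : ℕ} (ξ : Fin 6 → Fib (n + 1) (q + 1)) :
    ((n : ℝ) + 2) * swapForm (starFib (n + 1) q) ξ =
      (swapA fun i => incl (n + 1) (q + 1) (ξ i)).re +
        (n + 1) / (q + 1) * ((normSqGup fun i => incl (n + 1) (q + 1) (ξ i)).re -
          (q + 2) * ‖altUp fun i => incl (n + 1) (q + 1) (ξ i)‖ ^ 2) := by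
  have hq : (q : ℝ) + 1 ≠ 0 := by positivity
  have h1 := swapForm_starMap (fun i => incl_mem (ξ i))
  have h2 := sum_gup_swap (fun i => incl_mem (ξ i))
  simp only [Finset.sum_add_distrib, ← Finset.mul_sum] at h1
  change _ = swapA _ + _ at h1
  change _ = normSqGup _ - _ at h2
  set S : ℂ := ∑ A : Fin q → Fin 4, ∑ B : Fin n → Fin 4, ∑ e, ∑ c,
          conj (gup (fun i => incl (n + 1) (q + 1) (ξ i)) c (icons e A) B) *
            gup (fun i => incl (n + 1) (q + 1) (ξ i)) e (icons c A) B
  have r1 : ((n : ℝ) + 2) * swapForm (starFib (n + 1) q) ξ =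
      (swapA fun i => incl (n + 1) (q + 1) (ξ i)).re + (n + 1) * S.re := by
    have := congrArg Complex.re h1
    have e : (n : ℂ) + 2 = (((n : ℝ) + 2 : ℝ) : ℂ) := by push_cast; ring
    have e' : (n : ℂ) + 1 = (((n : ℝ) + 1 : ℝ) : ℂ) := by push_cast; ring
    rw [e, e', Complex.re_ofReal_mul, Complex.add_re, Complex.re_ofReal_mul] at this
    exact this
  have r2 : ((q : ℝ) + 1) * S.re = (normSqGup fun i => incl (n + 1) (q + 1) (ξ i)).re -
          (q + 2) * ‖altUp fun i => incl (n + 1) (q + 1) (ξ i)‖ ^ 2 := by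
    have := congrArg Complex.re h2
    have e : (q : ℂ) + 2 = (((q : ℝ) + 2 : ℝ) : ℂ) := by push_cast; ring
    have e' : (q : ℂ) + 1 = (((q : ℝ) + 1 : ℝ) : ℂ) := by push_cast; ring
    rw [e, e', Complex.re_ofReal_mul, Complex.sub_re, Complex.re_ofReal_mul,
      Complex.ofReal_re] at this
    exact this
  rw [r1, ← r2]
  field_simp

-- In `swapForm_starFib` the negative coefficient of `‖altUp‖²` has size at most `2 (m + 2)`, while
-- the symbol of `𝒟` supplies `2 (m + 3)`. The spare `2 ‖altUp‖²` is available in each degree to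
-- compensate `swapA`.
open ContinuousLinearMap in
theorem swapForm_nonneg {m q : ℕ} {W : Type*} [NormedAddCommGroup W] [InnerProductSpace ℂ W]
    (N : Fin 6 → Fib (m + 2) (q + 1) →L[ℂ] W) (β : ℝ) (ξ : Fin 6 → Fib (m + 2) (q + 1))
    (h : 0 ≤ (swapA fun i => incl (m + 2) (q + 1) (ξ i)).re +
        (m + 2) / (q + 1) * (normSqGup fun i => incl (m + 2) (q + 1) (ξ i)).re -
          (m + 3) * β * swapForm N ξ +
            2 * ‖altUp fun i => incl (m + 2) (q + 1) (ξ i)‖ ^ 2) :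
    0 ≤ swapForm (starFib (m + 2) q) ξ - β * swapForm N ξ +
      2 * ‖∑ i, adjoint (thetaMap (m + 1) (q + 1) i) (ξ i)‖ ^ 2 := by
  have h1 := swapForm_starFib (n := m + 1) ξ
  have h2 := norm_altUp_le ξ
  push_cast at h1
  have hm : (0 : ℝ) < m + 3 := by positivity
  set Γ := ‖altUp fun i => incl (m + 2) (q + 1) (ξ i)‖ ^ 2
  have hΓ : 0 ≤ Γ := sq_nonneg _
  refine nonneg_of_mul_nonneg_right ?_ hm
  have e : (m : ℝ) + 1 + 1 = m + 2 := by ring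
  have e2 : (m : ℝ) + 1 + 2 = m + 3 := by ring
  rw [e, e2] at h1
  have h3 : ((m : ℝ) + 2) / (q + 1) * (q + 2) ≤ 2 * (m + 2) := by
    rw [div_mul_eq_mul_div, div_le_iff₀ (by positivity)]
    nlinarith [mul_nonneg (Nat.cast_nonneg (α := ℝ) m) (Nat.cast_nonneg (α := ℝ) q),
      Nat.cast_nonneg (α := ℝ) q]
  have h4 := mul_le_mul_of_nonneg_right h3 hΓ
  have h5 := mul_le_mul_of_nonneg_left h2 hm.le
  rw [mul_sub] at h1
  nlinarith

end Fibers

/-! ### Degree two. -/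

section TwoUpper

/-- The empty multi-index. -/
abbrev inil : Fin 0 → Fin 4 := Fin.elim0

theorem sum_inil {M : Type*} [AddCommMonoid M] (f : (Fin 0 → Fin 4) → M) : ∑ A, f A = f inil := by
  rw [Fintype.sum_unique]
  exact congrArg f (Subsingleton.elim _ _)

/-- The representation `∧² ⊗ ∧²` of `GL(4)` has three inequivalent irreducible parts, so the forms
in question are spanned by the norm, the exchange of the two pairs, and the square of the totally
antisymmetric part. The coefficients are checked in coordinates. -/
theorem antisymm_quadratic (F F' : Fin 4 → Fin 4 → Fin 4 → Fin 4 → ℂ)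
    (h1 : ∀ a b c d, F a b c d = -F b a c d) (h2 : ∀ a b c d, F a b c d = -F a b d c)
    (h1' : ∀ a b c d, F' a b c d = -F' b a c d) (h2' : ∀ a b c d, F' a b c d = -F' a b d c) :
    4 * ∑ a, ∑ b, ∑ e, ∑ c, F' c b e a * F e b c a =
      ∑ a, ∑ b, ∑ c, ∑ d, F' a b c d * F a b c d + ∑ a, ∑ b, ∑ c, ∑ d, F' c d a b * F a b c d -
        4 * ((F' 2 3 0 1 - F' 1 3 0 2 + F' 1 2 0 3 + F' 0 3 1 2 - F' 0 2 1 3 + F' 0 1 2 3) *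
          (F 2 3 0 1 - F 1 3 0 2 + F 1 2 0 3 + F 0 3 1 2 - F 0 2 1 3 + F 0 1 2 3)) := by
  have z1 : ∀ a c d, F a a c d = 0 := fun a c d => self_eq_neg.1 (h1 a a c d)
  have z2 : ∀ a b c, F a b c c = 0 := fun a b c => self_eq_neg.1 (h2 a b c c)
  have z1' : ∀ a c d, F' a a c d = 0 := fun a c d => self_eq_neg.1 (h1' a a c d)
  have z2' : ∀ a b c, F' a b c c = 0 := fun a b c => self_eq_neg.1 (h2' a b c c)
  simp only [Fin.sum_univ_four, z1, z2, z1', z2',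
    h1 1 0, h1 2 0, h1 3 0, h1 2 1, h1 3 1, h1 3 2, h2 _ _ 1 0, h2 _ _ 2 0, h2 _ _ 3 0,
    h2 _ _ 2 1, h2 _ _ 3 1, h2 _ _ 3 2, h1' 1 0, h1' 2 0, h1' 3 0, h1' 2 1, h1' 3 1, h1' 3 2,
    h2' _ _ 1 0, h2' _ _ 2 0, h2' _ _ 3 0, h2' _ _ 2 1, h2' _ _ 3 1, h2' _ _ 3 2,
    mul_zero, zero_mul, add_zero, zero_add, neg_zero, neg_mul, mul_neg, neg_neg]
  ring

theorem up_comp_left {p q : ℕ} {ξ : Fin 6 → Tens p q} (hξ : ∀ i, ξ i ∈ symAlt p q) (a b : Fin 4)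
    (A : Fin q → Fin 4) (B : Fin p → Fin 4) (σ : Equiv.Perm (Fin q)) :
    up ξ a b (A ∘ σ, B) = ((Equiv.Perm.sign σ : ℤ) : ℂ) * up ξ a b (A, B) := by
  simp only [up, (hξ _).2, Finset.mul_sum]
  exact Finset.sum_congr rfl fun i _ => by ring

theorem up_swap_left {p q : ℕ} {ξ : Fin 6 → Tens p (q + 2)} (hξ : ∀ i, ξ i ∈ symAlt p (q + 2))
    (a b c d : Fin 4) (A : Fin q → Fin 4) (B : Fin p → Fin 4) :
    up ξ a b (icons c (icons d A), B) = -up ξ a b (icons d (icons c A), B) := by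
  simp only [up, symAlt_swap_left (hξ _) c d, mul_neg, Finset.sum_neg_distrib]

theorem up_trace {p q : ℕ} {ξ : Fin 6 → Tens (p + 1) (q + 1)}
    (hξ : ∀ i, ξ i ∈ symAlt (p + 1) (q + 1)) (h0 : ∀ i, contraction p q (ξ i) = 0) (a b : Fin 4)
    (A : Fin q → Fin 4) (B : Fin p → Fin 4) :
    ∑ c, up ξ a b (icons c A, icons c B) = 0 := by
  simp only [up]
  rw [Finset.sum_comm]
  refine Finset.sum_eq_zero fun i _ => ?_
  rw [← Finset.mul_sum, ← symAlt_trace_snoc (hξ i), h0 i]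
  simp

theorem re_sum_conj_mul_self {ι : Type*} [Fintype ι] (z : ι → ℂ) :
    (∑ i, conj (z i) * z i).re = ∑ i, ‖z i‖ ^ 2 := by
  rw [Complex.re_sum]
  refine Finset.sum_congr rfl fun i _ => ?_
  rw [Complex.conj_mul', ← Complex.ofReal_pow, Complex.ofReal_re]

theorem re_conj_mul_add_nonneg (z w : ℂ) :
    0 ≤ (conj z * z).re + (conj w * w).re + (conj z * w).re + (conj w * z).re := by
  have : conj (z + w) * (z + w) = conj z * z + conj w * w + conj z * w + conj w * z := by
    rw [map_add]; ring
  rw [← Complex.add_re, ← Complex.add_re, ← Complex.add_re, ← this, Complex.conj_mul',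
    ← Complex.ofReal_pow, Complex.ofReal_re]
  positivity

theorem re_sum_swap_ge {κ : Type*} [Fintype κ] (z : κ → κ → ℂ) :
    0 ≤ (∑ a, ∑ b, conj (z a b) * z a b).re + (∑ a, ∑ b, conj (z b a) * z a b).re := by
  have h := Finset.sum_nonneg fun a (_ : a ∈ (Finset.univ : Finset κ)) =>
    Finset.sum_nonneg fun b (_ : b ∈ (Finset.univ : Finset κ)) =>
      re_conj_mul_add_nonneg (z a b) (z b a)
  simp only [Finset.sum_add_distrib, ← Complex.re_sum] at h
  rw [Finset.sum_comm (f := fun a b => conj (z b a) * z b a),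
    Finset.sum_comm (f := fun a b => conj (z a b) * z b a)] at h
  linarith

/-- With `I` the squared norm and `Q` the real part of the pair exchange, the expression is `(1/4 -
α) (I + Q) + α I`, and `I + Q ≥ 0`. -/
theorem antisymm_quadratic_ge (F : Fin 4 → Fin 4 → Fin 4 → Fin 4 → ℂ)
    (h1 : ∀ a b c d, F a b c d = -F b a c d) (h2 : ∀ a b c d, F a b c d = -F a b d c) {α : ℝ}
    (h0 : 0 ≤ α) (hα : α ≤ 1 / 4) :
    0 ≤ (∑ a, ∑ b, ∑ e, ∑ c, conj (F c b e a) * F e b c a).re -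
      α * (∑ a, ∑ b, ∑ c, ∑ d, conj (F c d a b) * F a b c d).re +
        ‖F 2 3 0 1 - F 1 3 0 2 + F 1 2 0 3 + F 0 3 1 2 - F 0 2 1 3 + F 0 1 2 3‖ ^ 2 := by
  have key := antisymm_quadratic F (fun a b c d => conj (F a b c d)) h1 h2
    (fun a b c d => by rw [h1, map_neg]) (fun a b c d => by rw [h2, map_neg])
  have hI := re_sum_swap_ge fun (a c : Fin 4 × Fin 4) => F a.1 a.2 c.1 c.2
  have hI0 := re_sum_conj_mul_self fun a : Fin 4 × Fin 4 × Fin 4 × Fin 4 =>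
    F a.1 a.2.1 a.2.2.1 a.2.2.2
  have hp : 0 ≤ ∑ a : Fin 4 × Fin 4 × Fin 4 × Fin 4, ‖F a.1 a.2.1 a.2.2.1 a.2.2.2‖ ^ 2 := by
    positivity
  rw [← hI0] at hp
  simp only [Fintype.sum_prod_type] at hI hp
  set S := ∑ a, ∑ b, ∑ e, ∑ c, conj (F c b e a) * F e b c a
  set Q := ∑ a, ∑ b, ∑ c, ∑ d, conj (F c d a b) * F a b c d
  set I := ∑ a, ∑ b, ∑ c, ∑ d, conj (F a b c d) * F a b c d
  set τ := F 2 3 0 1 - F 1 3 0 2 + F 1 2 0 3 + F 0 3 1 2 - F 0 2 1 3 + F 0 1 2 3 with hτ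
  have ht : (conj τ * τ).re = ‖τ‖ ^ 2 := by
    rw [Complex.conj_mul', ← Complex.ofReal_pow, Complex.ofReal_re]
  have hc : conj τ = conj (F 2 3 0 1) - conj (F 1 3 0 2) + conj (F 1 2 0 3) + conj (F 0 3 1 2) -
      conj (F 0 2 1 3) + conj (F 0 1 2 3) := by
    simp only [hτ, map_add, map_sub]
  rw [← hc] at key
  have k := congrArg Complex.re key
  have e4 : (4 : ℂ) = ((4 : ℝ) : ℂ) := by norm_num
  rw [e4, Complex.re_ofReal_mul, Complex.sub_re, Complex.add_re, Complex.re_ofReal_mul, ht] at k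
  have := mul_nonneg (sub_nonneg.2 hα) hI
  have := mul_nonneg h0 hp
  linarith

/-- The contraction of `up ξ` with the totally antisymmetric symbol. -/
def fullTrace {p : ℕ} (ξ : Fin 6 → Tens p 2) (B : Fin p → Fin 4) : ℂ :=
  up ξ 2 3 (icons 0 (icons 1 inil), B) - up ξ 1 3 (icons 0 (icons 2 inil), B) +
    up ξ 1 2 (icons 0 (icons 3 inil), B) + up ξ 0 3 (icons 1 (icons 2 inil), B) -
      up ξ 0 2 (icons 1 (icons 3 inil), B) + up ξ 0 1 (icons 2 (icons 3 inil), B)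

theorem swapA_two_ge {p : ℕ} {ξ : Fin 6 → Tens p 2} (hξ : ∀ i, ξ i ∈ symAlt p 2) {α : ℝ}
    (h0 : 0 ≤ α) (h1 : α ≤ 1 / 4) :
    0 ≤ (swapA ξ).re - α *
      (∑ i, ∑ j, inner ℂ (pairMap p 0 i (ξ j)) (pairMap p 0 j (ξ i))).re +
        ∑ B, ‖fullTrace ξ B‖ ^ 2 := by
  have hS : swapA ξ = ∑ B, ∑ a, ∑ b, ∑ e, ∑ c,
      conj (up ξ c b (icons e (icons a inil), B)) *
        up ξ e b (icons c (icons a inil), B) := by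
    rw [swapA, sum_cons]
    simp only [sum_inil]
    rw [Finset.sum_comm_cycle]
  have hW : ∑ i, ∑ j, inner ℂ (pairMap p 0 i (ξ j)) (pairMap p 0 j (ξ i)) =
      ∑ B, ∑ a, ∑ b, ∑ c, ∑ d, conj (up ξ c d (icons a (icons b inil), B)) *
        up ξ a b (icons c (icons d inil), B) := by
    rw [swapForm_pairMap]
    simp only [sum_inil, Fintype.sum_prod_type]
  rw [hS, hW, Complex.re_sum, Complex.re_sum, Finset.mul_sum, ← Finset.sum_sub_distrib,
    ← Finset.sum_add_distrib]
  refine Finset.sum_nonneg fun B _ => ?_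
  exact antisymm_quadratic_ge (fun a b c d => up ξ a b (icons c (icons d inil), B))
    (fun a b c d => up_swap ξ a b _) (fun a b c d => up_swap_left hξ a b c d _ _) h0 h1

theorem sum_normSq_alt_three (t : Fin 4 → Fin 4 → Fin 4 → ℂ) (h1 : ∀ a b c, t a b c = -t b a c)
    (h2 : ∀ a b c, t a b c = -t a c b) :
    ∑ a, ∑ b, ∑ c, ‖t a b c‖ ^ 2 =
      6 * (‖t 1 2 3‖ ^ 2 + ‖t 0 2 3‖ ^ 2 + ‖t 0 1 3‖ ^ 2 + ‖t 0 1 2‖ ^ 2) := by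
  have z1 : ∀ a c, t a a c = 0 := fun a c => self_eq_neg.1 (h1 a a c)
  have z2 : ∀ a b, t a b b = 0 := fun a b => self_eq_neg.1 (h2 a b b)
  have z3 : ∀ a b, t a b a = 0 := fun a b => by rw [h2, z1, neg_zero]
  have s1 : ∀ a b c, ‖t a b c‖ = ‖t b a c‖ := fun a b c => by rw [h1, norm_neg]
  have s2 : ∀ a b c, ‖t a b c‖ = ‖t a c b‖ := fun a b c => by rw [h2, norm_neg]
  simp only [Fin.sum_univ_four, z1, z2, z3, norm_zero, s1 1 0, s1 2 0, s1 3 0, s1 2 1, s1 3 1,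
    s2 _ 1 0, s2 _ 2 0, s2 _ 3 0, s2 _ 2 1, s2 _ 3 1, s2 _ 3 2]
  ring

theorem altUp_three {n : ℕ} {ξ : Fin 6 → Tens (n + 1) 2} (hξ : ∀ i, ξ i ∈ symAlt (n + 1) 2)
    (a b c : Fin 4) (B : Fin n → Fin 4) :
    3 * altUp ξ (icons a (icons b (icons c inil)), B) =
      gup ξ a (icons b (icons c inil)) B - gup ξ b (icons a (icons c inil)) B -
        gup ξ c (icons b (icons a inil)) B := by
  have e : ((1 : ℕ) : ℂ) + 2 = 3 := by norm_num
  rw [altUp_icons hξ, e, Fin.sum_univ_two]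
  have u1 : Function.update (icons b (icons c inil)) 0 a =
      icons a (icons c inil) :=
    Fin.update_cons_zero _ _ _
  have u2 : Function.update (icons b (icons c inil)) 1 a =
      icons b (icons a inil) := by
    rw [← Fin.succ_zero_eq_one, ← Fin.cons_update]
    congr 1
    exact Fin.update_cons_zero _ _ _
  rw [u1, u2]
  simp only [Fin.cons_zero, Fin.cons_one]
  ring

/-- A given lower index selects the three complementary upper ones; each difference of the two sides
is a combination of traces of `ξ`. -/
theorem fullTrace_eq {n : ℕ} {ξ : Fin 6 → Tens (n + 1) 2} (hξ : ∀ i, ξ i ∈ symAlt (n + 1) 2)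
    (h0 : ∀ i, contraction n 1 (ξ i) = 0) (B : Fin n → Fin 4) :
    (fullTrace ξ (icons 0 B) = -(3 * altUp ξ (icons 1 (icons 2 (icons 3 inil)), B)) ∧
    fullTrace ξ (icons 1 B) = 3 * altUp ξ (icons 0 (icons 2 (icons 3 inil)), B)) ∧
    fullTrace ξ (icons 2 B) = -(3 * altUp ξ (icons 0 (icons 1 (icons 3 inil)), B)) ∧
    fullTrace ξ (icons 3 B) = 3 * altUp ξ (icons 0 (icons 1 (icons 2 inil)), B) := by
  have tr : ∀ a b d, ∑ c, up ξ a b (icons c (icons d inil), icons c B) = 0 := fun a b d =>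
    up_trace hξ h0 a b _ B
  simp only [altUp_three hξ, gup, fullTrace]
  have s1 : ∀ a b c d K, up ξ a b (icons c (icons d inil), K) =
      -up ξ a b (icons d (icons c inil), K) := fun a b c d K => up_swap_left hξ a b c d _ K
  have s0 := fun a b K => up_swap ξ a b K
  have z0 : ∀ a K, up ξ a a K = 0 := fun a K => self_eq_neg.1 (s0 a a K)
  have z1 : ∀ a b c K, up ξ a b (icons c (icons c inil), K) = 0 := fun a b c K =>
    self_eq_neg.1 (s1 a b c c K)
  have t1 := tr 1 2 3
  have t2 := tr 1 3 2
  have t3 := tr 2 3 1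
  have t4 := tr 0 2 3
  have t5 := tr 0 3 2
  have t6 := tr 2 3 0
  have t7 := tr 0 1 3
  have t8 := tr 0 3 1
  have t9 := tr 1 3 0
  have t10 := tr 0 1 2
  have t11 := tr 0 2 1
  have t12 := tr 1 2 0
  generalize up ξ = u at *
  simp only [Fin.sum_univ_four, s1 _ _ 1 0, s1 _ _ 2 0, s1 _ _ 3 0, s1 _ _ 2 1, s1 _ _ 3 1,
    s1 _ _ 3 2, z1] at t1 t2 t3 t4 t5 t6 t7 t8 t9 t10 t11 t12
  simp only [Fin.sum_univ_four, s0 1 0, s0 2 0, s0 3 0, s0 2 1, s0 3 1, s0 3 2, s1 _ _ 1 0,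
    s1 _ _ 2 0, s1 _ _ 2 1, z0]
  refine ⟨⟨?_, ?_⟩, ?_, ?_⟩
  · linear_combination t1 - t2 + t3
  · linear_combination -t4 + t5 - t6
  · linear_combination t7 - t8 + t9
  · linear_combination -t10 + t11 - t12

/-- The factor is `9 / 6`: the square of the `3` in `fullTrace_eq`, divided by the six orderings of
each triple of indices. -/
theorem sum_normSq_fullTrace {n : ℕ} {ξ : Fin 6 → Tens (n + 1) 2}
    (hξ : ∀ i, ξ i ∈ symAlt (n + 1) 2) (h0 : ∀ i, contraction n 1 (ξ i) = 0) :
    ∑ B, ‖fullTrace ξ B‖ ^ 2 = 3 / 2 * ‖altUp ξ‖ ^ 2 := by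
  have hm := altUp_mem hξ
  have hs : ∑ B, ‖fullTrace ξ B‖ ^ 2 = ∑ B, ∑ b, ‖fullTrace ξ (icons b B)‖ ^ 2 := by
    have := sum_cons fun B => ((‖fullTrace ξ B‖ ^ 2 : ℝ) : ℂ)
    rw [Finset.sum_comm] at this
    exact_mod_cast this
  have hn : ‖altUp ξ‖ ^ 2 = ∑ B, ∑ a, ∑ b, ∑ c,
      ‖altUp ξ (icons a (icons b (icons c inil)), B)‖ ^ 2 := by
    apply Complex.ofReal_injective
    rw [normSq_tens, Finset.sum_comm]
    push_cast
    refine Finset.sum_congr rfl fun B _ => ?_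
    simp only [sum_cons, sum_inil, Complex.conj_mul']
  rw [hs, hn, Finset.mul_sum]
  refine Finset.sum_congr rfl fun B _ => ?_
  rw [sum_normSq_alt_three (fun a b c => altUp ξ (icons a (icons b (icons c inil)), B))
    (fun a b c => symAlt_swap_left hm a b _ B) fun a b c => ?_]
  · obtain ⟨⟨e0, e1⟩, e2, e3⟩ := fullTrace_eq hξ h0 B
    rw [Fin.sum_univ_four, e0, e1, e2, e3]
    simp only [norm_neg, norm_mul, Complex.norm_ofNat]
    ring
  · rw [icons_icons b c, symAlt_icons_comp_left hm]
    simp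

theorem normSqGup_re_nonneg {n q : ℕ} (ξ : Fin 6 → Tens (n + 1) q) : 0 ≤ (normSqGup ξ).re := by
  simp only [normSqGup, Complex.re_sum, Complex.conj_mul', ← Complex.ofReal_pow, Complex.ofReal_re]
  positivity

-- Here `(m + 3) β = 1 / (m + 6) ≤ 1/4`. The square of `gup` is discarded, and `3/2` out of the
-- spare `2 ‖altUp‖²` pays for `fullTrace`.
open ContinuousLinearMap in
theorem swapForm_nonneg_two {m : ℕ} (ξ : Fin 6 → Fib (m + 2) 2) :
    0 ≤ swapForm (starFib (m + 2) 1) ξ -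
      (((0 : ℕ) + 1) / (((m + 1 : ℕ) + 5 - (0 : ℕ)) * ((m + 1 : ℕ) + 2)) : ℝ) *
        swapForm (pairFib (m + 2) 0) ξ +
      2 * ‖∑ i, adjoint (thetaMap (m + 1) 2 i) (ξ i)‖ ^ 2 := by
  refine swapForm_nonneg _ _ _ ?_
  have hα : ((m : ℝ) + 3) * (((0 : ℕ) + 1) / (((m + 1 : ℕ) + 5 - (0 : ℕ)) * ((m + 1 : ℕ) + 2))) =
      1 / (m + 6) := by
    push_cast
    have e1 : (m : ℝ) + 1 + 2 = m + 3 := by ring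
    have e2 : (m : ℝ) + 1 + 5 = m + 6 := by ring
    rw [e1, sub_zero, zero_add, e2]
    field_simp
  rw [hα]
  have h1 := swapA_two_ge (fun i => incl_mem (ξ i)) (α := 1 / ((m : ℝ) + 6)) (by positivity) (by
    apply one_div_le_one_div_of_le (by norm_num)
    have : (0 : ℝ) ≤ m := Nat.cast_nonneg m
    linarith)
  rw [sum_normSq_fullTrace (fun i => incl_mem (ξ i)) fun i => incl_contraction (ξ i)] at h1
  have h2 := normSqGup_re_nonneg fun i => incl (m + 2) 2 (ξ i)
  have h3 : 0 ≤ ((m : ℝ) + 2) / ((1 : ℕ) + 1) * (normSqGup fun i => incl (m + 2) 2 (ξ i)).re := by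
    positivity
  have h4 : swapForm (pairFib (m + 2) 0) ξ = (∑ i, ∑ j, inner ℂ
    (pairMap (m + 2) 0 i (incl (m + 2) 2 (ξ j))) (pairMap (m + 2) 0 j (incl (m + 2) 2 (ξ i)))).re :=
    rfl
  rw [h4]
  have h5 := sq_nonneg ‖altUp fun i => incl (m + 2) 2 (ξ i)‖
  linarith

end TwoUpper

/-! ### Degree three. -/

section ThreeUpper

/-- The vector dual to an antisymmetric three-tensor. -/
def dual3 (t : Fin 4 → Fin 4 → Fin 4 → ℂ) : Fin 4 → ℂ :=
  ![-t 1 2 3, t 0 2 3, -t 0 1 3, t 0 1 2]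

/-- An antisymmetric three-tensor is the `ε` symbol contracted with its dual vector. Two shared
indices of a product of two `ε` give `2 (δδ - δδ)`: the norm of the duals and the product of their
traces. -/
theorem alt_three_quadratic (F F' : Fin 4 → Fin 4 → Fin 4 → Fin 4 → Fin 4 → ℂ)
    (h1 : ∀ a b c d e, F a b c d e = -F a b d c e) (h2 : ∀ a b c d e, F a b c d e = -F a b c e d)
    (h1' : ∀ a b c d e, F' a b c d e = -F' a b d c e)
    (h2' : ∀ a b c d e, F' a b c d e = -F' a b c e d) (b : Fin 4) :
    ∑ a, ∑ d, ∑ e, ∑ c, F' c b e a d * F e b c a d =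
      2 * ∑ c, ∑ k, dual3 (F' c b) k * dual3 (F c b) k -
        2 * ((∑ c, dual3 (F' c b) c) * ∑ c, dual3 (F c b) c) := by
  have z1 : ∀ a b c d, F a b c c d = 0 := fun a b c d => self_eq_neg.1 (h1 a b c c d)
  have z2 : ∀ a b c d, F a b c d d = 0 := fun a b c d => self_eq_neg.1 (h2 a b c d d)
  have z3 : ∀ a b c d, F a b c d c = 0 := fun a b c d => by rw [h2, z1, neg_zero]
  have z1' : ∀ a b c d, F' a b c c d = 0 := fun a b c d => self_eq_neg.1 (h1' a b c c d)
  have z2' : ∀ a b c d, F' a b c d d = 0 := fun a b c d => self_eq_neg.1 (h2' a b c d d)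
  have z3' : ∀ a b c d, F' a b c d c = 0 := fun a b c d => by rw [h2', z1', neg_zero]
  simp only [Fin.sum_univ_four, z1, z2, z3, z1', z2', z3', mul_zero, zero_mul, add_zero, zero_add]
  simp only [h1 _ _ 1 0, h1 _ _ 2 0, h1 _ _ 3 0, h1 _ _ 2 1, h1 _ _ 3 1, h1 _ _ 3 2,
    h2 _ _ _ 2 0, h2 _ _ _ 3 0, h2 _ _ _ 2 1, h2 _ _ _ 3 1, h2 _ _ _ 3 2,
    h1' _ _ 1 0, h1' _ _ 2 0, h1' _ _ 3 0, h1' _ _ 2 1, h1' _ _ 3 1, h1' _ _ 3 2,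
    h2' _ _ _ 2 0, h2' _ _ _ 3 0, h2' _ _ _ 2 1, h2' _ _ _ 3 1, h2' _ _ _ 3 2,
    neg_mul, mul_neg, neg_neg, dual3, Matrix.cons_val]
  ring

/-- With one shared index the product of two `ε` has six terms. By antisymmetry in the first pair,
two of them give the norm of the duals and four the product of traces. -/
theorem alt_three_pair (F F' : Fin 4 → Fin 4 → Fin 4 → Fin 4 → Fin 4 → ℂ)
    (h0 : ∀ a b c d e, F a b c d e = -F b a c d e) (h0' : ∀ a b c d e, F' a b c d e = -F' b a c d e)
    (h1 : ∀ a b c d e, F a b c d e = -F a b d c e) (h2 : ∀ a b c d e, F a b c d e = -F a b c e d)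
    (h1' : ∀ a b c d e, F' a b c d e = -F' a b d c e)
    (h2' : ∀ a b c d e, F' a b c d e = -F' a b c e d) :
    ∑ a, ∑ b, ∑ c, ∑ d, ∑ e, F' d e b c a * F b c d e a =
      2 * ∑ b, ∑ c, ∑ k, dual3 (F' c b) k * dual3 (F c b) k -
        4 * ∑ b, ((∑ c, dual3 (F' c b) c) * ∑ c, dual3 (F c b) c) := by
  have z0 : ∀ a b c d, F a a b c d = 0 := fun a b c d => self_eq_neg.1 (h0 a a b c d)
  have z1 : ∀ a b c d, F a b c c d = 0 := fun a b c d => self_eq_neg.1 (h1 a b c c d)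
  have z2 : ∀ a b c d, F a b c d d = 0 := fun a b c d => self_eq_neg.1 (h2 a b c d d)
  have z3 : ∀ a b c d, F a b c d c = 0 := fun a b c d => by rw [h2, z1, neg_zero]
  have z0' : ∀ a b c d, F' a a b c d = 0 := fun a b c d => self_eq_neg.1 (h0' a a b c d)
  have z1' : ∀ a b c d, F' a b c c d = 0 := fun a b c d => self_eq_neg.1 (h1' a b c c d)
  have z2' : ∀ a b c d, F' a b c d d = 0 := fun a b c d => self_eq_neg.1 (h2' a b c d d)
  have z3' : ∀ a b c d, F' a b c d c = 0 := fun a b c d => by rw [h2', z1', neg_zero]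
  simp only [Fin.sum_univ_four, z0, z1, z2, z3, z0', z1', z2', z3', mul_zero, zero_mul, add_zero,
    zero_add, dual3, Matrix.cons_val]
  simp only [h0 1 0, h0 2 0, h0 3 0, h0 2 1, h0 3 1, h0 3 2,
    h1 _ _ 1 0, h1 _ _ 2 0, h1 _ _ 3 0, h1 _ _ 2 1, h1 _ _ 3 1, h1 _ _ 3 2,
    h2 _ _ _ 2 0, h2 _ _ _ 3 0, h2 _ _ _ 2 1, h2 _ _ _ 3 1, h2 _ _ _ 3 2,
    h0' 1 0, h0' 2 0, h0' 3 0, h0' 2 1, h0' 3 1, h0' 3 2,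
    h1' _ _ 1 0, h1' _ _ 2 0, h1' _ _ 3 0, h1' _ _ 2 1, h1' _ _ 3 1, h1' _ _ 3 2,
    h2' _ _ _ 2 0, h2' _ _ _ 3 0, h2' _ _ _ 2 1, h2' _ _ _ 3 1, h2' _ _ _ 3 2,
    mul_zero, add_zero, zero_add, neg_zero, neg_mul, mul_neg, neg_neg]
  ring

/-- The contraction of `up ξ` with a first lower index of the dual of the upper indices. -/
def dualTrace {p : ℕ} (ξ : Fin 6 → Tens p 3) (a : Fin 4) (B : Fin p → Fin 4) : ℂ :=
  ∑ d, dual3 (fun x y z => up ξ a d (icons x (icons y (icons z inil)), B)) d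

theorem up_swap_left' {p : ℕ} {ξ : Fin 6 → Tens p 3} (hξ : ∀ i, ξ i ∈ symAlt p 3)
    (a b c d e : Fin 4) (B : Fin p → Fin 4) :
    up ξ a b (icons c (icons d (icons e inil)), B) =
      -up ξ a b (icons c (icons e (icons d inil)), B) := by
  rw [icons_icons d e, icons_comp_succ, up_comp_left hξ]
  simp

theorem dual3_conj (t : Fin 4 → Fin 4 → Fin 4 → ℂ) (k : Fin 4) :
    dual3 (fun x y z => conj (t x y z)) k = conj (dual3 t k) := by
  fin_cases k <;> simp [dual3]

/-- The witness `Φ` is the total squared norm of the duals. Both forms are linear in `Φ` and the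
square of `dualTrace`, so the remaining inequality only compares coefficients. -/
theorem swapA_three {p : ℕ} {ξ : Fin 6 → Tens p 3} (hξ : ∀ i, ξ i ∈ symAlt p 3) :
    ∃ Φ : ℝ, 0 ≤ Φ ∧ (swapA ξ).re = 2 * Φ - 2 * ∑ B, ∑ b, ‖dualTrace ξ b B‖ ^ 2 ∧
      (∑ i, ∑ j, inner ℂ (pairMap p 1 i (ξ j)) (pairMap p 1 j (ξ i))).re =
        2 * Φ - 4 * ∑ B, ∑ b, ‖dualTrace ξ b B‖ ^ 2 := by
  set F : (Fin p → Fin 4) → Fin 4 → Fin 4 → Fin 4 → Fin 4 → Fin 4 → ℂ := fun B a b c d e =>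
    up ξ a b (icons c (icons d (icons e inil)), B) with hF
  have h0 : ∀ B a b c d e, F B a b c d e = -F B b a c d e := fun B a b c d e => up_swap ξ a b _
  have h1 : ∀ B a b c d e, F B a b c d e = -F B a b d c e := fun B a b c d e =>
    up_swap_left hξ a b c d _ B
  have h2 : ∀ B a b c d e, F B a b c d e = -F B a b c e d := fun B a b c d e =>
    up_swap_left' hξ a b c d e B
  have hγ : ∀ B b, ∑ c, dual3 (F B c b) c = -dualTrace ξ b B := fun B b => by
    rw [dualTrace, ← Finset.sum_neg_distrib]
    refine Finset.sum_congr rfl fun c _ => ?_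
    have : F B c b = fun x y z => -F B b c x y z := by
      ext x y z
      exact h0 B c b x y z
    rw [this]
    change _ = -dual3 (F B b c) c
    generalize F B b c = t
    fin_cases c <;> simp [dual3]
  have hS : swapA ξ = ∑ B, ∑ b, ∑ a, ∑ d, ∑ e, ∑ c, conj (F B c b e a d) * F B e b c a d := by
    simp only [swapA, sum_cons (n := 1), sum_cons (n := 0), sum_inil]
    rw [Finset.sum_comm_cycle]
    exact (Finset.sum_congr rfl fun b _ => Finset.sum_comm_cycle).trans Finset.sum_comm
  have hW : ∑ i, ∑ j, inner ℂ (pairMap p 1 i (ξ j)) (pairMap p 1 j (ξ i)) =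
      ∑ B, ∑ a, ∑ b, ∑ c, ∑ d, ∑ e, conj (F B d e b c a) * F B b c d e a := by
    rw [swapForm_pairMap]
    simp only [sum_cons (n := 0), sum_inil, Fintype.sum_prod_type]
    rw [Finset.sum_comm]
  have hn : ∀ z : ℂ, conj z * z = ((‖z‖ ^ 2 : ℝ) : ℂ) := fun z => by simp [Complex.conj_mul']
  have e1 : ∀ B b, ∑ a, ∑ d, ∑ e, ∑ c, conj (F B c b e a d) * F B e b c a d =
      ((2 * ∑ c, ∑ k, ‖dual3 (F B c b) k‖ ^ 2 - 2 * ‖dualTrace ξ b B‖ ^ 2 : ℝ) : ℂ) :=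
    fun B b => by
    refine (alt_three_quadratic (F B) (fun a b c d e => conj (F B a b c d e)) (h1 B) (h2 B)
      (fun a b c d e => by rw [h1, map_neg]) (fun a b c d e => by rw [h2, map_neg]) b).trans ?_
    simp only [dual3_conj, ← map_sum, hn, hγ, norm_neg]
    push_cast
    rfl
  have e2 : ∀ B, ∑ a, ∑ b, ∑ c, ∑ d, ∑ e, conj (F B d e b c a) * F B b c d e a =
      ((2 * ∑ b, ∑ c, ∑ k, ‖dual3 (F B c b) k‖ ^ 2 - 4 * ∑ b, ‖dualTrace ξ b B‖ ^ 2 : ℝ) : ℂ) :=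
    fun B => by
    refine (alt_three_pair (F B) (fun a b c d e => conj (F B a b c d e)) (h0 B)
      (fun a b c d e => by rw [h0, map_neg]) (h1 B) (h2 B)
      (fun a b c d e => by rw [h1, map_neg]) (fun a b c d e => by rw [h2, map_neg])).trans ?_
    simp only [dual3_conj, ← map_sum, hn, hγ, norm_neg]
    push_cast
    rfl
  refine ⟨∑ B, ∑ b, ∑ c, ∑ k, ‖dual3 (F B c b) k‖ ^ 2, by positivity, ?_, ?_⟩
  · rw [hS]
    simp only [e1, ← Complex.ofReal_sum, Complex.ofReal_re, Finset.sum_sub_distrib,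
      ← Finset.mul_sum]
  · rw [hW]
    simp only [e2, ← Complex.ofReal_sum, Complex.ofReal_re, Finset.sum_sub_distrib,
      ← Finset.mul_sum]

/-- Under dualization the trace of `t` becomes the antisymmetric part of a matrix, so trace-freeness
is symmetry. -/
theorem dual3_symm (t : Fin 4 → Fin 4 → Fin 4 → Fin 4 → ℂ)
    (h1 : ∀ x a b c, t x a b c = -t x b a c) (h2 : ∀ x a b c, t x a b c = -t x a c b)
    (h0 : ∀ a b, ∑ c, t c c a b = 0) (k d : Fin 4) : dual3 (t d) k = dual3 (t k) d := by
  have z1 : ∀ a b c, t a b b c = 0 := fun a b c => self_eq_neg.1 (h1 a b b c)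
  have z3 : ∀ a b c, t a b c b = 0 := fun a b c => by rw [h2, z1, neg_zero]
  have t1 := h0 2 3
  have t2 := h0 1 3
  have t3 := h0 1 2
  have t4 := h0 0 3
  have t5 := h0 0 2
  have t6 := h0 0 1
  simp only [Fin.sum_univ_four, z1, z3, h1 _ 1 0, h1 _ 2 0, h1 _ 3 0, h1 _ 2 1, h1 _ 3 1,
    h2 _ _ 2 1, h2 _ _ 3 1, h2 _ _ 3 2] at t1 t2 t3 t4 t5 t6
  fin_cases k <;> fin_cases d <;> simp [dual3]
  all_goals first
    | linear_combination t1 | linear_combination -t1 | linear_combination t2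
    | linear_combination -t2 | linear_combination t3 | linear_combination -t3
    | linear_combination t4 | linear_combination -t4 | linear_combination t5
    | linear_combination -t5 | linear_combination t6 | linear_combination -t6

/-- By `dual3_symm` the lower index contracted in `gup` may be traded for the dual index, so the
dual of `gup` is `dualTrace`; each component is counted in six orderings. -/
theorem normSqGup_three {n : ℕ} {ξ : Fin 6 → Tens (n + 1) 3} (hξ : ∀ i, ξ i ∈ symAlt (n + 1) 3)
    (h0 : ∀ i, contraction n 2 (ξ i) = 0) :
    (normSqGup ξ).re = 6 * ∑ B, ∑ b, ‖dualTrace ξ b B‖ ^ 2 := by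
  have key : ∀ a (B : Fin n → Fin 4),
      ∑ x, ∑ y, ∑ z, ‖gup ξ a (icons x (icons y (icons z inil))) B‖ ^ 2 =
        6 * ∑ k, ‖dualTrace ξ a (icons k B)‖ ^ 2 := fun a B => by
    rw [sum_normSq_alt_three]
    · have hd : ∀ k, dualTrace ξ a (icons k B) =
          dual3 (fun x y z => gup ξ a (icons x (icons y (icons z inil))) B) k := fun k => by
        have hs : ∀ d, dual3 (fun x y z =>
            up ξ a d (icons x (icons y (icons z inil)), icons k B)) d =
            dual3 (fun x y z => up ξ a d (icons x (icons y (icons z inil)), icons d B)) k :=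
          fun d => dual3_symm
            (fun c x y z => up ξ a d (icons x (icons y (icons z inil)), icons c B))
            (fun c x y z => up_swap_left hξ a d x y _ _) (fun c x y z => up_swap_left' hξ a d x y z _)
            (fun x y => up_trace hξ h0 a d _ B) d k
        simp only [dualTrace, hs, gup]
        generalize up ξ a = u
        fin_cases k <;> simp [dual3, Finset.sum_neg_distrib]
      simp only [hd, Fin.sum_univ_four, dual3, Matrix.cons_val, norm_neg]
    · intro x y z
      rw [icons_icons x y, gup_comp_left hξ]
      simp
    · intro x y z
      rw [icons_icons y z, icons_comp_succ, gup_comp_left hξ]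
      simp
  have hs : ∀ a, ∑ B, ‖dualTrace ξ a B‖ ^ 2 =
      ∑ k, ∑ B : Fin n → Fin 4, ‖dualTrace ξ a (icons k B)‖ ^ 2 := fun a => by
    have := sum_cons fun B => ((‖dualTrace ξ a B‖ ^ 2 : ℝ) : ℂ)
    exact_mod_cast this
  have hn : ∀ z : ℂ, conj z * z = ((‖z‖ ^ 2 : ℝ) : ℂ) := fun z => by simp [Complex.conj_mul']
  rw [Finset.sum_comm, Finset.mul_sum]
  simp only [hs]
  have hG : normSqGup ξ = ∑ a, ∑ B, ∑ A, conj (gup ξ a A B) * gup ξ a A B :=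
    Finset.sum_congr rfl fun a _ => Finset.sum_comm
  simp only [hG, sum_cons (n := 2), sum_cons (n := 1), sum_cons (n := 0), sum_inil, hn,
    ← Complex.ofReal_sum, Complex.ofReal_re]
  refine Finset.sum_congr rfl fun a _ => ?_
  refine Eq.trans ?_ (congrArg _ Finset.sum_comm)
  rw [Finset.mul_sum]
  simp only [← key]

-- With `α = 2 / (m + 5) ≤ 1` and `γ` the square of `dualTrace`, the terms add up to `2 (1 - α) Φ +
-- (2 m + 2 + 4 α) γ` and the nonnegative spare: the square of `gup` outweighs the negative term of
-- `swapA`.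
open ContinuousLinearMap in
theorem swapForm_nonneg_three {m : ℕ} (ξ : Fin 6 → Fib (m + 2) 3) :
    0 ≤ swapForm (starFib (m + 2) 2) ξ -
      (((1 : ℕ) + 1) / (((m + 1 : ℕ) + 5 - (1 : ℕ)) * ((m + 1 : ℕ) + 2)) : ℝ) *
        swapForm (pairFib (m + 2) 1) ξ +
      2 * ‖∑ i, adjoint (thetaMap (m + 1) 3 i) (ξ i)‖ ^ 2 := by
  refine swapForm_nonneg _ _ _ ?_
  have hα : ((m : ℝ) + 3) * (((1 : ℕ) + 1) / (((m + 1 : ℕ) + 5 - (1 : ℕ)) * ((m + 1 : ℕ) + 2))) =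
      2 / (m + 5) := by
    push_cast
    have e1 : (m : ℝ) + 1 + 2 = m + 3 := by ring
    have e2 : (m : ℝ) + 1 + 5 - 1 = m + 5 := by ring
    rw [e1, e2, one_add_one_eq_two]
    field_simp
  rw [hα]
  have hm : (0 : ℝ) ≤ m := Nat.cast_nonneg m
  have h0 : 0 ≤ 2 / ((m : ℝ) + 5) := by positivity
  have h1 : 2 / ((m : ℝ) + 5) ≤ 1 := by rw [div_le_one (by positivity)]; linarith
  generalize 2 / ((m : ℝ) + 5) = α at *
  obtain ⟨Φ, hΦ, hA, hW⟩ := swapA_three (fun i => incl_mem (ξ i))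
  have h4 : swapForm (pairFib (m + 2) 1) ξ = (∑ i, ∑ j, inner ℂ
    (pairMap (m + 2) 1 i (incl (m + 2) 3 (ξ j))) (pairMap (m + 2) 1 j (incl (m + 2) 3 (ξ i)))).re :=
    rfl
  rw [h4, hA, hW, normSqGup_three (fun i => incl_mem (ξ i)) fun i => incl_contraction (ξ i)]
  have h5 := sq_nonneg ‖altUp fun i => incl (m + 2) 3 (ξ i)‖
  set γ := ∑ B, ∑ b, ‖dualTrace (fun i => incl (m + 2) 3 (ξ i)) b B‖ ^ 2
  have hγ : 0 ≤ γ := by positivity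
  have e : ((m : ℝ) + 2) / ((2 : ℕ) + 1) * (6 * γ) = 2 * (m + 2) * γ := by
    push_cast
    ring
  rw [e]
  have p1 := mul_nonneg (sub_nonneg.2 h1) hΦ
  have p2 := mul_nonneg h0 hγ
  have p3 := mul_nonneg hm hγ
  linarith

end ThreeUpper

/-! ### Degree one. -/

section OneUpper

/-- Moving the subtracted square to the left makes the product of coefficients symmetric in the two
derivative indices, and the Clifford relation collapses it to twice the norm. -/
theorem clifford_swap (S : Fin 6 → Fin 4 → Fin 4 → ℂ)
    (hS : ∀ i j a c, ∑ b, (S i c b * conj (S j a b) + S j c b * conj (S i a b)) =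
      2 * ((if a = c then 1 else 0) * (if i = j then 1 else 0))) (x : Fin 6 → Fin 4 → ℂ) :
    ∑ b, ∑ e, ∑ c, conj (∑ j, S j c b * x j e) * ∑ i, S i e b * x i c =
      2 * ∑ i, ∑ e, conj (x i e) * x i e -
        ∑ b, conj (∑ i, ∑ c, conj (S i c b) * x i c) * ∑ i, ∑ c, conj (S i c b) * x i c := by
  have h1 : ∀ b, ∑ e, ∑ c, conj (∑ j, S j c b * x j e) * ∑ i, S i e b * x i c =
      ∑ j, ∑ e, ∑ i, ∑ c, S i e b * conj (S j c b) * (conj (x j e) * x i c) := fun b => by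
    simp only [map_sum, map_mul, Finset.sum_mul_sum]
    refine (Finset.sum_congr rfl fun e _ => Finset.sum_comm).trans ?_
    rw [Finset.sum_comm]
    refine Finset.sum_congr rfl fun j _ => Finset.sum_congr rfl fun e _ => ?_
    rw [Finset.sum_comm]
    exact Finset.sum_congr rfl fun i _ => Finset.sum_congr rfl fun c _ => by ring
  have h2 : ∀ b, conj (∑ i, ∑ c, conj (S i c b) * x i c) * ∑ i, ∑ c, conj (S i c b) * x i c =
      ∑ j, ∑ e, ∑ i, ∑ c, S j e b * conj (S i c b) * (conj (x j e) * x i c) := fun b => by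
    simp only [map_sum, map_mul, Complex.conj_conj, Finset.sum_mul]
    refine Finset.sum_congr rfl fun j _ => Finset.sum_congr rfl fun e _ => ?_
    simp only [Finset.mul_sum]
    exact Finset.sum_congr rfl fun i _ => Finset.sum_congr rfl fun c _ => by ring
  rw [eq_sub_iff_add_eq, ← Finset.sum_add_distrib]
  simp only [h1, h2, ← Finset.sum_add_distrib, ← add_mul]
  rw [Finset.sum_comm, Finset.mul_sum]
  refine Finset.sum_congr rfl fun j _ => ?_
  rw [Finset.sum_comm, Finset.mul_sum]
  refine Finset.sum_congr rfl fun e _ => ?_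
  rw [← Finset.sum_comm_cycle]
  simp only [← Finset.sum_mul, hS]
  simp

/-- The sum of the contractions `low i (ξ i)`. -/
def lowSum {p : ℕ} (ξ : Fin 6 → Tens p 1) (b : Fin 4) (B : Fin p → Fin 4) : ℂ :=
  ∑ i, ∑ c, conj (sym i c b) * ξ i (icons c inil, B)

/-- The sum of the squared norms. -/
def normSqSum {p : ℕ} (ξ : Fin 6 → Tens p 1) : ℂ :=
  ∑ B, ∑ i, ∑ e, conj (ξ i (icons e inil, B)) * ξ i (icons e inil, B)

theorem swapA_one {p : ℕ} (ξ : Fin 6 → Tens p 1) :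
    swapA ξ = 2 * normSqSum ξ - ∑ B, ∑ b, conj (lowSum ξ b B) * lowSum ξ b B := by
  rw [swapA, sum_inil, Finset.sum_comm, normSqSum, Finset.mul_sum, ← Finset.sum_sub_distrib]
  refine Finset.sum_congr rfl fun B _ => ?_
  exact clifford_swap sym clifford fun i e => ξ i (icons e inil, B)

/-- A component of `rotMap`. -/
def rotPart {n : ℕ} (i : Fin 6) (η : Tens (n + 1) 1) (a c : Fin 4) (B : Fin n → Fin 4) : ℂ :=
  ∑ b, sym i b a * η (icons c inil, icons b B)

/-- The coefficients of the antisymmetrized contraction of `∇` with a lower index. -/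
def rotMap (n : ℕ) (i : Fin 6) :
    Tens (n + 1) 1 →ₗ[ℂ] EuclideanSpace ℂ ((Fin 4 × Fin 4) × (Fin n → Fin 4)) where
  toFun η := WithLp.toLp 2 fun K => rotPart i η K.1.1 K.1.2 K.2 - rotPart i η K.1.2 K.1.1 K.2
  map_add' ξ η := by
    ext K
    simp only [rotPart, PiLp.add_apply, mul_add, Finset.sum_add_distrib]
    ring
  map_smul' c ξ := by
    ext K
    simp only [rotPart, PiLp.smul_apply, smul_eq_mul, RingHom.id_apply, mul_left_comm _ c,
      ← Finset.mul_sum, mul_sub]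

theorem inner_rotMap {n : ℕ} (i j : Fin 6) (η η' : Tens (n + 1) 1) :
    inner ℂ (rotMap n i η) (rotMap n j η') =
      2 * ∑ B, ∑ a, ∑ c, (conj (rotPart i η a c B) * rotPart j η' a c B -
        conj (rotPart i η a c B) * rotPart j η' c a B) := by
  rw [PiLp.inner_apply, Fintype.sum_prod_type, Fintype.sum_prod_type]
  simp only [RCLike.inner_apply']
  rw [Finset.sum_comm_cycle, Finset.mul_sum]
  refine Finset.sum_congr rfl fun B _ => ?_
  change ∑ a, ∑ c, conj (rotPart i η a c B - rotPart i η c a B) *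
    (rotPart j η' a c B - rotPart j η' c a B) = _
  have h : ∀ a c, conj (rotPart i η a c B - rotPart i η c a B) *
      (rotPart j η' a c B - rotPart j η' c a B) =
      (conj (rotPart i η a c B) * rotPart j η' a c B -
        conj (rotPart i η a c B) * rotPart j η' c a B) +
      (conj (rotPart i η c a B) * rotPart j η' c a B -
        conj (rotPart i η c a B) * rotPart j η' a c B) := fun a c => by
    rw [map_sub]; ring
  simp only [h]
  simp only [Finset.sum_add_distrib (s := Finset.univ (α := Fin 4))]
  rw [two_mul]
  congr 1
  rw [Finset.sum_comm]

theorem sum_rotPart {n : ℕ} (η η' : Tens (n + 1) 1) (a c k l : Fin 4) (B : Fin n → Fin 4) :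
    ∑ i, conj (rotPart i η a c B) * rotPart i η' k l B =
      2 * ((if a = k then
          ∑ b, conj (η (icons c inil, icons b B)) * η' (icons l inil, icons b B) else 0) -
        conj (η (icons c inil, icons k B)) * η' (icons l inil, icons a B)) := by
  have h : ∀ i, conj (rotPart i η a c B) * rotPart i η' k l B = ∑ b, ∑ d,
      sym i d k * conj (sym i b a) *
        (conj (η (icons c inil, icons b B)) * η' (icons l inil, icons d B)) := fun i => by
    simp only [rotPart, map_sum, map_mul, Finset.sum_mul_sum]
    exact Finset.sum_congr rfl fun b _ => Finset.sum_congr rfl fun d _ => by ring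
  simp only [h]
  rw [← Finset.sum_comm_cycle]
  simp only [← Finset.sum_mul, sum_sym_conj]
  simp only [mul_sub, sub_mul, Finset.sum_sub_distrib]
  congr 1
  · by_cases hb : a = k
    · simp [hb, Finset.mul_sum]
    · simp [hb, Ne.symm hb]
  · simp

/-- The number `8` is `2 (6 - 2)`: by `sum_rotPart` the direct terms give `2 (4 - 1)`, and the
crossed ones give `2` because `η` is trace-free. -/
theorem sum_normSq_rotMap {n : ℕ} {η : Tens (n + 1) 1} (hη : η ∈ symAlt (n + 1) 1)
    (h0 : contraction n 0 η = 0) : ∑ i, ‖rotMap n i η‖ ^ 2 = 8 * ‖η‖ ^ 2 := by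
  have h : ∀ i, ((‖rotMap n i η‖ ^ 2 : ℝ) : ℂ) = inner ℂ (rotMap n i η) (rotMap n i η) :=
    fun i => by rw [inner_self_eq_norm_sq_to_K]; simp
  have tr : ∀ B, ∑ c, η (icons c inil, icons c B) = 0 := fun B => by
    rw [← symAlt_trace_snoc hη, h0]; simp
  apply Complex.ofReal_injective
  rw [Complex.ofReal_mul, normSq_tens, Complex.ofReal_sum]
  simp only [h, inner_rotMap, ← Finset.mul_sum]
  have key : ∀ B : Fin n → Fin 4, ∑ a, ∑ c, ∑ i, (conj (rotPart i η a c B) * rotPart i η a c B -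
      conj (rotPart i η a c B) * rotPart i η c a B) =
      4 * ∑ a, ∑ c, conj (η (icons c inil, icons a B)) * η (icons c inil, icons a B) :=
    fun B => by
    have t : ∑ a, ∑ c, conj (η (icons c inil, icons c B)) * η (icons a inil, icons a B) = 0 := by
      simp only [← Finset.mul_sum, ← Finset.sum_mul, tr, mul_zero]
    simp only [Finset.sum_sub_distrib, sum_rotPart, if_true, ← Finset.mul_sum, t]
    simp only [Finset.sum_ite_eq, Finset.mem_univ, if_true, Finset.sum_const, Finset.card_univ,
      Fintype.card_fin, nsmul_eq_mul]
    rw [Finset.sum_comm (f := fun a c =>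
      conj (η (icons c inil, icons a B)) * η (icons c inil, icons a B))]
    push_cast
    ring
  have e : ∑ i, ∑ B, ∑ a, ∑ c, (conj (rotPart i η a c B) * rotPart i η a c B -
      conj (rotPart i η a c B) * rotPart i η c a B) = ∑ B : Fin n → Fin 4, ∑ a, ∑ c, ∑ i,
      (conj (rotPart i η a c B) * rotPart i η a c B -
        conj (rotPart i η a c B) * rotPart i η c a B) := by
    rw [Finset.sum_comm]
    exact Finset.sum_congr rfl fun B _ => Finset.sum_comm_cycle.symm
  rw [e]
  simp only [key, sum_cons (n := 0), sum_inil, sum_cons (n := n), ← Finset.mul_sum]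
  rw [Finset.sum_comm_cycle.symm, Finset.sum_comm (γ := Fin 4)]
  push_cast
  ring

/-- The direct terms follow from `clifford_swap` for the conjugate coefficients; in the crossed ones
each contraction becomes a `lowSum`. -/
theorem swap_rotMap {n : ℕ} (ξ : Fin 6 → Tens (n + 1) 1) :
    ∑ i, ∑ j, inner ℂ (rotMap n i (ξ j)) (rotMap n j (ξ i)) =
      2 * (2 * normSqSum ξ - normSqGup ξ -
        ∑ B : Fin n → Fin 4, ∑ e, ∑ d, conj (lowSum ξ d (icons e B)) * lowSum ξ e (icons d B)) := by
  have h1 : ∀ (B : Fin n → Fin 4) c, ∑ a, ∑ i, ∑ j,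
      conj (rotPart i (ξ j) a c B) * rotPart j (ξ i) a c B =
      2 * ∑ i, ∑ e, conj (ξ i (icons c inil, icons e B)) * ξ i (icons c inil, icons e B) -
        ∑ a, conj (gup ξ a (icons c inil) B) * gup ξ a (icons c inil) B := fun B c => by
    have e1 : ∀ a, ∑ i, ∑ j, conj (rotPart i (ξ j) a c B) * rotPart j (ξ i) a c B =
        ∑ e, ∑ d, conj (∑ j, conj (sym j d a) * ξ j (icons c inil, icons e B)) *
          ∑ i, conj (sym i e a) * ξ i (icons c inil, icons d B) := fun a => by
      have := sum_swap_factor (fun i e => conj (sym i e a)) (fun j d => conj (sym j d a))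
        (fun j e => ξ j (icons c inil, icons e B)) fun i d => ξ i (icons c inil, icons d B)
      simp only [Complex.conj_conj] at this
      exact this
    simp only [e1]
    rw [clifford_swap (fun i a b => conj (sym i a b)) (fun i j a c => by
      refine Eq.trans ?_ ((clifford i j c a).trans (by simp only [eq_comm (a := c) (b := a)]))
      simp only [Complex.conj_conj]
      exact Finset.sum_congr rfl fun b _ => by ring)
      fun i e => ξ i (icons c inil, icons e B)]
    congr 1
    refine Finset.sum_congr rfl fun a _ => ?_
    have e2 : ∑ i, ∑ e, conj (conj (sym i e a)) * ξ i (icons c inil, icons e B) =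
        -gup ξ a (icons c inil) B := by
      rw [Finset.sum_comm, gup, ← Finset.sum_neg_distrib]
      refine Finset.sum_congr rfl fun d _ => ?_
      rw [up, ← Finset.sum_neg_distrib]
      refine Finset.sum_congr rfl fun i _ => ?_
      rw [Complex.conj_conj, sym_swap, neg_mul]
    rw [e2, map_neg, neg_mul_neg]
  have h2 : ∀ (B : Fin n → Fin 4), ∑ a, ∑ c, ∑ i, ∑ j,
      conj (rotPart i (ξ j) a c B) * rotPart j (ξ i) c a B =
      ∑ e, ∑ d, conj (lowSum ξ d (icons e B)) * lowSum ξ e (icons d B) := fun B => by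
    have e1 : ∀ a c, ∑ i, ∑ j, conj (rotPart i (ξ j) a c B) * rotPart j (ξ i) c a B =
        ∑ e, ∑ d, conj (∑ j, conj (sym j d c) * ξ j (icons c inil, icons e B)) *
          ∑ i, conj (sym i e a) * ξ i (icons a inil, icons d B) := fun a c => by
      have := sum_swap_factor (fun i e => conj (sym i e a)) (fun j d => conj (sym j d c))
        (fun j e => ξ j (icons c inil, icons e B)) fun i d => ξ i (icons a inil, icons d B)
      simp only [Complex.conj_conj] at this
      exact this
    have e2 : ∀ b B, lowSum ξ b B = -∑ c, ∑ i, conj (sym i b c) * ξ i (icons c inil, B) :=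
      fun b B => by
      rw [lowSum, Finset.sum_comm]
      simp only [sym_swap _ _ b, map_neg, neg_mul, Finset.sum_neg_distrib]
    simp only [e1]
    rw [Finset.sum_comm_cycle]
    refine Finset.sum_congr rfl fun e _ => ?_
    rw [Finset.sum_comm_cycle]
    refine Finset.sum_congr rfl fun d _ => ?_
    rw [e2, e2, map_neg, neg_mul_neg, map_sum, Finset.sum_mul_sum, Finset.sum_comm]
  have L : ∀ B : Fin n → Fin 4, ∑ i, ∑ j, ∑ a, ∑ c,
      (conj (rotPart i (ξ j) a c B) * rotPart j (ξ i) a c B -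
        conj (rotPart i (ξ j) a c B) * rotPart j (ξ i) c a B) =
      ∑ c, ∑ a, ∑ i, ∑ j, conj (rotPart i (ξ j) a c B) * rotPart j (ξ i) a c B -
      ∑ a, ∑ c, ∑ i, ∑ j, conj (rotPart i (ξ j) a c B) * rotPart j (ξ i) c a B := fun B => by
    simp only [Finset.sum_sub_distrib]
    congr 1
    · rw [Finset.sum_comm_cycle]
      refine (Finset.sum_congr rfl fun a _ => ?_).trans Finset.sum_comm
      rw [Finset.sum_comm_cycle]
    · rw [Finset.sum_comm_cycle]
      refine Finset.sum_congr rfl fun a _ => ?_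
      rw [Finset.sum_comm_cycle]
  have n1 : normSqSum ξ = ∑ B : Fin n → Fin 4, ∑ c, ∑ i, ∑ e,
      conj (ξ i (icons c inil, icons e B)) * ξ i (icons c inil, icons e B) := by
    rw [normSqSum, sum_cons, Finset.sum_comm]
    refine Finset.sum_congr rfl fun B _ => ?_
    rw [Finset.sum_comm_cycle]
    exact Finset.sum_congr rfl fun c _ => Finset.sum_comm
  have n2 : normSqGup ξ = ∑ B : Fin n → Fin 4, ∑ c, ∑ a,
      conj (gup ξ a (icons c inil) B) * gup ξ a (icons c inil) B := by
    simp only [normSqGup, sum_cons (n := 0), sum_inil]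
    exact Finset.sum_comm_cycle.trans (Finset.sum_congr rfl fun B _ => Finset.sum_comm)
  simp only [inner_rotMap, ← Finset.mul_sum]
  congr 1
  rw [Finset.sum_comm_cycle, n1, n2, Finset.mul_sum, ← Finset.sum_sub_distrib,
    ← Finset.sum_sub_distrib]
  refine Finset.sum_congr rfl fun B _ => ?_
  rw [L, h2]
  simp only [h1, Finset.sum_sub_distrib, ← Finset.mul_sum]

theorem sum_conj_mul_sub_swap (y : Fin 4 → Fin 4 → ℂ) :
    ∑ d, ∑ b, conj (y d b) * (y d b - y b d) =
      ((‖y 0 1 - y 1 0‖ ^ 2 + ‖y 0 2 - y 2 0‖ ^ 2 + ‖y 0 3 - y 3 0‖ ^ 2 + ‖y 1 2 - y 2 1‖ ^ 2 +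
        ‖y 1 3 - y 3 1‖ ^ 2 + ‖y 2 3 - y 3 2‖ ^ 2 : ℝ) : ℂ) := by
  push_cast
  simp only [← Complex.conj_mul', Fin.sum_univ_four, map_sub]
  ring

theorem conj_sym (i : Fin 6) : ((conj (sym i 0 1) = sym i 2 3 ∧ conj (sym i 0 2) = -sym i 1 3) ∧
    conj (sym i 0 3) = sym i 1 2 ∧ conj (sym i 1 2) = sym i 0 3) ∧
    conj (sym i 1 3) = -sym i 0 2 ∧ conj (sym i 2 3) = sym i 0 1 := by
  fin_cases i <;> simp [sym, iota]

/-- By `sum_conj_mul_sub_swap` each side is the sum of squares of the six entries of an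
antisymmetric matrix. As the coefficients of `∇` are conjugate to their duals and `ξ` is trace-free,
the two matrices are dual to each other, with the same squared entries. -/
theorem lowSum_sub_swap {n : ℕ} {ξ : Fin 6 → Tens (n + 1) 1} (hξ : ∀ i, ξ i ∈ symAlt (n + 1) 1)
    (h0 : ∀ i, contraction n 0 (ξ i) = 0) (B : Fin n → Fin 4) :
    ∑ d, ∑ b, conj (lowSum ξ d (icons b B)) * (lowSum ξ d (icons b B) - lowSum ξ b (icons d B)) =
      ∑ a, ∑ c, conj (gup ξ a (icons c inil) B) *
        (gup ξ a (icons c inil) B - gup ξ c (icons a inil) B) := by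
  have hL : ∀ b K, lowSum ξ b K = ∑ c, ∑ i, conj (sym i c b) * ξ i (icons c inil, K) :=
    fun b K => Finset.sum_comm
  have hd : ∀ K, ((∑ i, conj (sym i 0 1) * ξ i K = up ξ 2 3 K ∧
      ∑ i, conj (sym i 0 2) * ξ i K = -up ξ 1 3 K) ∧
      ∑ i, conj (sym i 0 3) * ξ i K = up ξ 1 2 K ∧ ∑ i, conj (sym i 1 2) * ξ i K = up ξ 0 3 K) ∧
      ∑ i, conj (sym i 1 3) * ξ i K = -up ξ 0 2 K ∧
      ∑ i, conj (sym i 2 3) * ξ i K = up ξ 0 1 K := fun K => by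
    simp only [fun i => (conj_sym i).1.1.1, fun i => (conj_sym i).1.1.2,
      fun i => (conj_sym i).1.2.1, fun i => (conj_sym i).1.2.2, fun i => (conj_sym i).2.1,
      fun i => (conj_sym i).2.2, neg_mul, Finset.sum_neg_distrib, up, and_self]
  have hs : ∀ a b K, ∑ i, conj (sym i a b) * ξ i K = -∑ i, conj (sym i b a) * ξ i K :=
    fun a b K => by
    simp only [sym_swap _ a b, map_neg, neg_mul, Finset.sum_neg_distrib]
  have hz : ∀ a K, ∑ i, conj (sym i a a) * ξ i K = 0 := fun a K => by simp [sym_self]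
  have s0 := fun a b K => up_swap ξ a b K
  have z0 : ∀ a K, up ξ a a K = 0 := fun a K => self_eq_neg.1 (s0 a a K)
  have tr : ∀ a b, ∑ c, up ξ a b (icons c inil, icons c B) = 0 := fun a b =>
    up_trace hξ h0 a b _ B
  have t01 := tr 0 1
  have t02 := tr 0 2
  have t03 := tr 0 3
  have t12 := tr 1 2
  have t13 := tr 1 3
  have t23 := tr 2 3
  have hP : ((lowSum ξ 0 (icons 1 B) - lowSum ξ 1 (icons 0 B) =
        gup ξ 2 (icons 3 inil) B - gup ξ 3 (icons 2 inil) B ∧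
      lowSum ξ 0 (icons 2 B) - lowSum ξ 2 (icons 0 B) =
        -(gup ξ 1 (icons 3 inil) B - gup ξ 3 (icons 1 inil) B)) ∧
      lowSum ξ 0 (icons 3 B) - lowSum ξ 3 (icons 0 B) =
        gup ξ 1 (icons 2 inil) B - gup ξ 2 (icons 1 inil) B ∧
      lowSum ξ 1 (icons 2 B) - lowSum ξ 2 (icons 1 B) =
        gup ξ 0 (icons 3 inil) B - gup ξ 3 (icons 0 inil) B) ∧
      lowSum ξ 1 (icons 3 B) - lowSum ξ 3 (icons 1 B) =
        -(gup ξ 0 (icons 2 inil) B - gup ξ 2 (icons 0 inil) B) ∧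
      lowSum ξ 2 (icons 3 B) - lowSum ξ 3 (icons 2 B) =
        gup ξ 0 (icons 1 inil) B - gup ξ 1 (icons 0 inil) B := by
    simp only [Fin.sum_univ_four] at t01 t02 t03 t12 t13 t23
    simp only [hL, gup, Fin.sum_univ_four (M := ℂ), hz, hs 1 0, hs 2 0, hs 3 0, hs 2 1, hs 3 1,
      hs 3 2, fun K => (hd K).1.1.1, fun K => (hd K).1.1.2, fun K => (hd K).1.2.1,
      fun K => (hd K).1.2.2, fun K => (hd K).2.1, fun K => (hd K).2.2, s0 1 0, s0 2 0, s0 3 0,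
      s0 2 1, s0 3 1, s0 3 2, z0]
    generalize up ξ = u at *
    refine ⟨⟨⟨?_, ?_⟩, ?_, ?_⟩, ?_, ?_⟩
    · linear_combination -t23
    · linear_combination t13
    · linear_combination -t12
    · linear_combination -t03
    · linear_combination t02
    · linear_combination -t01
  obtain ⟨⟨⟨p1, p2⟩, p3, p4⟩, p5, p6⟩ := hP
  rw [sum_conj_mul_sub_swap fun d b => lowSum ξ d (icons b B),
    sum_conj_mul_sub_swap fun a c => gup ξ a (icons c inil) B]
  simp only [p1, p2, p3, p4, p5, p6, norm_neg]
  congr 1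
  ring

/-- `rotMap` on `𝒱`. -/
def rotFib (n : ℕ) (i : Fin 6) :
    Fib (n + 1) 1 →L[ℂ] EuclideanSpace ℂ ((Fin 4 × Fin 4) × (Fin n → Fin 4)) :=
  LinearMap.toContinuousLinearMap ((rotMap n i).comp (incl (n + 1) 1).toLinearMap)

theorem rotFib_apply (n : ℕ) (i : Fin 6) (η : Fib (n + 1) 1) :
    rotFib n i η = rotMap n i (incl (n + 1) 1 η) := rfl

/-- This is the purpose of `rotMap`: its exchanged form contains the same multiple of `normSqSum`,
so the difference involves `lowSum` only through its antisymmetric part, which `lowSum_sub_swap`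
converts into `gup`. -/
theorem swapA_sub_swap_rotMap {n : ℕ} {ξ : Fin 6 → Tens (n + 1) 1}
    (hξ : ∀ i, ξ i ∈ symAlt (n + 1) 1) (h0 : ∀ i, contraction n 0 (ξ i) = 0) :
    swapA ξ - 1 / 2 * ∑ i, ∑ j, inner ℂ (rotMap n i (ξ j)) (rotMap n j (ξ i)) =
      normSqGup ξ - 2 * ((‖altUp ξ‖ ^ 2 : ℝ) : ℂ) := by
  have h1 := sum_gup_swap hξ
  have h2 : ∑ B : Fin n → Fin 4, ∑ d, ∑ b, conj (lowSum ξ d (icons b B)) *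
      (lowSum ξ d (icons b B) - lowSum ξ b (icons d B)) = ∑ B : Fin n → Fin 4, ∑ a, ∑ c,
      conj (gup ξ a (icons c inil) B) * (gup ξ a (icons c inil) B - gup ξ c (icons a inil) B) :=
    Finset.sum_congr rfl fun B _ => lowSum_sub_swap hξ h0 B
  have h3 : ∑ B, ∑ b, conj (lowSum ξ b B) * lowSum ξ b B = ∑ B : Fin n → Fin 4, ∑ d, ∑ b,
      conj (lowSum ξ d (icons b B)) * lowSum ξ d (icons b B) := by
    rw [Finset.sum_comm]
    simp only [sum_cons (n := n)]
    rw [Finset.sum_comm_cycle]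
  have h4 : normSqGup ξ = ∑ B : Fin n → Fin 4, ∑ a, ∑ c,
      conj (gup ξ a (icons c inil) B) * gup ξ a (icons c inil) B := by
    simp only [normSqGup, sum_cons (n := 0), sum_inil]
    exact Finset.sum_comm_cycle
  have h5 : ∑ B : Fin n → Fin 4, ∑ e, ∑ d, conj (lowSum ξ d (icons e B)) * lowSum ξ e (icons d B) =
      ∑ B : Fin n → Fin 4, ∑ d, ∑ b, conj (lowSum ξ d (icons b B)) * lowSum ξ b (icons d B) :=
    Finset.sum_congr rfl fun B _ => Finset.sum_comm
  change _ = normSqGup ξ - _ at h1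
  simp only [sum_inil] at h1
  have h6 : ∑ B : Fin n → Fin 4, ∑ e, ∑ c, conj (gup ξ c (icons e inil) B) *
      gup ξ e (icons c inil) B = ∑ B : Fin n → Fin 4, ∑ a, ∑ c,
        conj (gup ξ a (icons c inil) B) * gup ξ c (icons a inil) B :=
    Finset.sum_congr rfl fun B _ => Finset.sum_comm
  rw [h6] at h1
  simp only [mul_sub, Finset.sum_sub_distrib] at h2
  rw [swapA_one, swap_rotMap, h3, h5]
  rw [← h4] at h2
  push_cast at h1 ⊢
  linear_combination h1 - h2

-- The value of `β` makes `(m + 3) β = 1/2`, as in `swapA_sub_swap_rotMap`; the deficit `-2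
-- ‖altUp‖²` is exactly the spare in `swapForm_nonneg`.
open ContinuousLinearMap in
theorem swapForm_nonneg_one {m : ℕ} (ξ : Fin 6 → Fib (m + 2) 1) :
    0 ≤ swapForm (starFib (m + 2) 0) ξ - (1 / (2 * (m + 3)) : ℝ) * swapForm (rotFib (m + 1)) ξ +
      2 * ‖∑ i, adjoint (thetaMap (m + 1) 1 i) (ξ i)‖ ^ 2 := by
  refine swapForm_nonneg _ _ _ ?_
  have hα : ((m : ℝ) + 3) * (1 / (2 * (m + 3))) = 1 / 2 := by field_simp
  rw [hα]
  have h1 := congrArg Complex.re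
    (swapA_sub_swap_rotMap (fun i => incl_mem (ξ i)) fun i => incl_contraction (ξ i))
  have e1 : (1 / 2 : ℂ) = ((1 / 2 : ℝ) : ℂ) := by norm_num
  have e2 : (2 : ℂ) = ((2 : ℝ) : ℂ) := by norm_num
  rw [e1, Complex.sub_re, Complex.sub_re, Complex.re_ofReal_mul, e2, Complex.re_ofReal_mul,
    Complex.ofReal_re] at h1
  have h4 : swapForm (rotFib (m + 1)) ξ = (∑ i, ∑ j, inner ℂ
    (rotMap (m + 1) i (incl (m + 2) 1 (ξ j))) (rotMap (m + 1) j (incl (m + 2) 1 (ξ i)))).re :=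
    rfl
  rw [h4]
  have h2 := normSqGup_re_nonneg fun i => incl (m + 2) 1 (ξ i)
  have h3 : 0 ≤ ((m : ℝ) + 2) / ((0 : ℕ) + 1) *
      (normSqGup fun i => incl (m + 2) 1 (ξ i)).re := by positivity
  linarith

/-- Equality holds: `(4 n + 16 - 8) / (n + 2) = 4`. -/
theorem const_le_of_starFib_one {n : ℕ} (η : Fib (n + 1) 1) :
    4 * ‖η‖ ^ 2 ≤ 2 * ∑ i, ‖starFib (n + 1) 0 i η‖ ^ 2 -
      (1 / (2 * (n + 2)) : ℝ) * (2 * ∑ i, ‖rotFib n i η‖ ^ 2) := by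
  have h1 := sum_normSq_starMap (incl_mem η) (incl_contraction η)
  have h2 := sum_normSq_rotMap (incl_mem η) (incl_contraction η)
  simp only [LinearIsometry.norm_map, ← starFib_apply, ← rotFib_apply] at h1 h2
  have hS : ∑ i, ‖starFib (n + 1) 0 i η‖ ^ 2 = (2 * n + 8) / (n + 2) * ‖η‖ ^ 2 := by
    field_simp
    linarith
  rw [h2, hS]
  apply le_of_eq
  field_simp
  ring

/-- Tensors without upper indices satisfy no trace condition, so the projection fixes `H` and the
term with `rotFib` is simply given away. -/
theorem normSq_theta_one_ge {n : ℕ} (ζ : Fin 6 → Fib (n + 1) 1) :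
    ‖∑ i, starFib (n + 1) 0 i (ζ i)‖ ^ 2 - (1 / (2 * (n + 2)) : ℝ) * ‖∑ i, rotFib n i (ζ i)‖ ^ 2 ≤
      ‖∑ i, thetaMap (n + 1) 0 i (ζ i)‖ ^ 2 := by
  rw [sum_thetaMap]
  set H := ∑ i, starFib (n + 1) 0 i (ζ i) with hH
  have hm : H ∈ scrV (n + 2) 0 :=
    (symAlt _ _).sum_mem fun i _ => starMap_mem i (incl_mem (ζ i))
  have h : (proj (n + 2) 0 H : Fib (n + 2) 0) = (⟨H, hm⟩ : scrV (n + 2) 0) :=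
    Submodule.orthogonalProjectionOnto_mem_subspace_eq_self (K := scrV (n + 2) 0) ⟨H, hm⟩
  have h2 : ‖proj (n + 2) 0 H‖ = ‖H‖ := by rw [h]; rfl
  rw [h2]
  have : 0 ≤ (1 / (2 * (n + 2)) : ℝ) * ‖∑ i, rotFib n i (ζ i)‖ ^ 2 := by positivity
  linarith

end OneUpper

/-! ### The estimate in all three degrees. -/

section Main

open ContinuousLinearMap in
theorem estimate {m q : ℕ} (hq : q ≤ 2) (f : L2phi (m + 2) (q + 1))
    (h₁ : f ∈ (scrD (m + 1) (q + 1)).domain) (h₂ : f ∈ (scrD (m + 2) q).adjoint.domain) :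
    4 * ‖f‖ ^ 2 ≤ 2 * ‖scrD (m + 1) (q + 1) ⟨f, h₁⟩‖ ^ 2 +
      ‖(scrD (m + 2) q).adjoint ⟨f, h₂⟩‖ ^ 2 := by
  refine estimate_of_apriori (by norm_num) (by norm_num) (fun w hw => ?_) f h₁ h₂
  obtain _ | _ | _ | q := q
  · refine apriori_of_pointwise (fun i => thetaMap (m + 2) 0 i)
      (fun i => adjoint (thetaMap (m + 1) 1 i)) (fun i => starFib (m + 2) 0 i)
      (fun i => rotFib (m + 1) i) normSq_theta_one_ge (fun ξ => ?_) const_le_of_starFib_one hw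
    have := swapForm_nonneg_one ξ
    have e : ((m + 1 : ℕ) : ℝ) + 2 = m + 3 := by push_cast; ring
    rwa [e]
  · exact apriori_of_pointwise (fun i => thetaMap (m + 2) 1 i)
      (fun i => adjoint (thetaMap (m + 1) 2 i)) (fun i => starFib (m + 2) 1 i)
      (fun i => pairFib (m + 2) 0 i) (normSq_theta_ge (by omega)) swapForm_nonneg_two
      (const_le_of_starFib (by omega)) hw
  · exact apriori_of_pointwise (fun i => thetaMap (m + 2) 2 i)
      (fun i => adjoint (thetaMap (m + 1) 3 i)) (fun i => starFib (m + 2) 2 i)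
      (fun i => pairFib (m + 2) 1 i) (normSq_theta_ge (by omega)) swapForm_nonneg_three
      (const_le_of_starFib (by omega)) hw
  · omega

end Main

end Monogenic

end

theorem mainTheorem2 (k : ℕ) (hk : 6 ≤ k) :
    ∃ C : ℝ, 0 < C ∧
      -- `l = j + 1` is one of `1, 2, 3`, and `p + 1 = k - l`
      ∀ p j : ℕ, (p + 1) + (j + 1) = k → j + 1 ≤ 3 →
        ∀ (f : L2phi (p + 1) (j + 1))
          (h₁ : f ∈ (scrD p (j + 1)).domain)
          (h₂ : f ∈ (scrD (p + 1) j).adjoint.domain),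
          ‖f‖ ^ 2 ≤ C * (‖scrD p (j + 1) ⟨f, h₁⟩‖ ^ 2 +
            ‖(scrD (p + 1) j).adjoint ⟨f, h₂⟩‖ ^ 2) := by
  -- Dividing `4 ‖f‖² ≤ 2 ‖𝒟f‖² + ‖𝒟^*f‖²` by `4` leaves coefficients at most `1/2`.
  refine ⟨1 / 2, by norm_num, fun p j hpj hj f h₁ h₂ => ?_⟩
  -- The bounds `k ≥ 6` and `l ≤ 3` give `p ≥ 2`. The estimate is stated for `p ≥ 1`, where values
  -- of `𝒟` keep a lower index and a trace condition.
  obtain ⟨m, rfl⟩ : ∃ m, p = m + 1 := ⟨p - 1, by omega⟩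
  have h := estimate (by omega) f h₁ h₂
  have h2 := sq_nonneg ‖(scrD (m + 1 + 1) j).adjoint ⟨f, h₂⟩‖
  linarith
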